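/- Let $M$ be a compact connected Riemann surface with an anti-conformal involution $J:M\to M$. Let $\Gamma_M$ be the fixed point set of $J$, and assume that $M$ is of dividing type, i.e. that $M\setminus\Gamma_M$ has exactly two connected components; let $M_+$ be one of them. Let $f$ be a non-constant meromorphic function on $M$ without zeros and poles on $\partial M_+$, and let $f^*=\overline{f\circ J}$. Let $h$ be a holomorphic function on $M_+$ that is integrable with respect to the pull-back by $f$ of the spherical area measure, i.e. with respect to the measure on $M_+$ given by the nonnegative $2$-form $\frac{1}{2\pi \mathrm{i}}\frac{d\bar f\wedge df}{(1+|f|^2)^2}$. Then $$ \frac{1}{2\pi \mathrm{i}}\int_{M_+} h\,\frac{d\bar f\wedge df}{(1+|f|^2)^2} =-\sum_{M_+}\operatorname{Res}\frac{h\,df}{f(1+ff^*)}+\sum_{\omega_k\in M_+}h(\omega_k) =\sum_{M_+}\operatorname{Res}\frac{h f^*\,df}{1+ff^*}+\sum_{\xi_j\in M_+}h(\xi_j). $$ Here the first sum in each expression is over the singular points in $M_+$ of the indicated differential, $\omega_k$ and $\xi_j$ are the zeros and the poles of $f$, repeated according to multiplicity, and all sums are finite. Suppose in addition that $f^*$ does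 not vanish at any pole of $f$ in $M_+$ and that $f$ does not vanish at any pole of $f^*$ in $M_+$. Then the explicit terms cancel: at each point $p\in M_+$ with $1+f(p)f^*(p)\neq 0$ (a pole of $1+ff^*$ is also counted here), the residue of $\frac{h\,df}{f(1+ff^*)}$ is $h(p)$ times the multiplicity of $p$ as a zero of $f$, and the residue of $\frac{hf^*\,df}{1+ff^*}$ is $-h(p)$ times the multiplicity of $p$ as a pole of $f$ (a multiplicity being $0$ if $p$ is no zero, respectively no pole). Consequently $$ \frac{1}{2\pi \mathrm{i}}\int_{M_+} h\,\frac{d\bar f\wedge df}{(1+|f|^2)^2} =-\sum_{1+ff^*=0}\operatorname{Res}\Big(\frac{h}{1+ff^*}\cdot\frac{df}{f}\Big) =\sum_{1+ff^*=0}\operatorname{Res}\Big(\frac{h}{1+ff^*}\cdot f^*\,df\Big), $$ where the sums are over the points of $M_+$ at which $1+ff^*=0$. -/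

import Mathlib

open Complex MeasureTheory Filter Topology Function
open scoped Manifold ContDiff ComplexConjugate

noncomputable section

namespace RiemannSurface

/-- The residue at `z₀` of a function `g` that is meromorphic at `z₀`, that is
`(2πi)⁻¹ ∮ g(z) dz` over all sufficiently small circles around `z₀`, written as a limit. -/
def residue (g : ℂ → ℂ) (z₀ : ℂ) : ℂ :=
  limUnder (𝓝[>] (0 : ℝ)) fun r => (2 * Real.pi * I)⁻¹ * ∮ z in C(z₀, r), g z

/-- The set of connected components of a subset `S` of a topological space. -/
def components {X : Type*} [TopologicalSpace X] (S : Set X) : Set (Set X) :=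
  connectedComponentIn S '' S

variable {M : Type*} [TopologicalSpace M] [ChartedSpace ℂ M]

/-- `f` in the local coordinate at `p`. -/
def inChart (f : M → ℂ) (p : M) : ℂ → ℂ := fun z => f ((chartAt ℂ p).symm z)

/-- The coordinate of `p` in the chart at `p`. -/
def coord (p : M) : ℂ := chartAt ℂ p p

/-- `f` is a meromorphic function on `M`. As everywhere in Mathlib, a meromorphic function is a
`ℂ`-valued function whose values at its poles (and on a discrete set of points) are irrelevant. -/
def IsMeromorphic (f : M → ℂ) : Prop := ∀ p : M, MeromorphicAt (inChart f p) (coord p)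

/-- The order of a meromorphic function at `p`: `n > 0` at a zero of multiplicity `n`, `-n < 0` at
a pole of multiplicity `n`, `⊤` if the function vanishes identically near `p`. -/
def orderAt (f : M → ℂ) (p : M) : WithTop ℤ := meromorphicOrderAt (inChart f p) (coord p)

/-- The multiplicity of `p` as a zero of `f` (`0` if `p` is not a zero). -/
def zeroMult (f : M → ℂ) (p : M) : ℕ := (orderAt f p).untop₀.toNat

/-- The multiplicity of `p` as a pole of `f` (`0` if `p` is not a pole). -/
def poleMult (f : M → ℂ) (p : M) : ℕ := (-(orderAt f p).untop₀).toNat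

/-- The coefficient of the differential `a df` with respect to `dz`, `z` the coordinate at `p`. -/
def formCoeff (a f : M → ℂ) (p : M) : ℂ → ℂ := fun z => inChart a p z * deriv (inChart f p) z

/-- The residue at `p` of the meromorphic differential `a df`. -/
def formResidue (a f : M → ℂ) (p : M) : ℂ := residue (formCoeff a f p) (coord p)

/-- The singular points (poles) in `U` of the meromorphic differential `a df`. -/
def formSingularPoints (a f : M → ℂ) (U : Set M) : Set M :=
  {p ∈ U | meromorphicOrderAt (formCoeff a f p) (coord p) < 0}

/-- `J` is antiholomorphic: it is continuous, and in local coordinates its complex conjugate is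
complex differentiable at every point. -/
def IsAntiholomorphic (J : M → M) : Prop :=
  Continuous J ∧ ∀ p : M, DifferentiableAt ℂ
    (fun z => conj (chartAt ℂ (J p) (J ((chartAt ℂ p).symm z)))) (coord p)

/-- The reflected function `f^* = conj (f ∘ J)`. -/
def reflect (J : M → M) (f : M → ℂ) : M → ℂ := fun p => conj (f (J p))

/-- The density, with respect to `dx dy` in a coordinate `z = x + iy`, of
`(2πi)⁻¹ dF̄ ∧ dF / (1 + |F|²)²`. Since `dF̄ ∧ dF = |F'|² dz̄ ∧ dz = 2i |F'|² dx ∧ dy`, it is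
`|F'|² / (π (1 + |F|²)²)`. -/
def sphericalDensity (F : ℂ → ℂ) (z : ℂ) : ENNReal :=
  ENNReal.ofReal (‖deriv F z‖ ^ 2 / (Real.pi * (1 + ‖F z‖ ^ 2) ^ 2))

/-- The pull-back by `f` of the spherical area measure, that is the measure on `M` given by the
nonnegative 2-form `(2πi)⁻¹ df̄ ∧ df / (1 + |f|²)²`. In each chart `e` the 2-form gives a measure on
the domain of `e`; these measures agree on overlaps, and their least upper bound is the measure on
`M` that restricts to each of them. -/
def sphericalMeasure [MeasurableSpace M] (f : M → ℂ) : Measure M :=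
  ⨆ e ∈ atlas ℂ M, Measure.map e.symm
    ((volume.restrict e.target).withDensity (sphericalDensity fun z => f (e.symm z)))

end RiemannSurface

end

open RiemannSurface

/-! ### Calculus of `∂/∂z̄` and integration by parts in the plane. -/

namespace RiemannSurface

/-! The spherical area form has, up to a constant, the primitive `f̄ df / (1 + |f|²)` away from the
poles of `f`; in a coordinate this says that `∂/∂z̄` of `sphPrim` is `sphDens` (`dbar_sphPrim`). On
the boundary of `M₊` the involution is the identity, so `f* = f̄` there and the primitive agrees
with the meromorphic differential `f* df / (1 + f f*)`, whose coefficient is `merPrim`. Stokes'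
theorem for `h (sphPrim - merPrim) dz` therefore has no boundary integral, and only isolated
singularities contribute: the residues of `h f* df / (1 + f f*)`, and the poles of `f`. At a pole
`sphPrim f = f'/f + sphPrim (1/f)` with a regular last term (`sphPrim_inv`), which yields the
multiplicity times `h`. This is the second formula. The first follows from `h df / (f (1 + f f*)) +
h f* df / (1 + f f*) = h df / f`, whose residue at `p` is the order of `f` times `h(p)`
(`residue_add_residue`). The cancellations in the last part come from counting orders
(`residue_of_order_nonpos`, `eq_zero_of_order_pos`).

Stokes' theorem does not apply directly, because `h` is only integrable on `M₊` and need not extend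
to the boundary. Near the boundary the test function is multiplied by `φ(n |f̄ - f*|²)`, which
vanishes close to the boundary. The derivative of this cutoff is large, but it multiplies `sphPrim -
merPrim`, which contains the factor `f̄ - f*`. The product is bounded, uniformly in `n`, by a
multiple of `|f'|²`, hence of the area density, and dominated convergence removes the cutoff
(`BoundaryData.integral_mul_sphDens`).

The surface is treated with a partition of unity. For `ρ` supported in a chart, Green's formula for
`ρ h` has the error `∫ ∂̄ρ ∧ h (sphPrim - merPrim) dz`. Written as the integral of a
chart-independent function, these errors add up to zero since `∂̄ 1 = 0` (`sum_boundaryTerm`,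
`integral_eq_sum_residueTerm`). -/

/-- The Wirtinger derivative `∂φ/∂z̄`. -/
noncomputable def dbar (φ : ℂ → ℂ) (z : ℂ) : ℂ := (fderiv ℝ φ z 1 + I * fderiv ℝ φ z I) / 2

lemma dbar_congr {φ ψ : ℂ → ℂ} {z : ℂ} (h : φ =ᶠ[𝓝 z] ψ) : dbar φ z = dbar ψ z := by
  rw [dbar, dbar, h.fderiv_eq]

lemma dbar_const (c z : ℂ) : dbar (fun _ => c) z = 0 := by
  simp [dbar]

lemma dbar_mul {φ ψ : ℂ → ℂ} {z : ℂ} (hφ : DifferentiableAt ℝ φ z)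
    (hψ : DifferentiableAt ℝ ψ z) :
    dbar (fun w => φ w * ψ w) z = dbar φ z * ψ z + φ z * dbar ψ z := by
  simp only [dbar, fderiv_fun_mul hφ hψ]
  simp
  ring

lemma dbar_add {φ ψ : ℂ → ℂ} {z : ℂ} (hφ : DifferentiableAt ℝ φ z)
    (hψ : DifferentiableAt ℝ ψ z) :
    dbar (fun w => φ w + ψ w) z = dbar φ z + dbar ψ z := by
  simp only [dbar, fderiv_fun_add hφ hψ]
  simp
  ring

lemma dbar_sub {φ ψ : ℂ → ℂ} {z : ℂ} (hφ : DifferentiableAt ℝ φ z)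
    (hψ : DifferentiableAt ℝ ψ z) :
    dbar (fun w => φ w - ψ w) z = dbar φ z - dbar ψ z := by
  simp only [dbar, fderiv_fun_sub hφ hψ]
  simp
  ring

lemma dbar_sum {ι : Type*} (t : Finset ι) {φ : ι → ℂ → ℂ} {z : ℂ}
    (hφ : ∀ i ∈ t, DifferentiableAt ℝ (φ i) z) :
    dbar (fun w => ∑ i ∈ t, φ i w) z = ∑ i ∈ t, dbar (φ i) z := by
  simp only [dbar, fderiv_fun_sum hφ]
  simp [Finset.mul_sum, Finset.sum_add_distrib, ← Finset.sum_div]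

lemma dbar_of_differentiableAt {φ : ℂ → ℂ} {z : ℂ} (hφ : DifferentiableAt ℂ φ z) :
    dbar φ z = 0 := by
  have h := hφ.hasDerivAt.complexToReal_fderiv.fderiv
  simp only [dbar, h]
  simp
  linear_combination (deriv φ z) * I_mul_I

lemma dbar_conj {φ : ℂ → ℂ} {z : ℂ} (hφ : DifferentiableAt ℂ φ z) :
    dbar (fun w => conj (φ w)) z = conj (deriv φ z) := by
  have h := hφ.hasDerivAt.complexToReal_fderiv
  have h2 := (conjCLE.hasFDerivAt (x := φ z)).comp z h
  have h3 : fderiv ℝ (fun w => conj (φ w)) z = _ := h2.fderiv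
  simp only [dbar, h3]
  simp
  linear_combination (-conj (deriv φ z)) * I_mul_I / 2

/-- Chain rule for a holomorphic inner function. -/
lemma dbar_comp {φ T : ℂ → ℂ} {z : ℂ} (hφ : DifferentiableAt ℝ φ (T z))
    (hT : DifferentiableAt ℂ T z) :
    dbar (fun w => φ (T w)) z = dbar φ (T z) * conj (deriv T z) := by
  have h := hT.hasDerivAt.complexToReal_fderiv
  have h2 := hφ.hasFDerivAt.comp z h
  have h3 : fderiv ℝ (fun w => φ (T w)) z = _ := h2.fderiv
  simp only [dbar, h3]
  set L := fderiv ℝ φ (T z)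
  set a := deriv T z
  have hL : ∀ v : ℂ, L v = v.re * L 1 + v.im * L I := by
    intro v
    conv_lhs => rw [show v = v.re • (1 : ℂ) + v.im • I by simp]
    rw [map_add, map_smul, map_smul]
    simp
  have h4 : conj a = a.re - a.im * I := by
    apply Complex.ext <;> simp
  simp only [ContinuousLinearMap.comp_apply, smul_apply,
    one_apply_eq_self, smul_eq_mul]
  rw [hL (a * 1), hL (a * I), h4]
  simp
  linear_combination (a.im * L I) * I_mul_I / 2

/-- Chain rule for a holomorphic outer function. -/
lemma dbar_comp_left {g φ : ℂ → ℂ} {z : ℂ} (hg : DifferentiableAt ℂ g (φ z))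
    (hφ : DifferentiableAt ℝ φ z) :
    dbar (fun w => g (φ w)) z = deriv g (φ z) * dbar φ z := by
  have h := hg.hasDerivAt.complexToReal_fderiv
  have h2 := h.comp z hφ.hasFDerivAt
  have h3 : fderiv ℝ (fun w => g (φ w)) z = _ := h2.fderiv
  simp only [dbar, h3]
  simp
  ring

lemma dbar_inv {φ : ℂ → ℂ} {z : ℂ} (hφ : DifferentiableAt ℝ φ z) (h0 : φ z ≠ 0) :
    dbar (fun w => (φ w)⁻¹) z = -dbar φ z / φ z ^ 2 := by
  rw [dbar_comp_left (g := fun w => w⁻¹) (differentiableAt_inv h0) hφ, deriv_inv]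
  ring

lemma norm_dbar_le (φ : ℂ → ℂ) (z : ℂ) : ‖dbar φ z‖ ≤ ‖fderiv ℝ φ z‖ := by
  have h1 := (fderiv ℝ φ z).le_opNorm 1
  have h2 := (fderiv ℝ φ z).le_opNorm I
  simp only [norm_one, mul_one, norm_I] at h1 h2
  rw [dbar, norm_div]
  have := norm_add_le (fderiv ℝ φ z 1) (I * fderiv ℝ φ z I)
  rw [norm_mul, norm_I, one_mul] at this
  simp only [RCLike.norm_ofNat]
  linarith

lemma continuousOn_dbar {φ : ℂ → ℂ} {U : Set ℂ} (hU : IsOpen U) (hφ : ContDiffOn ℝ 1 φ U) :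
    ContinuousOn (dbar φ) U := by
  have h := hφ.continuousOn_fderiv_of_isOpen hU le_rfl
  unfold dbar
  fun_prop

lemma dbar_eq_zero_of_notMem_tsupport {φ : ℂ → ℂ} {z : ℂ} (hz : z ∉ tsupport φ) :
    dbar φ z = 0 := by
  rw [dbar_congr (notMem_tsupport_iff_eventuallyEq.mp hz)]
  exact dbar_const 0 z

lemma tsupport_dbar_subset (φ : ℂ → ℂ) : tsupport (dbar φ) ⊆ tsupport φ :=
  closure_minimal (fun _ hz => by
    by_contra hz'
    exact hz (dbar_eq_zero_of_notMem_tsupport hz')) (isClosed_tsupport φ)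

lemma integral_dbar_eq_zero {φ : ℂ → ℂ} (hφ : ContDiff ℝ 1 φ) (hc : HasCompactSupport φ) :
    ∫ z, dbar φ z = 0 := by
  have hi : ∀ v : ℂ, Integrable (fun z => fderiv ℝ φ z v) := fun v =>
    ((hφ.continuous_fderiv one_ne_zero).clm_apply continuous_const).integrable_of_hasCompactSupport
      (hc.fderiv_apply ℝ v)
  have hz : ∀ v : ℂ, ∫ z, fderiv ℝ φ z v = 0 := by
    intro v
    have h := integral_mul_fderiv_eq_neg_fderiv_mul_of_integrable (μ := volume) (𝕜 := ℂ)
      (f := fun _ : ℂ => (1 : ℂ)) (g := φ) (v := v) (by simp) (by simpa using hi v)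
      (by simpa using hφ.continuous.integrable_of_hasCompactSupport hc)
      (fun x _ => differentiableAt_const _)
      (fun x _ => hφ.differentiable one_ne_zero x)
    simpa using h
  simp only [dbar]
  rw [integral_div, integral_add (hi 1) ((hi I).const_mul I), integral_const_mul, hz, hz]
  simp

/-- A product of a compactly supported function with a function that is regular near the support
is regular. -/
lemma contDiff_mul_of_tsupport_subset {ρ Φ : ℂ → ℂ} {U : Set ℂ} (hU : IsOpen U)
    (hρ : ContDiff ℝ 1 ρ) (hs : tsupport ρ ⊆ U) (hΦ : ContDiffOn ℝ 1 Φ U) :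
    ContDiff ℝ 1 fun z => ρ z * Φ z := by
  rw [contDiff_iff_contDiffAt]
  intro z
  by_cases hz : z ∈ U
  · exact hρ.contDiffAt.mul (hΦ.contDiffAt (hU.mem_nhds hz))
  · have : (fun z => ρ z * Φ z) =ᶠ[𝓝 z] fun _ => 0 := by
      filter_upwards [notMem_tsupport_iff_eventuallyEq.mp fun h => hz (hs h)] with w hw
      simp [hw]
    exact contDiffAt_const.congr_of_eventuallyEq this

lemma continuous_mul_of_tsupport_subset {ρ Φ : ℂ → ℂ} {U : Set ℂ} (hU : IsOpen U)
    (hρ : Continuous ρ) (hs : tsupport ρ ⊆ U) (hΦ : ContinuousOn Φ U) :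
    Continuous fun z => ρ z * Φ z := by
  rw [continuous_iff_continuousAt]
  intro z
  by_cases hz : z ∈ U
  · exact hρ.continuousAt.mul (hΦ.continuousAt (hU.mem_nhds hz))
  · have : (fun z => ρ z * Φ z) =ᶠ[𝓝 z] fun _ => 0 := by
      filter_upwards [notMem_tsupport_iff_eventuallyEq.mp fun h => hz (hs h)] with w hw
      simp [hw]
    exact continuousAt_const.congr this.symm

lemma integrable_mul_of_tsupport_subset {ρ Φ : ℂ → ℂ} {U : Set ℂ} (hU : IsOpen U)
    (hρ : Continuous ρ) (hc : HasCompactSupport ρ) (hs : tsupport ρ ⊆ U)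
    (hΦ : ContinuousOn Φ U) : Integrable fun z => ρ z * Φ z :=
  (continuous_mul_of_tsupport_subset hU hρ hs hΦ).integrable_of_hasCompactSupport hc.mul_right

lemma integrable_dbar_mul {ρ Φ : ℂ → ℂ} {U : Set ℂ} (hU : IsOpen U)
    (hρ : ContDiff ℝ 1 ρ) (hc : HasCompactSupport ρ) (hs : tsupport ρ ⊆ U)
    (hΦ : ContinuousOn Φ U) : Integrable fun z => dbar ρ z * Φ z :=
  integrable_mul_of_tsupport_subset hU
    (continuousOn_univ.mp (continuousOn_dbar isOpen_univ hρ.contDiffOn))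
    (hc.of_isClosed_subset (isClosed_tsupport _) (tsupport_dbar_subset ρ))
    ((tsupport_dbar_subset ρ).trans hs) hΦ

/-- Integration by parts for `∂/∂z̄`. -/
lemma integral_mul_dbar {ρ Φ : ℂ → ℂ} {U : Set ℂ} (hU : IsOpen U)
    (hρ : ContDiff ℝ 1 ρ) (hc : HasCompactSupport ρ) (hs : tsupport ρ ⊆ U)
    (hΦ : ContDiffOn ℝ 1 Φ U) :
    ∫ z, ρ z * dbar Φ z = -∫ z, dbar ρ z * Φ z := by
  have h := integral_dbar_eq_zero (contDiff_mul_of_tsupport_subset hU hρ hs hΦ) hc.mul_right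
  have h1 : ∀ z, dbar (fun w => ρ w * Φ w) z = dbar ρ z * Φ z + ρ z * dbar Φ z := by
    intro z
    by_cases hz : z ∈ U
    · exact dbar_mul (hρ.differentiable one_ne_zero z)
        ((hΦ.contDiffAt (hU.mem_nhds hz)).differentiableAt one_ne_zero)
    · have h0 : z ∉ tsupport ρ := fun h => hz (hs h)
      have h2 : (fun w => ρ w * Φ w) =ᶠ[𝓝 z] fun _ => 0 := by
        filter_upwards [notMem_tsupport_iff_eventuallyEq.mp h0] with w hw
        simp [hw]
      rw [dbar_congr h2, dbar_const, dbar_eq_zero_of_notMem_tsupport h0, image_eq_zero_of_notMem_tsupport h0]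
      simp
  simp only [h1] at h
  rw [integral_add (integrable_dbar_mul hU hρ hc hs hΦ.continuousOn)
    (integrable_mul_of_tsupport_subset hU hρ.continuous hc hs (continuousOn_dbar hU hΦ))] at h
  linear_combination h

end RiemannSurface

/-! ### Residues as limits of circle integrals. -/

namespace RiemannSurface

lemma exists_ball_of_eventually_punctured {z₀ : ℂ} {p : ℂ → Prop} (h : ∀ᶠ z in 𝓝[≠] z₀, p z) :
    ∃ R > 0, ∀ z ∈ Metric.ball z₀ R \ {z₀}, p z := by
  rw [eventually_nhdsWithin_iff, Metric.eventually_nhds_iff_ball] at h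
  obtain ⟨R, hR, h⟩ := h
  exact ⟨R, hR, fun z hz => h z hz.1 hz.2⟩

/-- On small circles the circle integral is `2πi` times the residue. -/
lemma circleIntegral_eq_residue {m : ℂ → ℂ} {z₀ : ℂ} {R r : ℝ}
    (hm : DifferentiableOn ℂ m (Metric.ball z₀ R \ {z₀})) (h0 : 0 < r) (hr : r < R) :
    (∮ z in C(z₀, r), m z) = 2 * Real.pi * I * residue m z₀ := by
  have hop : IsOpen (Metric.ball z₀ R \ {z₀}) := Metric.isOpen_ball.sdiff isClosed_singleton
  -- Cauchy's theorem on annuli makes the expression in the limit eventually constant.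
  have key : ∀ s t : ℝ, 0 < s → s ≤ t → t < R →
      (∮ z in C(z₀, t), m z) = ∮ z in C(z₀, s), m z := by
    intro s t hs hst ht
    refine circleIntegral_eq_of_differentiable_on_annulus_off_countable hs hst
      (s := ∅) Set.countable_empty ?_ ?_
    · refine hm.continuousOn.mono fun z hz => ⟨?_, ?_⟩
      · exact Metric.closedBall_subset_ball ht hz.1
      · rintro rfl
        exact hz.2 (Metric.mem_ball_self hs)
    · intro z hz
      refine hm.differentiableAt (hop.mem_nhds ⟨?_, ?_⟩)
      · exact Metric.ball_subset_ball ht.le hz.1.1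
      · rintro rfl
        exact hz.1.2 (Metric.mem_closedBall_self hs.le)
  have hlim : Tendsto (fun s : ℝ => (2 * Real.pi * I)⁻¹ * ∮ z in C(z₀, s), m z)
      (𝓝[>] (0 : ℝ)) (𝓝 ((2 * Real.pi * I)⁻¹ * ∮ z in C(z₀, r), m z)) := by
    refine tendsto_const_nhds.congr' ?_
    filter_upwards [Ioo_mem_nhdsGT h0] with s hs
    rw [key s r hs.1 hs.2.le hr]
  rw [residue, hlim.limUnder_eq, ← mul_assoc, mul_inv_cancel₀ two_pi_I_ne_zero, one_mul]

lemma exists_differentiableOn_punctured {m : ℂ → ℂ} {z₀ : ℂ} (hm : MeromorphicAt m z₀) :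
    ∃ R > 0, DifferentiableOn ℂ m (Metric.ball z₀ R \ {z₀}) := by
  obtain ⟨R, hR, h⟩ := exists_ball_of_eventually_punctured hm.eventually_analyticAt
  exact ⟨R, hR, fun z hz => (h z hz).differentiableAt.differentiableWithinAt⟩

lemma residue_congr {m n : ℂ → ℂ} {z₀ : ℂ} (h : m =ᶠ[𝓝[≠] z₀] n) :
    residue m z₀ = residue n z₀ := by
  obtain ⟨R, hR, h⟩ := exists_ball_of_eventually_punctured h
  rw [residue, residue, limUnder, limUnder]
  congr 1
  refine Filter.map_congr ?_
  filter_upwards [Ioo_mem_nhdsGT hR] with s hs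
  congr 1
  refine circleIntegral.integral_congr hs.1.le fun z hz => h z ⟨?_, ?_⟩
  · exact Metric.sphere_subset_ball hs.2 hz
  · rintro rfl
    simp only [mem_sphere_iff_norm, sub_self, norm_zero] at hz
    exact hs.1.ne hz

/-- `limUnder` is additive only when the limits exist; the three residues are read off on one circle
inside both punctured discs. -/
lemma residue_add {m n : ℂ → ℂ} {z₀ : ℂ} (hm : MeromorphicAt m z₀) (hn : MeromorphicAt n z₀) :
    residue (fun z => m z + n z) z₀ = residue m z₀ + residue n z₀ := by
  obtain ⟨R, hR, h1⟩ := exists_differentiableOn_punctured hm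
  obtain ⟨R', hR', h2⟩ := exists_differentiableOn_punctured hn
  obtain ⟨r, hr, hrr⟩ := exists_between (lt_min hR hR')
  have hrR := hrr.trans_le (min_le_left _ _)
  have hrR' := hrr.trans_le (min_le_right _ _)
  have hs : ∀ z ∈ Metric.sphere z₀ r, z ≠ z₀ := by
    rintro z hz rfl
    simp only [mem_sphere_iff_norm, sub_self, norm_zero] at hz
    exact hr.ne hz
  have e1 := circleIntegral_eq_residue h1 hr hrR
  have e2 := circleIntegral_eq_residue h2 hr hrR'
  have e3 := circleIntegral_eq_residue (m := fun z => m z + n z) (R := min R R')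
    ((h1.mono (Set.sdiff_subset_sdiff_left (Metric.ball_subset_ball (min_le_left _ _)))).add
    (h2.mono (Set.sdiff_subset_sdiff_left (Metric.ball_subset_ball (min_le_right _ _))))) hr hrr
  rw [circleIntegral.integral_add, e1, e2, ← mul_add] at e3
  · exact (mul_left_cancel₀ two_pi_I_ne_zero e3).symm
  · exact (h1.continuousOn.mono fun z hz =>
      ⟨Metric.sphere_subset_ball hrR hz, hs z hz⟩).circleIntegrable hr.le
  · exact (h2.continuousOn.mono fun z hz =>
      ⟨Metric.sphere_subset_ball hrR' hz, hs z hz⟩).circleIntegrable hr.le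

/-- Cauchy's formula, as a residue. -/
lemma residue_div_sub {g : ℂ → ℂ} {z₀ : ℂ} (hg : AnalyticAt ℂ g z₀) :
    residue (fun z => (z - z₀)⁻¹ * g z) z₀ = g z₀ := by
  obtain ⟨R, hR, h⟩ := Metric.eventually_nhds_iff_ball.mp hg.eventually_analyticAt
  have hd : DifferentiableOn ℂ g (Metric.ball z₀ R) := fun z hz =>
    (h z hz).differentiableAt.differentiableWithinAt
  obtain ⟨r, hr, hrR⟩ := exists_between hR
  have e1 := circleIntegral_eq_residue (m := fun z => (z - z₀)⁻¹ * g z) (R := R) (by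
    refine DifferentiableOn.mul (DifferentiableOn.inv (by fun_prop) fun z hz => ?_)
      (hd.mono Set.sdiff_subset)
    exact sub_ne_zero.mpr hz.2) hr hrR
  have e2 := (hd.mono (Metric.closedBall_subset_ball hrR)).diffContOnCl_ball
    (Set.Subset.refl _) |>.circleIntegral_sub_inv_smul (Metric.mem_ball_self hr)
  simp only [smul_eq_mul] at e2
  rw [e1] at e2
  exact mul_left_cancel₀ two_pi_I_ne_zero e2

lemma residue_of_analyticAt {g : ℂ → ℂ} {z₀ : ℂ} (hg : AnalyticAt ℂ g z₀) :
    residue g z₀ = 0 := by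
  have h := residue_div_sub (g := fun z => (z - z₀) * g z) (z₀ := z₀) (by fun_prop)
  simp only [sub_self, zero_mul] at h
  rw [← h]
  refine residue_congr ?_
  filter_upwards [self_mem_nhdsWithin] with z hz
  rw [inv_mul_cancel_left₀ (sub_ne_zero.mpr hz)]

lemma residue_eq_zero_of_order_nonneg {m : ℂ → ℂ} {z₀ : ℂ} (hm : MeromorphicAt m z₀)
    (h : 0 ≤ meromorphicOrderAt m z₀) : residue m z₀ = 0 := by
  obtain ⟨g, hg, he⟩ := hm.meromorphicOrderAt_nonneg_iff.mp h
  rw [residue_congr he, residue_of_analyticAt hg]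

/-- The residue of `h df / f`. -/
lemma residue_mul_logDeriv {h f : ℂ → ℂ} {z₀ : ℂ} {n : ℤ} (hh : AnalyticAt ℂ h z₀)
    (hf : MeromorphicAt f z₀) (hn : meromorphicOrderAt f z₀ = n) :
    residue (fun z => h z * (deriv f z / f z)) z₀ = n * h z₀ := by
  obtain ⟨g, hg, hg0, he⟩ := (meromorphicOrderAt_eq_int_iff hf).mp hn
  have he : f =ᶠ[𝓝[≠] z₀] fun z => (z - z₀) ^ n • g z := he
  have hgd : AnalyticAt ℂ (fun z => h z * (deriv g z / g z)) z₀ :=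
    hh.mul (hg.deriv.div hg hg0)
  -- From `f = (z - z₀)^n g` one gets `f'/f = n/(z - z₀) + g'/g`, with `g'/g` analytic at `z₀`.
  have h1 : (fun z => h z * (deriv f z / f z)) =ᶠ[𝓝[≠] z₀]
      fun z => (z - z₀)⁻¹ * (n * h z) + h z * (deriv g z / g z) := by
    filter_upwards [self_mem_nhdsWithin, he, he.nhdsNE_deriv,
      (hg.continuousAt.eventually_ne hg0).filter_mono nhdsWithin_le_nhds,
      hg.eventually_analyticAt.filter_mono nhdsWithin_le_nhds] with z hz h1 h2 h3 h4
    have hz' : z - z₀ ≠ 0 := sub_ne_zero.mpr hz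
    have hd : HasDerivAt (fun z => (z - z₀) ^ n • g z) (n * (z - z₀) ^ (n - 1) * g z
        + (z - z₀) ^ n * deriv g z) z := by
      have := ((hasDerivAt_zpow n (z - z₀) (Or.inl hz')).comp_sub_const z z₀).mul
        h4.differentiableAt.hasDerivAt
      exact this
    rw [h2, h1, hd.deriv, zpow_sub_one₀ hz', smul_eq_mul]
    field_simp
  rw [residue_congr h1, residue_add (m := fun z => (z - z₀)⁻¹ * (n * h z))
    (by fun_prop) hgd.meromorphicAt, residue_div_sub (by fun_prop),
    residue_of_analyticAt hgd, add_zero]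

end RiemannSurface

/-! ### `∂/∂z̄` of an isolated singularity is a residue. -/

namespace RiemannSurface

/-- The factor `w` is `∂|z|²/∂z̄` at `w`. -/
lemma dbar_radial {K : ℝ → ℝ} (hK : ContDiff ℝ 1 K) (w : ℂ) :
    dbar (fun z => ((K (‖z‖ ^ 2) : ℝ) : ℂ)) w = deriv K (‖w‖ ^ 2) * w := by
  have h1 : HasFDerivAt (fun z : ℂ => ‖z‖ ^ 2) (2 • innerSL ℝ w) w :=
    (hasStrictFDerivAt_norm_sq w).hasFDerivAt
  have h2 := ((hK.differentiable one_ne_zero (‖w‖ ^ 2)).hasDerivAt.comp_hasFDerivAt w h1)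
  have h3 := (ofRealCLM.hasFDerivAt (x := K (‖w‖ ^ 2))).comp w h2
  have h4 : fderiv ℝ (fun z => ((K (‖z‖ ^ 2) : ℝ) : ℂ)) w = _ := h3.fderiv
  simp only [dbar, h4]
  simp
  linear_combination ((deriv K (‖w‖ ^ 2) : ℝ) : ℂ) * re_add_im w

/-- A radial cutoff. -/
lemma exists_radial_cutoff {δ : ℝ} (hδ : 0 < δ) :
    ∃ K : ℝ → ℝ, ContDiff ℝ 1 K ∧ (∀ t < (δ / 2) ^ 2, K t = 1) ∧ ∀ t, δ ^ 2 ≤ t → K t = 0 := by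
  -- The argument is at least `1` for `t ≤ (δ/2)²` and nonpositive from `t = δ²/2` on.
  refine ⟨fun t => Real.smoothTransition (2 - t / (δ / 2) ^ 2), ?_, fun t ht => ?_, fun t ht => ?_⟩
  · have := Real.smoothTransition.contDiff (n := 1)
    fun_prop
  · apply Real.smoothTransition.one_of_one_le
    have : t / (δ / 2) ^ 2 ≤ 1 := (div_le_one (by positivity)).mpr ht.le
    linarith
  · apply Real.smoothTransition.zero_of_nonpos
    have : 2 ≤ t / (δ / 2) ^ 2 := by
      rw [le_div_iff₀ (by positivity)]
      nlinarith [sq_nonneg δ]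
    linarith

/-- In polar coordinates the angular integral is a circle integral of `m`, equal to `2πi` times the
residue at every radius `s`. What remains is the radial integral of the derivative of `K (s²)`,
which is `-K 0 = -1`. -/
lemma integral_dbar_radial_mul {m : ℂ → ℂ} {δ R : ℝ} (hδ : 0 < δ) (hδR : δ < R)
    (hm : DifferentiableOn ℂ m (Metric.ball 0 R \ {0})) {K : ℝ → ℝ} (hK : ContDiff ℝ 1 K)
    (hK1 : ∀ t < (δ / 2) ^ 2, K t = 1) (hK0 : ∀ t, δ ^ 2 ≤ t → K t = 0) :
    ∫ z, dbar (fun z => ((K (‖z‖ ^ 2) : ℝ) : ℂ)) z * m z = -Real.pi * residue m 0 := by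
  have hop : IsOpen (Metric.ball (0 : ℂ) R \ {0}) := Metric.isOpen_ball.sdiff isClosed_singleton
  set F : ℂ → ℂ := fun z => dbar (fun z => ((K (‖z‖ ^ 2) : ℝ) : ℂ)) z * m z with hF
  have hd1 : ∀ t < (δ / 2) ^ 2, deriv K t = 0 := fun t ht => by
    have : K =ᶠ[𝓝 t] fun _ => 1 := by
      filter_upwards [Iio_mem_nhds ht] with s hs using hK1 s hs
    rw [this.deriv_eq, deriv_const]
  have hd0 : ∀ t, δ ^ 2 < t → deriv K t = 0 := fun t ht => by
    have : K =ᶠ[𝓝 t] fun _ => 0 := by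
      filter_upwards [Ioi_mem_nhds ht] with s hs using hK0 s (le_of_lt hs)
    rw [this.deriv_eq, deriv_const]
  have hF0 : ∀ z, δ < ‖z‖ → F z = 0 := fun z hz => by
    simp only [hF]
    rw [dbar_radial hK, hd0 _ (by gcongr)]
    simp
  -- The singularity of `m` at `0` is harmless: `deriv K (‖z‖²)` vanishes unless `δ/2 ≤ ‖z‖ ≤ δ`.
  have hcont : Continuous F := by
    rw [continuous_iff_continuousAt]
    intro z
    by_cases hz : ‖z‖ < δ / 2
    · have : F =ᶠ[𝓝 z] fun _ => 0 := by
        filter_upwards [continuous_norm.continuousAt.eventually_lt_const hz] with w hw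
        simp only [hF]
        rw [dbar_radial hK, hd1 _ (by gcongr)]
        simp
      exact continuousAt_const.congr this.symm
    · by_cases hz' : δ < ‖z‖
      · have : F =ᶠ[𝓝 z] fun _ => 0 := by
          filter_upwards [continuous_norm.continuousAt.eventually_const_lt hz'] with w hw
          exact hF0 w hw
        exact continuousAt_const.congr this.symm
      · have hmem : z ∈ Metric.ball (0 : ℂ) R \ {0} := by
          refine ⟨by simp; linarith, ?_⟩
          rintro rfl
          simp at hz
          linarith
        have hK' := hK.continuous_deriv le_rfl
        refine ContinuousAt.mul ?_ (hm.differentiableAt (hop.mem_nhds hmem)).continuousAt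
        have : dbar (fun z => ((K (‖z‖ ^ 2) : ℝ) : ℂ)) = fun w => ((deriv K (‖w‖ ^ 2) : ℝ) : ℂ) * w :=
          funext (dbar_radial hK)
        rw [this]
        fun_prop
  have hpc : Continuous fun p : ℝ × ℝ => p.1 • F (Complex.polarCoord.symm p) := by
    simp only [Complex.polarCoord_symm_apply]
    fun_prop
  rw [← Complex.integral_comp_polarCoord_symm]
  have hint : IntegrableOn (fun p : ℝ × ℝ => p.1 • F (Complex.polarCoord.symm p))
      (Set.Ioi (0 : ℝ) ×ˢ Set.Ioo (-Real.pi) Real.pi) (volume.prod volume) := by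
    have h1 : IntegrableOn (fun p : ℝ × ℝ => p.1 • F (Complex.polarCoord.symm p))
        (Set.Icc (0 : ℝ) δ ×ˢ Set.Icc (-Real.pi) Real.pi) (volume.prod volume) :=
      hpc.continuousOn.integrableOn_compact (isCompact_Icc.prod isCompact_Icc)
    refine h1.of_forall_sdiff_eq_zero (measurableSet_Ioi.prod measurableSet_Ioo) ?_
    rintro ⟨s, θ⟩ ⟨⟨hs, hθ⟩, hn⟩
    have : δ < s := by
      by_contra hc
      exact hn ⟨⟨le_of_lt hs, not_lt.mp hc⟩, Set.Ioo_subset_Icc_self hθ⟩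
    rw [hF0, smul_zero]
    rw [Complex.norm_polarCoord_symm]
    exact this.trans_le (le_abs_self _)
  rw [polarCoord_target, Measure.volume_eq_prod, setIntegral_prod _ hint]
  have hinner : ∀ s ∈ Set.Ioi (0 : ℝ), (∫ θ in Set.Ioo (-Real.pi) Real.pi,
      (s, θ).1 • F (Complex.polarCoord.symm (s, θ))) =
      (deriv (fun t => K (t ^ 2)) s : ℝ) * (Real.pi * residue m 0) := by
    intro s hs
    have hs0 : 0 < s := hs
    have hdK : deriv (fun t => K (t ^ 2)) s = deriv K (s ^ 2) * (2 * s) := by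
      have := (hK.differentiable one_ne_zero (s ^ 2)).hasDerivAt.comp s (hasDerivAt_pow 2 s)
      have h2 := this.deriv
      simp only [Function.comp_def] at h2
      rw [h2]
      simp
    by_cases hsδ : δ < s
    · rw [hdK, hd0 _ (by gcongr)]
      have : ∀ θ : ℝ, (s, θ).1 • F (Complex.polarCoord.symm (s, θ)) = 0 := fun θ => by
        rw [hF0, smul_zero]
        rw [Complex.norm_polarCoord_symm]
        exact hsδ.trans_le (le_abs_self _)
      rw [integral_congr_ae (Eventually.of_forall this)]
      simp
    · have hcirc := circleIntegral_eq_residue hm hs0 (lt_of_le_of_lt (not_lt.mp hsδ) hδR)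
      have hpt : ∀ θ : ℝ, (s, θ).1 • F (Complex.polarCoord.symm (s, θ)) =
          (s * (deriv K (s ^ 2) : ℝ) * (-I) : ℂ) • (deriv (circleMap 0 s) θ • m (circleMap 0 s θ)) := by
        intro θ
        have hc : Complex.polarCoord.symm (s, θ) = circleMap 0 s θ := by
          rw [Complex.polarCoord_symm_apply, circleMap, Complex.exp_mul_I]
          simp
        have hn : ‖circleMap 0 s θ‖ = s := by simp [abs_of_pos hs0]
        rw [hc]
        simp only [hF]
        rw [dbar_radial hK, hn, deriv_circleMap]
        simp only [smul_eq_mul, real_smul]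
        linear_combination (s * (deriv K (s ^ 2) : ℝ) * circleMap 0 s θ * m (circleMap 0 s θ)) * I_mul_I
      simp only [hpt]
      rw [integral_smul, ← integral_Ioc_eq_integral_Ioo,
        ← intervalIntegral.integral_of_le (by linarith [Real.pi_pos])]
      -- Polar coordinates use angles in `(-π, π)` and circle integrals use `(0, 2π)`.
      have hper : Periodic (fun θ => deriv (circleMap 0 s) θ • m (circleMap 0 s θ))
          (2 * Real.pi) := by
        intro θ
        simp only [deriv_circleMap, periodic_circleMap 0 s θ]
      have hP := hper.intervalIntegral_add_eq (-Real.pi) 0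
      rw [show -Real.pi + 2 * Real.pi = Real.pi by ring, zero_add] at hP
      rw [hP, ← circleIntegral, hcirc, hdK]
      push_cast
      simp only [smul_eq_mul]
      linear_combination (-s * (deriv K (s ^ 2) : ℝ) * 2 * Real.pi * residue m 0) * I_mul_I
  rw [setIntegral_congr_fun measurableSet_Ioi hinner, integral_mul_const]
  have hKc : HasCompactSupport fun t : ℝ => K (t ^ 2) := by
    refine HasCompactSupport.intro (isCompact_Icc (a := -δ) (b := δ)) fun t ht => hK0 _ ?_
    by_contra hc
    have := abs_lt_of_sq_lt_sq (not_le.mp hc) hδ.le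
    exact ht ⟨(abs_lt.mp this).1.le, (abs_lt.mp this).2.le⟩
  have h0 := hKc.integral_Ioi_deriv_eq (hK.comp (contDiff_id.pow 2)) 0
  simp only [Function.comp_def, id] at h0
  rw [integral_complex_ofReal, h0, hK1 _ (by rw [zero_pow two_ne_zero]; positivity)]
  push_cast
  ring

lemma residue_comp_add (m : ℂ → ℂ) (z₀ : ℂ) :
    residue (fun z => m (z + z₀)) 0 = residue m z₀ := by
  have : ∀ r : ℝ, (∮ z in C(0, r), m (z + z₀)) = ∮ z in C(z₀, r), m z := by
    intro r
    simp only [circleIntegral, deriv_circleMap]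
    simp [circleMap, add_comm]
  simp only [residue, this]

/-- As `ρ` is constant near `z₀`, the support of `∂ρ/∂z̄` stays away from the singularity. -/
lemma integrable_dbar_mul_of_punctured {ρ m : ℂ → ℂ} {U : Set ℂ} {z₀ : ℂ} (hU : IsOpen U)
    (hρ : ContDiff ℝ 1 ρ) (hc : HasCompactSupport ρ) (hs : tsupport ρ ⊆ U) {c : ℂ}
    (h1 : ρ =ᶠ[𝓝 z₀] fun _ => c) (hm : ContinuousOn m (U \ {z₀})) :
    Integrable fun z => dbar ρ z * m z := by
  refine integrable_mul_of_tsupport_subset (hU.sdiff isClosed_singleton)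
    (continuousOn_univ.mp (continuousOn_dbar isOpen_univ hρ.contDiffOn))
    (hc.of_isClosed_subset (isClosed_tsupport _) (tsupport_dbar_subset ρ)) ?_ hm
  refine Set.subset_sdiff_singleton ((tsupport_dbar_subset ρ).trans hs) ?_
  rw [notMem_tsupport_iff_eventuallyEq]
  filter_upwards [h1.eventually_nhds] with z hz
  rw [dbar_congr hz, dbar_const]
  rfl

/-- `∂/∂z̄` of a function with an isolated singularity, tested against `ρ`, is the residue. -/
lemma integral_dbar_mul_eq_residue {ρ m : ℂ → ℂ} {U : Set ℂ} {z₀ : ℂ} (hU : IsOpen U)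
    (hz₀ : z₀ ∈ U) (hρ : ContDiff ℝ 1 ρ) (hc : HasCompactSupport ρ) (hs : tsupport ρ ⊆ U)
    (h1 : ρ =ᶠ[𝓝 z₀] fun _ => 1) (hm : DifferentiableOn ℂ m (U \ {z₀})) :
    ∫ z, dbar ρ z * m z = -Real.pi * residue m z₀ := by
  obtain ⟨R, hR, hRU⟩ := Metric.isOpen_iff.mp hU z₀ hz₀
  obtain ⟨K, hK, hK1, hK0⟩ := exists_radial_cutoff (half_pos hR)
  have hop : IsOpen (U \ {z₀}) := hU.sdiff isClosed_singleton
  -- The function `ρ` is compared with a radial cutoff `κ` about `z₀`. Near `z₀` the difference `ρ -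
  -- κ` vanishes, so `m` is holomorphic on a neighbourhood of its support and integration by parts
  -- gives zero.
  set κ₀ : ℂ → ℂ := fun z => ((K (‖z‖ ^ 2) : ℝ) : ℂ) with hκ₀
  have hκ₀d : ContDiff ℝ 1 κ₀ := by
    have h2 : ContDiff ℝ 1 fun z : ℂ => K (‖z‖ ^ 2) := hK.comp (contDiff_norm_sq ℝ)
    exact ofRealCLM.contDiff.comp h2
  set κ : ℂ → ℂ := fun z => κ₀ (z - z₀) with hκ
  have hκd : ContDiff ℝ 1 κ := hκ₀d.comp (contDiff_id.sub contDiff_const)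
  have hκs : support κ ⊆ Metric.closedBall z₀ (R / 2) := by
    intro z hz
    by_contra hz'
    apply hz
    simp only [hκ, hκ₀]
    rw [hK0, ofReal_zero]
    rw [Metric.mem_closedBall, dist_eq_norm, not_le] at hz'
    gcongr
  have hκt : tsupport κ ⊆ Metric.closedBall z₀ (R / 2) :=
    closure_minimal hκs Metric.isClosed_closedBall
  have hκc : HasCompactSupport κ :=
    (isCompact_closedBall z₀ (R / 2)).of_isClosed_subset (isClosed_tsupport _) hκt
  have hκU : tsupport κ ⊆ U :=
    hκt.trans ((Metric.closedBall_subset_ball (half_lt_self hR)).trans hRU)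
  have hκ1 : κ =ᶠ[𝓝 z₀] fun _ => 1 := by
    filter_upwards [Metric.ball_mem_nhds z₀ (half_pos (half_pos hR))] with z hz
    simp only [hκ, hκ₀]
    rw [hK1, ofReal_one]
    rw [Metric.mem_ball, dist_eq_norm] at hz
    gcongr
  have hκint : ∫ z, dbar κ z * m z = -Real.pi * residue m z₀ := by
    have h2 := integral_dbar_radial_mul (m := fun z => m (z + z₀)) (half_pos hR)
      (half_lt_self hR) (by
        refine (hm.mono (Set.sdiff_subset_sdiff_left hRU)).comp (by fun_prop) ?_
        rintro z ⟨hz, hz'⟩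
        exact ⟨by simpa using hz, by simpa using hz'⟩) hK hK1 hK0
    rw [residue_comp_add] at h2
    rw [← h2, ← integral_add_right_eq_self (fun z => dbar κ z * m z) z₀]
    congr 1
    ext z
    rw [hκ, dbar_comp (hκ₀d.differentiable one_ne_zero _) (by fun_prop)]
    simp [hκ₀]
  have hσs : tsupport (fun z => ρ z - κ z) ⊆ U \ {z₀} := by
    refine Set.subset_sdiff_singleton ?_ ?_
    · refine (tsupport_sub ρ κ).trans (Set.union_subset hs hκU)
    · rw [notMem_tsupport_iff_eventuallyEq]
      filter_upwards [h1, hκ1] with z hz hz'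
      simp [hz, hz']
  have hmd : ContDiffOn ℝ 1 m (U \ {z₀}) :=
    (hm.contDiffOn hop).restrict_scalars ℝ
  have hσ := integral_mul_dbar hop (hρ.sub hκd) (hc.sub hκc) hσs hmd
  have hz : ∀ z, (ρ z - κ z) * dbar m z = 0 := by
    intro z
    by_cases hz : z ∈ U \ {z₀}
    · rw [dbar_of_differentiableAt (hm.differentiableAt (hop.mem_nhds hz)), mul_zero]
    · rw [image_eq_zero_of_notMem_tsupport (f := fun z => ρ z - κ z) fun h => hz (hσs h), zero_mul]
  simp only [hz, integral_zero] at hσ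
  have hsub : ∀ z, dbar (fun z => ρ z - κ z) z * m z = dbar ρ z * m z - dbar κ z * m z := by
    intro z
    rw [dbar_sub (hρ.differentiable one_ne_zero z) (hκd.differentiable one_ne_zero z), sub_mul]
  simp only [hsub] at hσ
  rw [integral_sub (integrable_dbar_mul_of_punctured hU hρ hc hs h1 hm.continuousOn)
    (integrable_dbar_mul_of_punctured hU hκd hκc hκU hκ1 hm.continuousOn), hκint] at hσ
  linear_combination hσ

end RiemannSurface

/-! ### The spherical density, its primitive, and Green's formula inside a plane domain. -/

namespace RiemannSurface

/-- The density `|F'|² / (1 + |F|²)²`. -/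
noncomputable def sphDens (F : ℂ → ℂ) (z : ℂ) : ℝ := ‖deriv F z‖ ^ 2 / (1 + ‖F z‖ ^ 2) ^ 2

/-- The coefficient of `F̄ dF / (1 + |F|²)`, a primitive of the spherical area form. -/
noncomputable def sphPrim (F : ℂ → ℂ) (z : ℂ) : ℂ :=
  conj (F z) / (1 + F z * conj (F z)) * deriv F z

/-- The coefficient of `G dF / (1 + F G)`. -/
noncomputable def merPrim (F G : ℂ → ℂ) (z : ℂ) : ℂ := G z / (1 + F z * G z) * deriv F z

lemma one_add_mul_conj (w : ℂ) : 1 + w * conj w = ((1 + ‖w‖ ^ 2 : ℝ) : ℂ) := by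
  rw [mul_conj, normSq_eq_norm_sq]
  push_cast
  rfl

lemma one_add_mul_conj_ne_zero (w : ℂ) : 1 + w * conj w ≠ 0 := by
  rw [one_add_mul_conj]
  exact_mod_cast (by positivity : (1 + ‖w‖ ^ 2 : ℝ) ≠ 0)

lemma _root_.DifferentiableAt.conj_comp_real {F : ℂ → ℂ} {z : ℂ} (hF : DifferentiableAt ℝ F z) :
    DifferentiableAt ℝ (fun w => conj (F w)) z :=
  (conjCLE.differentiableAt (x := F z)).comp z hF

lemma contDiffOn_conj_comp {F : ℂ → ℂ} {U : Set ℂ} (hF : ContDiffOn ℝ 1 F U) :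
    ContDiffOn ℝ 1 (fun w => conj (F w)) U :=
  conjCLE.contDiff.comp_contDiffOn hF

lemma contDiffOn_real {F : ℂ → ℂ} {U : Set ℂ} (hU : IsOpen U) (hF : DifferentiableOn ℂ F U) :
    ContDiffOn ℝ 1 F U :=
  (hF.contDiffOn hU).restrict_scalars ℝ

lemma contDiffOn_sphPrim {F : ℂ → ℂ} {U : Set ℂ} (hU : IsOpen U) (hF : DifferentiableOn ℂ F U) :
    ContDiffOn ℝ 1 (sphPrim F) U := by
  have h1 := contDiffOn_real hU hF
  have h2 := contDiffOn_real hU (hF.deriv hU)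
  have h3 := contDiffOn_conj_comp h1
  exact (h3.mul ((contDiffOn_const.add (h1.mul h3)).inv
    fun z _ => one_add_mul_conj_ne_zero (F z))).mul h2

/-- For `∂/∂z̄` the factors `F` and `F'` are constants, so only `F̄` is differentiated, and `F̄ / (1
+ F F̄)` gives `conj F' / (1 + |F|²)²`. -/
lemma dbar_sphPrim {F : ℂ → ℂ} {U : Set ℂ} (hU : IsOpen U) (hF : DifferentiableOn ℂ F U) {z : ℂ}
    (hz : z ∈ U) : dbar (sphPrim F) z = sphDens F z := by
  have hFz := hF.differentiableAt (hU.mem_nhds hz)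
  have hdF := (hF.deriv hU).differentiableAt (hU.mem_nhds hz)
  have hR := hFz.restrictScalars ℝ
  have hc := hR.conj_comp_real
  have hne := one_add_mul_conj_ne_zero (F z)
  have hd : DifferentiableAt ℝ (fun w => 1 + F w * conj (F w)) z := (hR.fun_mul hc).const_add 1
  have hdb : dbar (fun w => 1 + F w * conj (F w)) z = F z * conj (deriv F z) := by
    rw [dbar_add (differentiableAt_const _) (hR.fun_mul hc), dbar_const, dbar_mul hR hc,
      dbar_of_differentiableAt hFz, dbar_conj hFz]
    ring
  have e : sphPrim F = fun w => (conj (F w) * (1 + F w * conj (F w))⁻¹) * deriv F w := by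
    ext w
    rw [sphPrim, div_eq_mul_inv]
  rw [e, dbar_mul (hc.fun_mul (hd.fun_inv hne)) (hdF.restrictScalars ℝ), dbar_of_differentiableAt hdF,
    dbar_mul hc (hd.fun_inv hne), dbar_conj hFz, dbar_inv hd hne, hdb, sphDens]
  push_cast
  have h1 := one_add_mul_conj (F z)
  push_cast at h1
  rw [← h1, ← Complex.mul_conj']
  field_simp
  ring

/-- This is `∂/∂z` of `log (1 + |F|²) = log |F|² + log (1 + |1/F|²)`. It isolates the singular part
of the primitive at a pole of `F`. -/
lemma sphPrim_inv {F g : ℂ → ℂ} {z : ℂ} (hg : g =ᶠ[𝓝 z] fun w => (F w)⁻¹)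
    (hF : DifferentiableAt ℂ F z) (h0 : F z ≠ 0) :
    sphPrim F z = deriv F z / F z + sphPrim g z := by
  have h1 := one_add_mul_conj_ne_zero (F z)
  have h0' : conj (F z) ≠ 0 := by simpa using h0
  rw [sphPrim, sphPrim, hg.deriv_eq, hg.eq_of_nhds, deriv_fun_inv'' hF h0]
  rw [map_inv₀]
  generalize conj (F z) = b at *
  generalize F z = a at *
  rw [show 1 + a⁻¹ * b⁻¹ = (1 + a * b) / (a * b) by field_simp; ring]
  obtain ⟨X, hX⟩ : ∃ X, X = 1 + a * b := ⟨_, rfl⟩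
  rw [← hX] at h1 ⊢
  field_simp
  linear_combination -deriv F z * hX

/-- Inversion `w ↦ 1/w` is an isometry of the Riemann sphere. -/
lemma sphDens_inv {F g : ℂ → ℂ} {z : ℂ} (hg : g =ᶠ[𝓝 z] fun w => (F w)⁻¹)
    (hF : DifferentiableAt ℂ F z) (h0 : F z ≠ 0) : sphDens F z = sphDens g z := by
  have h0' : ‖F z‖ ≠ 0 := by simpa using h0
  rw [sphDens, sphDens, hg.deriv_eq, hg.eq_of_nhds, deriv_fun_inv'' hF h0]
  rw [norm_div, norm_neg, norm_pow, norm_inv]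
  field_simp
  ring

lemma differentiableOn_merPrim {F G : ℂ → ℂ} {U : Set ℂ} (hU : IsOpen U)
    (hF : DifferentiableOn ℂ F U) (hG : DifferentiableOn ℂ G U)
    (hne : ∀ z ∈ U, 1 + F z * G z ≠ 0) : DifferentiableOn ℂ (merPrim F G) U :=
  (hG.div ((differentiableOn_const 1).add (hF.mul hG)) hne).mul (hF.deriv hU)

/-- Green's formula for `h` times the spherical area form, without singularities. -/
lemma integral_mul_sphDens {ρ h F G : ℂ → ℂ} {U : Set ℂ} (hU : IsOpen U)
    (hρ : ContDiff ℝ 1 ρ) (hc : HasCompactSupport ρ) (hs : tsupport ρ ⊆ U)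
    (hh : DifferentiableOn ℂ h U) (hF : DifferentiableOn ℂ F U) (hG : DifferentiableOn ℂ G U)
    (hne : ∀ z ∈ U, 1 + F z * G z ≠ 0) :
    Integrable (fun z => dbar ρ z * (h z * (sphPrim F z - merPrim F G z))) ∧
    ∫ z, ρ z * (h z * sphDens F z) =
      -∫ z, dbar ρ z * (h z * (sphPrim F z - merPrim F G z)) := by
  have hm := differentiableOn_merPrim hU hF hG hne
  have hp := contDiffOn_sphPrim hU hF
  have hΦ : ContDiffOn ℝ 1 (fun z => h z * (sphPrim F z - merPrim F G z)) U :=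
    (contDiffOn_real hU hh).mul (hp.sub (contDiffOn_real hU hm))
  refine ⟨integrable_dbar_mul hU hρ hc hs hΦ.continuousOn, ?_⟩
  rw [← integral_mul_dbar hU hρ hc hs hΦ]
  congr 1
  ext z
  by_cases hz : z ∈ U
  · have hn := hU.mem_nhds hz
    have h1 := (hh.differentiableAt hn)
    have h2 := (hm.differentiableAt hn)
    have h3 := (hp.contDiffAt hn).differentiableAt one_ne_zero
    rw [dbar_mul (h1.restrictScalars ℝ) (h3.fun_sub (h2.restrictScalars ℝ)),
      dbar_of_differentiableAt h1, dbar_sub h3 (h2.restrictScalars ℝ),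
      dbar_of_differentiableAt h2, dbar_sphPrim hU hF hz]
    ring
  · rw [image_eq_zero_of_notMem_tsupport fun h => hz (hs h), zero_mul, zero_mul]

/-- The value of a meromorphic function at a removable singularity is arbitrary and has to be
corrected before the function is holomorphic on `U`. -/
lemma differentiableOn_update {F F' : ℂ → ℂ} {U : Set ℂ} {z₀ : ℂ} (hU : IsOpen U)
    (hF : DifferentiableOn ℂ F (U \ {z₀})) (hF' : AnalyticAt ℂ F' z₀) (he : F =ᶠ[𝓝[≠] z₀] F') :
    DifferentiableOn ℂ (update F z₀ (F' z₀)) U := by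
  intro z hz
  apply DifferentiableAt.differentiableWithinAt
  by_cases h : z = z₀
  · subst h
    refine hF'.differentiableAt.congr_of_eventuallyEq ?_
    rw [EventuallyEq, eventually_nhdsWithin_iff] at he
    filter_upwards [he] with w hw
    by_cases hwz : w = z
    · subst hwz
      simp
    · rw [update_of_ne hwz, hw hwz]
  · have hop : IsOpen (U \ {z₀}) := hU.sdiff isClosed_singleton
    refine (hF.differentiableAt (hop.mem_nhds ⟨hz, h⟩)).congr_of_eventuallyEq ?_
    filter_upwards [hop.mem_nhds ⟨hz, h⟩] with w hw
    rw [update_of_ne hw.2]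

lemma residue_neg {m : ℂ → ℂ} {z₀ : ℂ} (hm : MeromorphicAt m z₀) :
    residue (fun z => -m z) z₀ = -residue m z₀ := by
  have h := residue_add hm hm.neg
  have h0 : residue (fun z => m z + (-m) z) z₀ = 0 := by
    simp only [Pi.neg_apply, add_neg_cancel]
    exact residue_of_analyticAt analyticAt_const
  rw [h0] at h
  exact eq_neg_of_add_eq_zero_right h.symm

/-- Green's formula with a splitting into a regular part and a meromorphic part. -/
lemma integral_dbar_mul_of_splitting {ρ Φ W m : ℂ → ℂ} {U : Set ℂ} {z₀ : ℂ} (hU : IsOpen U)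
    (hz₀ : z₀ ∈ U) (hρ : ContDiff ℝ 1 ρ) (hc : HasCompactSupport ρ) (hs : tsupport ρ ⊆ U)
    (h1 : ρ =ᶠ[𝓝 z₀] fun _ => 1) (hΦ : ContDiffOn ℝ 1 Φ U)
    (hm : DifferentiableOn ℂ m (U \ {z₀})) (hW : ∀ z ∈ U \ {z₀}, W z = Φ z + m z) :
    Integrable (fun z => dbar ρ z * W z) ∧
    ∫ z, dbar ρ z * W z = -(∫ z, ρ z * dbar Φ z) - Real.pi * residue m z₀ := by
  have hWe : ∀ z, dbar ρ z * W z = dbar ρ z * Φ z + dbar ρ z * m z := by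
    intro z
    by_cases hz : z ∈ U \ {z₀}
    · rw [hW z hz, mul_add]
    · have : dbar ρ z = 0 := by
        by_cases hzU : z ∈ U
        · have hzz : z = z₀ := by
            by_contra hne
            exact hz ⟨hzU, hne⟩
          rw [hzz, dbar_congr h1, dbar_const]
        · exact dbar_eq_zero_of_notMem_tsupport fun h => hzU (hs h)
      simp [this]
  have i1 := integrable_dbar_mul hU hρ hc hs hΦ.continuousOn
  have i2 := integrable_dbar_mul_of_punctured hU hρ hc hs h1 hm.continuousOn
  simp only [hWe]
  refine ⟨i1.add i2, ?_⟩
  rw [integral_add i1 i2, integral_dbar_mul_eq_residue hU hz₀ hρ hc hs h1 hm,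
    integral_mul_dbar hU hρ hc hs hΦ]
  ring

/-- Green's formula for `h` times the spherical area form, with one isolated singularity. -/
lemma integral_mul_sphDens_of_punctured {ρ h F G : ℂ → ℂ} {U : Set ℂ} {z₀ : ℂ} (hU : IsOpen U)
    (hz₀ : z₀ ∈ U) (hρ : ContDiff ℝ 1 ρ) (hc : HasCompactSupport ρ) (hs : tsupport ρ ⊆ U)
    (h1 : ρ =ᶠ[𝓝 z₀] fun _ => 1) (hh : DifferentiableOn ℂ h U)
    (hF : DifferentiableOn ℂ F (U \ {z₀})) (hG : DifferentiableOn ℂ G (U \ {z₀}))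
    (hF0 : ∀ z ∈ U \ {z₀}, F z ≠ 0) (hne : ∀ z ∈ U \ {z₀}, 1 + F z * G z ≠ 0)
    (hFm : MeromorphicAt F z₀) (hGm : MeromorphicAt G z₀) :
    Integrable (fun z => dbar ρ z * (h z * (sphPrim F z - merPrim F G z))) ∧
    ∫ z, ρ z * (h z * sphDens F z) =
      -(∫ z, dbar ρ z * (h z * (sphPrim F z - merPrim F G z))) +
        Real.pi * (residue (fun z => h z * merPrim F G z) z₀ +
          ((-(meromorphicOrderAt F z₀).untop₀).toNat : ℂ) * h z₀) := by
  have hop : IsOpen (U \ {z₀}) := hU.sdiff isClosed_singleton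
  have hha : AnalyticAt ℂ h z₀ := hh.analyticAt (hU.mem_nhds hz₀)
  have hBd : DifferentiableOn ℂ (fun z => h z * merPrim F G z) (U \ {z₀}) :=
    (hh.mono Set.sdiff_subset).mul (differentiableOn_merPrim hop hF hG hne)
  have hBm : MeromorphicAt (fun z => h z * merPrim F G z) z₀ := by
    have := hFm.deriv
    unfold merPrim
    fun_prop
  have hdΦ : ∀ F' : ℂ → ℂ, DifferentiableOn ℂ F' U →
      (∀ z ∈ U \ {z₀}, sphDens F z = sphDens F' z) →
      ∫ z, ρ z * dbar (fun z => h z * sphPrim F' z) z = ∫ z, ρ z * (h z * sphDens F z) := by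
    intro F' hF' he
    refine integral_congr_ae ?_
    -- Since `F z₀` is arbitrary, the densities are compared off a null set.
    have hae : ∀ᵐ z : ℂ, z ≠ z₀ := by simp [ae_iff, measure_singleton]
    filter_upwards [hae] with z hz
    by_cases hzU : z ∈ U
    · have hn := hU.mem_nhds hzU
      rw [dbar_mul ((hh.differentiableAt hn).restrictScalars ℝ)
        (((contDiffOn_sphPrim hU hF').contDiffAt hn).differentiableAt one_ne_zero),
        dbar_of_differentiableAt (hh.differentiableAt hn), dbar_sphPrim hU hF' hzU, he z ⟨hzU, hz⟩]
      ring
    · rw [image_eq_zero_of_notMem_tsupport fun h => hzU (hs h), zero_mul, zero_mul]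
  have hnear : ∀ {F' : ℂ → ℂ} {v : ℂ} {z : ℂ}, z ∈ U \ {z₀} → update F' z₀ v =ᶠ[𝓝 z] F' := by
    intro F' v z hz
    filter_upwards [hop.mem_nhds hz] with w hw
    rw [update_of_ne hw.2]
  by_cases hord : 0 ≤ meromorphicOrderAt F z₀
  · obtain ⟨F', hF', he⟩ := hFm.meromorphicOrderAt_nonneg_iff.mp hord
    set F₁ := update F z₀ (F' z₀) with hF₁
    have hd := differentiableOn_update hU hF hF' he
    obtain ⟨i, e⟩ := integral_dbar_mul_of_splitting (W := fun z => h z * (sphPrim F z - merPrim F G z))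
      (m := fun z => -(h z * merPrim F G z)) hU hz₀ hρ hc hs h1
      ((contDiffOn_real hU hh).mul (contDiffOn_sphPrim hU hd)) hBd.neg (by
        intro z hz
        have : sphPrim (update F z₀ (F' z₀)) z = sphPrim F z := by
          rw [sphPrim, sphPrim, (hnear hz).deriv_eq, update_of_ne hz.2]
        rw [this]
        ring)
    refine ⟨i, ?_⟩
    rw [e, hdΦ _ hd, residue_neg hBm]
    · have : (-(meromorphicOrderAt F z₀).untop₀).toNat = 0 := by
        have := WithTop.untop₀_nonneg.mpr hord
        omega
      rw [this]
      push_cast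
      ring
    · intro z hz
      rw [sphDens, sphDens, (hnear hz).deriv_eq, update_of_ne hz.2]
  · have htop : meromorphicOrderAt F z₀ ≠ ⊤ := by
      intro ht
      rw [ht] at hord
      exact hord le_top
    obtain ⟨n, hn⟩ := WithTop.ne_top_iff_exists.mp htop
    have hn0 : n < 0 := by
      rw [← hn, not_le] at hord
      exact_mod_cast hord
    have hinv : 0 < meromorphicOrderAt (fun z => (F z)⁻¹) z₀ := by
      rw [show (fun z => (F z)⁻¹) = F⁻¹ from rfl, meromorphicOrderAt_inv, ← hn]
      have : (0 : ℤ) < -n := by omega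
      exact_mod_cast this
    -- At a pole the regular part is built from `g = 1/F`, which has the same density. The remainder
    -- gains `h F'/F`, of residue `n h(z₀)` with `n < 0`, that is, minus the multiplicity of the
    -- pole times `h(z₀)`.
    obtain ⟨g, hg, he⟩ := (hFm.fun_inv).meromorphicOrderAt_nonneg_iff.mp hinv.le
    have hd := differentiableOn_update hU (hF.inv hF0) hg he
    have hgn : ∀ z ∈ U \ {z₀}, update F⁻¹ z₀ (g z₀) =ᶠ[𝓝 z] fun w => (F w)⁻¹ :=
      fun z hz => hnear hz
    have hlog : DifferentiableOn ℂ (fun z => h z * (deriv F z / F z)) (U \ {z₀}) :=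
      (hh.mono Set.sdiff_subset).mul ((hF.deriv hop).div hF hF0)
    have hlogm : MeromorphicAt (fun z => h z * (deriv F z / F z)) z₀ := by
      have := hFm.deriv
      fun_prop
    obtain ⟨i, e⟩ := integral_dbar_mul_of_splitting (W := fun z => h z * (sphPrim F z - merPrim F G z))
      (m := fun z => h z * (deriv F z / F z) + -(h z * merPrim F G z)) hU hz₀ hρ hc hs h1
      ((contDiffOn_real hU hh).mul (contDiffOn_sphPrim hU hd)) (hlog.add hBd.neg) (by
        intro z hz
        rw [sphPrim_inv (hgn z hz) (hF.differentiableAt (hop.mem_nhds hz)) (hF0 z hz)]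
        ring)
    refine ⟨i, ?_⟩
    rw [e, hdΦ _ hd, residue_add (n := fun z => -(h z * merPrim F G z)) hlogm hBm.neg,
      residue_neg hBm, residue_mul_logDeriv hha hFm hn.symm]
    · have : (((-(meromorphicOrderAt F z₀).untop₀).toNat : ℕ) : ℂ) = -n := by
        rw [← hn, WithTop.untop₀_coe]
        have h2 : (((-n).toNat : ℤ) : ℂ) = ((-n : ℤ) : ℂ) := by
          rw [Int.toNat_of_nonneg (by omega)]
        rw [← Int.cast_natCast, h2, Int.cast_neg]
      rw [this]
      ring
    · intro z hz
      exact sphDens_inv (hgn z hz) (hF.differentiableAt (hop.mem_nhds hz)) (hF0 z hz)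

end RiemannSurface

/-! ### Green's formula up to the boundary, in a plane domain. -/

namespace RiemannSurface

lemma fderiv_real_eq {F : ℂ → ℂ} {z : ℂ} (hF : DifferentiableAt ℂ F z) :
    ‖fderiv ℝ F z‖ ≤ ‖deriv F z‖ := by
  rw [hF.hasDerivAt.complexToReal_fderiv.fderiv, norm_smul]
  exact mul_le_of_le_one_right (norm_nonneg _) ContinuousLinearMap.norm_id_le

lemma norm_fderiv_conj_sub_le {F G : ℂ → ℂ} {z : ℂ} (hF : DifferentiableAt ℂ F z)
    (hG : DifferentiableAt ℂ G z) :
    ‖fderiv ℝ (fun w => conj (F w) - G w) z‖ ≤ ‖deriv F z‖ + ‖deriv G z‖ := by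
  have hR := hF.restrictScalars ℝ
  have h2 := (conjCLE.hasFDerivAt (x := F z)).comp z hR.hasFDerivAt
  rw [fderiv_fun_sub hR.conj_comp_real (hG.restrictScalars ℝ)]
  refine (norm_sub_le _ _).trans (add_le_add ?_ (fderiv_real_eq hG))
  have h3 : fderiv ℝ (fun w => conj (F w)) z = _ := h2.fderiv
  rw [h3]
  refine le_trans (ContinuousLinearMap.opNorm_le_bound _ (norm_nonneg _) fun v => ?_)
    (fderiv_real_eq hF)
  simpa using (fderiv ℝ F z).le_opNorm v

/-- A holomorphic function agrees with the conjugate of a holomorphic function without critical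
points only on a null set. -/
lemma volume_conj_eq_zero {F G : ℂ → ℂ} {V : Set ℂ} (hV : IsOpen V) (hF : DifferentiableOn ℂ F V)
    (hG : DifferentiableOn ℂ G V) (hF' : ∀ z ∈ V, deriv F z ≠ 0) :
    volume {z ∈ V | conj (F z) - G z = 0} = 0 := by
  set u : ℂ → ℂ := fun z => conj (F z) - G z with hu
  have hud : ∀ z ∈ V, DifferentiableAt ℝ u z := fun z hz =>
    ((hF.differentiableAt (hV.mem_nhds hz)).restrictScalars ℝ).conj_comp_real.sub
      ((hG.differentiableAt (hV.mem_nhds hz)).restrictScalars ℝ)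
  set s := {z ∈ V | u z = 0} with hs
  have hmeas : MeasurableSet s := by
    have hc : ContinuousOn u V := fun z hz => (hud z hz).continuousAt.continuousWithinAt
    have : s = V \ (V ∩ u ⁻¹' {0}ᶜ) := by
      ext z
      simp [hs]
    rw [this]
    exact hV.measurableSet.diff (hc.isOpen_inter_preimage hV isOpen_compl_singleton).measurableSet
  -- On its zero set `u` is approximated by the zero map, so its derivative vanishes at almost every
  -- point of that set. But `∂u/∂z̄ = conj F'` has no zero.
  have hlin : ApproximatesLinearOn u (0 : ℂ →L[ℝ] ℂ) s 0 := by
    intro x hx y hy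
    simp [hx.2, hy.2]
  have h := hlin.norm_fderiv_sub_le volume hmeas (fderiv ℝ u)
    fun z hz => (hud z hz.1).hasFDerivAt.hasFDerivWithinAt
  have hne : ∀ᵐ z ∂volume.restrict s, False := by
    filter_upwards [h, ae_restrict_mem hmeas] with z hz hzs
    have h0 : fderiv ℝ u z = 0 := by simpa using hz
    have h1 : dbar u z = 0 := by simp [dbar, h0]
    have hFz := hF.differentiableAt (hV.mem_nhds hzs.1)
    have hGz := hG.differentiableAt (hV.mem_nhds hzs.1)
    rw [hu, dbar_sub (hFz.restrictScalars ℝ).conj_comp_real (hGz.restrictScalars ℝ),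
      dbar_conj hFz, dbar_of_differentiableAt hGz, sub_zero] at h1
    exact hF' z hzs.1 (by simpa using h1)
  rw [ae_iff] at hne
  simpa using hne

/-- A cutoff function on the half line. -/
lemma exists_cutoff : ∃ (φ : ℝ → ℝ) (L : ℝ), ContDiff ℝ 1 φ ∧ (∀ t < 1, φ t = 0) ∧
    (∀ t, 2 ≤ t → φ t = 1) ∧ (∀ t, |φ t| ≤ 1) ∧ ∀ t, 0 ≤ t → |deriv φ t| * t ≤ L := by
  set φ : ℝ → ℝ := fun t => Real.smoothTransition (t - 1) with hφ
  have hd : ContDiff ℝ 1 φ := by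
    have := Real.smoothTransition.contDiff (n := 1)
    fun_prop
  have h2 : ∀ t, 2 ≤ t → φ t = 1 := fun t ht =>
    Real.smoothTransition.one_of_one_le (by linarith)
  have hd' := hd.continuous_deriv le_rfl
  -- Beyond `2` the cutoff is constant, so only a compact interval matters.
  obtain ⟨L, hL⟩ := (isCompact_Icc (a := (0 : ℝ)) (b := 2)).exists_bound_of_continuousOn
    (f := fun t => deriv φ t * t) (by fun_prop)
  refine ⟨φ, max L 0, hd, fun t ht => Real.smoothTransition.zero_of_nonpos (by linarith), h2,
    fun t => ?_, fun t ht => ?_⟩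
  · rw [abs_of_nonneg (Real.smoothTransition.nonneg _)]
    exact Real.smoothTransition.le_one _
  · by_cases h : t ≤ 2
    · have := hL t ⟨ht, h⟩
      rw [Real.norm_eq_abs, abs_mul, abs_of_nonneg ht] at this
      exact this.trans (le_max_left _ _)
    · have : φ =ᶠ[𝓝 t] fun _ => 1 := by
        filter_upwards [Ioi_mem_nhds (not_le.mp h)] with s hs using h2 s (le_of_lt hs)
      rw [this.deriv_eq]
      simp

/-- The hypotheses of the boundary lemma: `F` and `G` are holomorphic near the boundary of `V`,
`G` is the conjugate of `F` on the boundary, and `F` controls `G`. -/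
structure BoundaryData (F G : ℂ → ℂ) (W V : Set ℂ) (z₀ : ℂ) (C : ℝ) : Prop where
  isOpen_W : IsOpen W
  isOpen_V : IsOpen V
  diffF : DifferentiableOn ℂ F W
  diffG : DifferentiableOn ℂ G W
  eq_conj : ∀ z ∈ W ∩ frontier V, conj (F z) - G z = 0
  deriv_ne : ∀ z ∈ W \ {z₀}, deriv F z ≠ 0
  deriv_le : ∀ z ∈ W, ‖deriv G z‖ ≤ C * ‖deriv F z‖
  sub_le : ∀ z ∈ W, ‖conj (F z) - G z‖ ≤ C * ‖deriv F z‖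
  bound : ∀ z ∈ W, ‖F z‖ ≤ C
  half_le : ∀ z ∈ W, 1 / 2 ≤ ‖1 + F z * G z‖

namespace BoundaryData

variable {F G : ℂ → ℂ} {W V : Set ℂ} {z₀ : ℂ} {C : ℝ}

lemma ne_zero (D : BoundaryData F G W V z₀ C) {z : ℂ} (hz : z ∈ W) : 1 + F z * G z ≠ 0 := by
  intro h
  have := D.half_le z hz
  rw [h, norm_zero] at this
  linarith

lemma C_nonneg (D : BoundaryData F G W V z₀ C) {z : ℂ} (hz : z ∈ W) : 0 ≤ C :=
  (norm_nonneg _).trans (D.bound z hz)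

/-- The factor `conj F - G`, which vanishes on the boundary, is what pays for the derivative of the
cutoff. -/
lemma gap_eq (D : BoundaryData F G W V z₀ C) {z : ℂ} (hz : z ∈ W) :
    sphPrim F z - merPrim F G z =
      (conj (F z) - G z) * deriv F z / ((1 + F z * conj (F z)) * (1 + F z * G z)) := by
  have h1 := one_add_mul_conj_ne_zero (F z)
  have h2 := D.ne_zero hz
  rw [sphPrim, merPrim, div_mul_eq_mul_div, div_mul_eq_mul_div, div_sub_div _ _ h1 h2]
  congr 1
  ring

lemma norm_gap_le (D : BoundaryData F G W V z₀ C) {z : ℂ} (hz : z ∈ W) :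
    ‖sphPrim F z - merPrim F G z‖ ≤ 2 * ‖conj (F z) - G z‖ * ‖deriv F z‖ := by
  rw [D.gap_eq hz, norm_div, norm_mul, norm_mul]
  have h1 : 1 ≤ ‖1 + F z * conj (F z)‖ := by
    rw [one_add_mul_conj, norm_real, Real.norm_eq_abs, abs_of_nonneg (by positivity)]
    linarith [sq_nonneg ‖F z‖]
  have h2 := D.half_le z hz
  have h3 : 1 / 2 ≤ ‖1 + F z * conj (F z)‖ * ‖1 + F z * G z‖ := by nlinarith
  rw [div_le_iff₀ (by linarith)]
  have : 0 ≤ ‖conj (F z) - G z‖ * ‖deriv F z‖ := by positivity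
  nlinarith

lemma sq_deriv_le (D : BoundaryData F G W V z₀ C) {z : ℂ} (hz : z ∈ W) :
    ‖deriv F z‖ ^ 2 ≤ (1 + C ^ 2) ^ 2 * sphDens F z := by
  have h1 := D.bound z hz
  rw [sphDens, mul_div_assoc', le_div_iff₀ (by positivity), mul_comm]
  gcongr

/-- The distance squared to the conjugate, with its derivative. -/
lemma norm_dbar_cutoff_le (D : BoundaryData F G W V z₀ C) {z : ℂ} (hz : z ∈ W) {φ : ℝ → ℝ} {L : ℝ}
    (hφ : ContDiff ℝ 1 φ) (hL : ∀ t, 0 ≤ t → |deriv φ t| * t ≤ L) (n : ℕ) :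
    DifferentiableAt ℝ (fun w => ((φ (n * ‖conj (F w) - G w‖ ^ 2) : ℝ) : ℂ)) z ∧
    ‖dbar (fun w => ((φ (n * ‖conj (F w) - G w‖ ^ 2) : ℝ) : ℂ)) z‖ *
      ‖sphPrim F z - merPrim F G z‖ ≤ 4 * L * (1 + C) * ‖deriv F z‖ ^ 2 := by
  have hFz := D.diffF.differentiableAt (D.isOpen_W.mem_nhds hz)
  have hGz := D.diffG.differentiableAt (D.isOpen_W.mem_nhds hz)
  set u : ℂ → ℂ := fun w => conj (F w) - G w with hu
  have hud : DifferentiableAt ℝ u z :=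
    (hFz.restrictScalars ℝ).conj_comp_real.sub (hGz.restrictScalars ℝ)
  have h1 : HasFDerivAt (fun w : ℂ => (n : ℝ) * ‖u w‖ ^ 2)
      ((n : ℝ) • ((2 • innerSL ℝ (u z)).comp (fderiv ℝ u z))) z :=
    ((hasStrictFDerivAt_norm_sq (u z)).hasFDerivAt.comp z hud.hasFDerivAt).const_mul _
  have h2 := (hφ.differentiable one_ne_zero (n * ‖u z‖ ^ 2)).hasDerivAt.comp_hasFDerivAt z h1
  have h3 := (ofRealCLM.hasFDerivAt (x := φ (n * ‖u z‖ ^ 2))).comp z h2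
  refine ⟨h3.differentiableAt, ?_⟩
  have h4 : fderiv ℝ (fun w => ((φ (n * ‖u w‖ ^ 2) : ℝ) : ℂ)) z = _ := h3.fderiv
  have hub : ‖fderiv ℝ u z‖ ≤ (1 + C) * ‖deriv F z‖ := by
    have := norm_fderiv_conj_sub_le hFz hGz
    have h5 := D.deriv_le z hz
    rw [add_mul, one_mul]
    exact this.trans (by linarith)
  have h6 : ‖dbar (fun w => ((φ (n * ‖u w‖ ^ 2) : ℝ) : ℂ)) z‖ ≤
      |deriv φ (n * ‖u z‖ ^ 2)| * (n * (2 * ‖u z‖ * ((1 + C) * ‖deriv F z‖))) := by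
    refine (norm_dbar_le _ _).trans ?_
    rw [h4]
    refine (ContinuousLinearMap.opNorm_comp_le _ _).trans ?_
    rw [ofRealCLM_norm, one_mul, norm_smul, Real.norm_eq_abs, norm_smul, Real.norm_natCast]
    gcongr
    refine (ContinuousLinearMap.opNorm_comp_le _ _).trans ?_
    gcongr
    rw [← Nat.cast_smul_eq_nsmul ℝ, norm_smul, innerSL_apply_norm]
    simp
  have hC := D.C_nonneg hz
  have h7 := D.norm_gap_le hz
  have h8 := hL (n * ‖u z‖ ^ 2) (by positivity)
  -- One factor `‖u‖` comes from differentiating `‖u‖²` and one from the gap. Together with `n` they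
  -- form the argument `t = n ‖u‖²` of `φ'`, and `|φ'(t)| t ≤ L` makes the bound uniform in `n`.
  calc _ ≤ |deriv φ (n * ‖u z‖ ^ 2)| * (n * (2 * ‖u z‖ * ((1 + C) * ‖deriv F z‖))) *
        (2 * ‖u z‖ * ‖deriv F z‖) := mul_le_mul h6 h7 (norm_nonneg _) (by positivity)
    _ = (|deriv φ (n * ‖u z‖ ^ 2)| * (n * ‖u z‖ ^ 2)) * (4 * (1 + C) * ‖deriv F z‖ ^ 2) := by ring
    _ ≤ L * (4 * (1 + C) * ‖deriv F z‖ ^ 2) := by gcongr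
    _ = _ := by ring

lemma continuousOn_mul_gap (D : BoundaryData F G W V z₀ C) (hVW : V ⊆ W) {h : ℂ → ℂ}
    (hh : DifferentiableOn ℂ h V) :
    ContDiffOn ℝ 1 (fun z => h z * (sphPrim F z - merPrim F G z)) V :=
  (contDiffOn_real D.isOpen_V hh).mul ((contDiffOn_sphPrim D.isOpen_V (D.diffF.mono hVW)).sub
    (contDiffOn_real D.isOpen_V (differentiableOn_merPrim D.isOpen_V (D.diffF.mono hVW)
      (D.diffG.mono hVW) fun _ hz => D.ne_zero (hVW hz))))

/-- Here `sub_le` trades `conj F - G` for a second factor `F'`. As `h` is controlled only through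
its product with the density, this bound is what makes `h` times the gap integrable, even if `F'`
vanishes at `z₀`. -/
lemma norm_gap_le_sphDens (D : BoundaryData F G W V z₀ C) {z : ℂ} (hz : z ∈ W) :
    ‖sphPrim F z - merPrim F G z‖ ≤ 2 * C * (1 + C ^ 2) ^ 2 * sphDens F z := by
  have hC := D.C_nonneg hz
  calc _ ≤ 2 * ‖conj (F z) - G z‖ * ‖deriv F z‖ := D.norm_gap_le hz
    _ ≤ 2 * (C * ‖deriv F z‖) * ‖deriv F z‖ := by gcongr; exact D.sub_le z hz
    _ = 2 * C * ‖deriv F z‖ ^ 2 := by ring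
    _ ≤ 2 * C * ((1 + C ^ 2) ^ 2 * sphDens F z) := by gcongr; exact D.sq_deriv_le hz
    _ = _ := by ring

lemma norm_mul_sphDens (h F : ℂ → ℂ) (z : ℂ) : ‖h z * sphDens F z‖ = ‖h z‖ * sphDens F z := by
  rw [norm_mul, norm_real, Real.norm_eq_abs, abs_of_nonneg]
  unfold sphDens
  positivity

/-- The cut off test function used near the boundary. -/
noncomputable def cutTest (F G ρ : ℂ → ℂ) (V : Set ℂ) (φ : ℝ → ℝ) (n : ℕ) : ℂ → ℂ :=
  V.indicator fun z => ρ z * ((φ (n * ‖conj (F z) - G z‖ ^ 2) : ℝ) : ℂ)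

/-- At a boundary point of `V` inside `W` one has `conj F = G`, so the argument of `φ` is below `1`
in a neighbourhood and the cutoff is zero there. Boundary points outside `W` are excluded by the
support of `ρ`. -/
lemma tsupport_cutTest_subset (D : BoundaryData F G W V z₀ C) {ρ : ℂ → ℂ}
    (hs : tsupport ρ ⊆ W) {φ : ℝ → ℝ} (hφ0 : ∀ t < 1, φ t = 0) (n : ℕ) :
    tsupport (cutTest F G ρ V φ n) ⊆ V ∧ support (cutTest F G ρ V φ n) ⊆ support ρ := by
  have hsupp : ∀ z ∈ support (cutTest F G ρ V φ n),
      z ∈ V ∧ z ∈ support ρ ∧ 1 ≤ n * ‖conj (F z) - G z‖ ^ 2 := by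
    intro z hz
    have hzV : z ∈ V := Set.mem_of_indicator_ne_zero hz
    rw [mem_support, cutTest, Set.indicator_of_mem hzV] at hz
    refine ⟨hzV, left_ne_zero_of_mul hz, ?_⟩
    by_contra hlt
    rw [hφ0 _ (not_le.mp hlt)] at hz
    simp at hz
  refine ⟨fun z hz => ?_, fun z hz => (hsupp z hz).2.1⟩
  have hzW : z ∈ W := hs (closure_mono (fun z hz => (hsupp z hz).2.1) hz)
  have hzV : z ∈ closure V := closure_mono (fun z hz => (hsupp z hz).1) hz
  by_contra hnot
  have hfr : z ∈ frontier V := by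
    rw [frontier, D.isOpen_V.interior_eq]
    exact ⟨hzV, hnot⟩
  have hu0 := D.eq_conj z ⟨hzW, hfr⟩
  have hn := D.isOpen_W.mem_nhds hzW
  have hcont : ContinuousAt (fun w => (n : ℝ) * ‖conj (F w) - G w‖ ^ 2) z := by
    have h1 := (D.diffF.differentiableAt hn).continuousAt
    have h2 := (D.diffG.differentiableAt hn).continuousAt
    have h3 : ContinuousAt (fun w => conj (F w)) z := continuous_conj.continuousAt.comp h1
    exact continuousAt_const.mul ((h3.sub h2).norm.pow 2)
  have hlt := hcont.eventually_lt_const (u := 1) (by simp [hu0])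
  obtain ⟨w, hw, hw'⟩ := mem_closure_iff_nhds.mp hz _ hlt
  exact absurd (hsupp w hw').2.2 (not_le.mpr hw)

lemma contDiff_cutTest (D : BoundaryData F G W V z₀ C) {ρ : ℂ → ℂ} (hρ : ContDiff ℝ 1 ρ)
    (hs : tsupport ρ ⊆ W) (hVW : V ⊆ W) {φ : ℝ → ℝ} (hφ : ContDiff ℝ 1 φ)
    (hφ0 : ∀ t < 1, φ t = 0) (n : ℕ) : ContDiff ℝ 1 (cutTest F G ρ V φ n) := by
  rw [contDiff_iff_contDiffAt]
  intro z
  by_cases hz : z ∈ V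
  · have hn := D.isOpen_W.mem_nhds (hVW hz)
    have h1 := (contDiffOn_real D.isOpen_W D.diffF).contDiffAt hn
    have h2 := (contDiffOn_real D.isOpen_W D.diffG).contDiffAt hn
    have h3 : ContDiffAt ℝ 1 (fun w => conj (F w)) z := conjCLE.contDiff.contDiffAt.comp z h1
    have h4 : ContDiffAt ℝ 1 (fun w => (n : ℝ) * ‖conj (F w) - G w‖ ^ 2) z :=
      contDiffAt_const.mul ((h3.sub h2).norm_sq ℝ)
    have h5 : ContDiffAt ℝ 1 (fun w => ((φ (n * ‖conj (F w) - G w‖ ^ 2) : ℝ) : ℂ)) z :=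
      ofRealCLM.contDiff.contDiffAt.comp z (hφ.contDiffAt.comp z h4)
    refine (hρ.contDiffAt.mul h5).congr_of_eventuallyEq ?_
    filter_upwards [D.isOpen_V.mem_nhds hz] with w hw
    rw [cutTest, Set.indicator_of_mem hw]
  · have h0 : z ∉ tsupport (cutTest F G ρ V φ n) := fun h =>
      hz ((D.tsupport_cutTest_subset hs hφ0 n).1 h)
    exact contDiffAt_const.congr_of_eventuallyEq (notMem_tsupport_iff_eventuallyEq.mp h0)

/-- Green's formula for `h` times the spherical area form, up to the boundary. -/
theorem integral_mul_sphDens (D : BoundaryData F G W V z₀ C) {ρ h : ℂ → ℂ} (hρ : ContDiff ℝ 1 ρ)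
    (hc : HasCompactSupport ρ) (hs : tsupport ρ ⊆ W) (hVW : V ⊆ W)
    (hh : DifferentiableOn ℂ h V) (hi : IntegrableOn (fun z => h z * sphDens F z) V) :
    IntegrableOn (fun z => dbar ρ z * (h z * (sphPrim F z - merPrim F G z))) V ∧
    ∫ z in V, ρ z * (h z * sphDens F z) =
      -∫ z in V, dbar ρ z * (h z * (sphPrim F z - merPrim F G z)) := by
  have hVm := D.isOpen_V.measurableSet
  have hgap := D.continuousOn_mul_gap hVW hh
  have hdρ : Continuous (dbar ρ) := continuousOn_univ.mp (continuousOn_dbar isOpen_univ hρ.contDiffOn)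
  have hdc : HasCompactSupport (dbar ρ) :=
    hc.of_isClosed_subset (isClosed_tsupport _) (tsupport_dbar_subset ρ)
  obtain ⟨A, hA⟩ := hρ.continuous.bounded_above_of_compact_support hc
  obtain ⟨B, hB⟩ := hdρ.bounded_above_of_compact_support hdc
  have hA0 : 0 ≤ A := (norm_nonneg _).trans (hA 0)
  have hB0 : 0 ≤ B := (norm_nonneg _).trans (hB 0)
  obtain ⟨φ, L, hφ, hφ0, hφ1, hφb, hL⟩ := exists_cutoff
  have hL0 : 0 ≤ L := by simpa using hL 0 le_rfl
  have hsph : ∀ z, 0 ≤ sphDens F z := fun z => by unfold sphDens; positivity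
  set T := cutTest F G ρ V φ with hT
  have hTd := D.contDiff_cutTest hρ hs hVW hφ hφ0
  have hTs := D.tsupport_cutTest_subset hs hφ0
  have hTV : ∀ n, ∀ z ∈ V, T n z = ρ z * ((φ (n * ‖conj (F z) - G z‖ ^ 2) : ℝ) : ℂ) :=
    fun n z hz => by rw [hT, cutTest, Set.indicator_of_mem hz]
  have hfin : ∀ n, ∫ z in V, T n z * (h z * sphDens F z) =
      -∫ z in V, dbar (T n) z * (h z * (sphPrim F z - merPrim F G z)) := by
    intro n
    obtain ⟨-, e⟩ := RiemannSurface.integral_mul_sphDens D.isOpen_V (hTd n)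
      (hc.mono (hTs n).2) (hTs n).1 hh (D.diffF.mono hVW) (D.diffG.mono hVW)
      fun z hz => D.ne_zero (hVW hz)
    rw [setIntegral_eq_integral_of_forall_compl_eq_zero,
      setIntegral_eq_integral_of_forall_compl_eq_zero, e]
    · intro z hz
      rw [dbar_eq_zero_of_notMem_tsupport fun h => hz ((hTs n).1 h), zero_mul]
    · intro z hz
      rw [hT, image_eq_zero_of_notMem_tsupport fun h => hz ((hTs n).1 h), zero_mul]
  -- The cutoffs tend to `1` only where `conj F ≠ G`; the possible critical point `z₀` is discarded
  -- as a null set.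
  have hae : ∀ᵐ z ∂volume.restrict V, z ∈ V ∧ conj (F z) - G z ≠ 0 := by
    have h0 : volume {z ∈ V \ {z₀} | conj (F z) - G z = 0} = 0 :=
      volume_conj_eq_zero (D.isOpen_V.sdiff isClosed_singleton)
        (D.diffF.mono (Set.sdiff_subset.trans hVW)) (D.diffG.mono (Set.sdiff_subset.trans hVW))
        fun z hz => D.deriv_ne z ⟨hVW hz.1, hz.2⟩
    have h1 : ∀ᵐ z ∂volume, z ∉ {z ∈ V \ {z₀} | conj (F z) - G z = 0} := measure_eq_zero_iff_ae_notMem.mp h0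
    have h2 : ∀ᵐ z : ℂ, z ≠ z₀ := by simp [ae_iff, measure_singleton]
    filter_upwards [ae_restrict_of_ae h1, ae_restrict_of_ae h2, ae_restrict_mem hVm] with z a b c
    exact ⟨c, fun h => a ⟨⟨c, b⟩, h⟩⟩
  -- Agreement in a neighbourhood, not merely at `z`, gives convergence of the `∂/∂z̄` derivatives
  -- as well.
  have hev : ∀ z ∈ V, conj (F z) - G z ≠ 0 → ∀ᶠ n : ℕ in atTop, T n =ᶠ[𝓝 z] ρ := by
    intro z hz hne
    have hpos : 0 < ‖conj (F z) - G z‖ ^ 2 := by positivity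
    obtain ⟨N, hN⟩ := exists_nat_gt (2 / ‖conj (F z) - G z‖ ^ 2)
    filter_upwards [eventually_ge_atTop N] with n hn
    have hlt : 2 < (n : ℝ) * ‖conj (F z) - G z‖ ^ 2 := by
      rw [div_lt_iff₀ hpos] at hN
      exact hN.trans_le (by gcongr)
    have hn' := D.isOpen_W.mem_nhds (hVW hz)
    have hcont : ContinuousAt (fun w => (n : ℝ) * ‖conj (F w) - G w‖ ^ 2) z := by
      have h1 := (D.diffF.differentiableAt hn').continuousAt
      have h2 := (D.diffG.differentiableAt hn').continuousAt
      have h3 : ContinuousAt (fun w => conj (F w)) z := continuous_conj.continuousAt.comp h1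
      exact continuousAt_const.mul ((h3.sub h2).norm.pow 2)
    filter_upwards [hcont.eventually_const_lt hlt, D.isOpen_V.mem_nhds hz] with w hw hwV
    rw [hTV n w hwV, hφ1 _ hw.le]
    simp
  have hlim1 : Tendsto (fun n => ∫ z in V, T n z * (h z * sphDens F z)) atTop
      (𝓝 (∫ z in V, ρ z * (h z * sphDens F z))) := by
    refine tendsto_integral_of_dominated_convergence (fun z => A * ‖h z * sphDens F z‖)
      (fun n => ?_) (hi.norm.const_mul A) (fun n => ?_) ?_
    · exact (hTd n).continuous.aestronglyMeasurable.mul hi.aestronglyMeasurable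
    · filter_upwards [ae_restrict_mem hVm] with z hz
      rw [norm_mul, hTV n z hz, norm_mul, norm_real, Real.norm_eq_abs]
      have := hA z
      have := hφb (n * ‖conj (F z) - G z‖ ^ 2)
      gcongr
      exact (mul_le_mul (hA z) this (abs_nonneg _) hA0).trans_eq (mul_one A)
    · filter_upwards [hae] with z hz
      refine tendsto_const_nhds.congr' ?_
      filter_upwards [hev z hz.1 hz.2] with n hn
      rw [hn.eq_of_nhds]
  have hgb : ∀ z ∈ V, ‖h z * (sphPrim F z - merPrim F G z)‖ ≤
      2 * C * (1 + C ^ 2) ^ 2 * ‖h z * sphDens F z‖ := fun z hz => by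
    rw [norm_mul, norm_mul_sphDens]
    calc _ ≤ ‖h z‖ * (2 * C * (1 + C ^ 2) ^ 2 * sphDens F z) := by
          gcongr
          exact D.norm_gap_le_sphDens (hVW hz)
      _ = _ := by ring
  have hlim2 : Tendsto (fun n => ∫ z in V, dbar (T n) z * (h z * (sphPrim F z - merPrim F G z)))
      atTop (𝓝 (∫ z in V, dbar ρ z * (h z * (sphPrim F z - merPrim F G z)))) := by
    -- The two summands dominate the terms with `∂ρ/∂z̄` and with the derivative of the cutoff,
    -- respectively.
    refine tendsto_integral_of_dominated_convergence (fun z => (B * (2 * C * (1 + C ^ 2) ^ 2) +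
      A * (4 * L * (1 + C) * (1 + C ^ 2) ^ 2)) * ‖h z * sphDens F z‖)
      (fun n => ?_) (hi.norm.const_mul _) (fun n => ?_) ?_
    · exact (continuousOn_univ.mp
        (continuousOn_dbar isOpen_univ (hTd n).contDiffOn)).aestronglyMeasurable.mul
        (hgap.continuousOn.aestronglyMeasurable hVm)
    · filter_upwards [ae_restrict_mem hVm] with z hz
      have hC := D.C_nonneg (hVW hz)
      obtain ⟨hd, hb⟩ := D.norm_dbar_cutoff_le (hVW hz) hφ hL n
      have e : dbar (T n) z = dbar ρ z * ((φ (n * ‖conj (F z) - G z‖ ^ 2) : ℝ) : ℂ) +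
          ρ z * dbar (fun w => ((φ (n * ‖conj (F w) - G w‖ ^ 2) : ℝ) : ℂ)) z := by
        rw [← dbar_mul (hρ.differentiable one_ne_zero z) hd]
        refine dbar_congr ?_
        filter_upwards [D.isOpen_V.mem_nhds hz] with w hw using hTV n w hw
      rw [e, add_mul, add_mul]
      refine (norm_add_le _ _).trans (add_le_add ?_ ?_)
      · rw [norm_mul, norm_mul (dbar ρ z), norm_real, Real.norm_eq_abs, mul_assoc B]
        refine mul_le_mul ?_ (hgb z hz) (norm_nonneg _) hB0
        exact (mul_le_mul (hB z) (hφb _) (abs_nonneg _) hB0).trans_eq (mul_one B)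
      · rw [norm_mul, norm_mul, norm_mul (h z), norm_mul_sphDens]
        calc _ = ‖ρ z‖ * (‖h z‖ *
              (‖dbar (fun w => ((φ (n * ‖conj (F w) - G w‖ ^ 2) : ℝ) : ℂ)) z‖ *
                ‖sphPrim F z - merPrim F G z‖)) := by ring
          _ ≤ A * (‖h z‖ * (4 * L * (1 + C) * ((1 + C ^ 2) ^ 2 * sphDens F z))) := by
              have h9 := hb.trans (mul_le_mul_of_nonneg_left (D.sq_deriv_le (hVW hz))
                (by positivity : 0 ≤ 4 * L * (1 + C)))
              exact mul_le_mul (hA z) (mul_le_mul_of_nonneg_left h9 (norm_nonneg _))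
                (by positivity) hA0
          _ = _ := by ring
    · filter_upwards [hae] with z hz
      refine tendsto_const_nhds.congr' ?_
      filter_upwards [hev z hz.1 hz.2] with n hn
      rw [dbar_congr hn]
  refine ⟨?_, ?_⟩
  · refine Integrable.mono' (hi.norm.const_mul (B * (2 * C * (1 + C ^ 2) ^ 2)))
      (hdρ.aestronglyMeasurable.mul (hgap.continuousOn.aestronglyMeasurable hVm)) ?_
    filter_upwards [ae_restrict_mem hVm] with z hz
    rw [norm_mul, mul_assoc B]
    exact mul_le_mul (hB z) (hgb z hz) (norm_nonneg _) hB0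
  · refine tendsto_nhds_unique hlim1 ?_
    simp only [hfin]
    exact hlim2.neg

end BoundaryData

end RiemannSurface

/-! ### Charts: orders, the identity theorem, and change of coordinates. -/

namespace RiemannSurface

section Charts

variable {M : Type*} [TopologicalSpace M]

lemma tendsto_chart_punctured {e : OpenPartialHomeomorph M ℂ} {p : M} (hp : p ∈ e.source) :
    Tendsto e (𝓝[≠] p) (𝓝[≠] (e p)) := by
  refine tendsto_nhdsWithin_iff.mpr ⟨(e.continuousAt hp).tendsto.mono_left nhdsWithin_le_nhds, ?_⟩
  filter_upwards [self_mem_nhdsWithin, mem_nhdsWithin_of_mem_nhds (e.open_source.mem_nhds hp)]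
    with q hq hqs h
  exact hq (e.injOn hqs hp h)

lemma tendsto_chart_symm {e : OpenPartialHomeomorph M ℂ} {p : M} (hp : p ∈ e.source) :
    Tendsto e.symm (𝓝 (e p)) (𝓝 p) := by
  have := (e.continuousAt_symm (e.map_source hp)).tendsto
  rwa [e.left_inv hp] at this

lemma tendsto_chart_symm_punctured {e : OpenPartialHomeomorph M ℂ} {p : M} (hp : p ∈ e.source) :
    Tendsto e.symm (𝓝[≠] (e p)) (𝓝[≠] p) := by
  have := tendsto_chart_punctured (e := e) hp
  refine tendsto_nhdsWithin_iff.mpr ⟨(tendsto_chart_symm hp).mono_left nhdsWithin_le_nhds, ?_⟩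
  filter_upwards [self_mem_nhdsWithin,
    mem_nhdsWithin_of_mem_nhds (e.open_target.mem_nhds (e.map_source hp))] with z hz hzt h
  refine hz ?_
  rw [Set.mem_singleton_iff] at h ⊢
  rw [← h, e.right_inv hzt]

lemma eventually_punctured_iff {e : OpenPartialHomeomorph M ℂ} {p : M} (hp : p ∈ e.source)
    {P : M → Prop} : (∀ᶠ q in 𝓝[≠] p, P q) ↔ ∀ᶠ z in 𝓝[≠] (e p), P (e.symm z) := by
  refine ⟨fun h => (tendsto_chart_symm_punctured hp).eventually h, fun h => ?_⟩
  filter_upwards [(tendsto_chart_punctured hp).eventually h,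
    mem_nhdsWithin_of_mem_nhds (e.open_source.mem_nhds hp)] with q hq hqs
  rwa [e.left_inv hqs] at hq

lemma finite_of_eventually_punctured [CompactSpace M] {P : M → Prop}
    (h : ∀ p, ∀ᶠ q in 𝓝[≠] p, P q) : {q | ¬ P q}.Finite := by
  have h2 : ∀ p, {q | P q} ∪ {p} ∈ 𝓝 p := by
    intro p
    filter_upwards [eventually_nhdsWithin_iff.mp (h p)] with q hq
    by_cases hqp : q = p
    · exact Or.inr hqp
    · exact Or.inl (hq hqp)
  obtain ⟨t, ht⟩ := CompactSpace.elim_nhds_subcover _ h2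
  refine t.finite_toSet.subset fun q hq => ?_
  have hq2 : q ∈ ⋃ x ∈ t, {q | P q} ∪ {x} := by
    rw [ht]
    trivial
  simp only [Set.mem_iUnion] at hq2
  obtain ⟨x, hx, h3 | h3⟩ := hq2
  · exact absurd h3 hq
  · rw [Set.mem_singleton_iff] at h3
    exact h3 ▸ hx

variable {e e' : OpenPartialHomeomorph M ℂ}

/-- Expressing a function in another chart. -/
lemma comp_symm_eventuallyEq {β : Type*} (f : M → β) {x : M} (hx : x ∈ e.source)
    (hx' : x ∈ e'.source) :
    (fun z => f (e.symm z)) =ᶠ[𝓝 (e x)] (fun w => f (e'.symm w)) ∘ fun z => e' (e.symm z) := by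
  filter_upwards [(tendsto_chart_symm hx).eventually (e'.open_source.mem_nhds hx')] with z hz
  simp [e'.left_inv hz]

variable [ChartedSpace ℂ M]

lemma coord_mem_target (p : M) : coord p ∈ (chartAt ℂ p).target := mem_chart_target ℂ p

lemma eventually_punctured_coord_iff {p : M} {P : M → Prop} :
    (∀ᶠ q in 𝓝[≠] p, P q) ↔ ∀ᶠ z in 𝓝[≠] (coord p), P ((chartAt ℂ p).symm z) :=
  eventually_punctured_iff (mem_chart_source ℂ p)

instance punctured_neBot (p : M) : (𝓝[≠] p).NeBot :=
  (tendsto_chart_symm_punctured (mem_chart_source ℂ p)).neBot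

lemma eventually_target_punctured (p : M) :
    ∀ᶠ z in 𝓝[≠] (coord p), z ∈ (chartAt ℂ p).target :=
  mem_nhdsWithin_of_mem_nhds ((chartAt ℂ p).open_target.mem_nhds (coord_mem_target p))

lemma orderAt_eq_top_iff {f : M → ℂ} {p : M} :
    orderAt f p = ⊤ ↔ ∀ᶠ q in 𝓝[≠] p, f q = 0 := by
  rw [orderAt, meromorphicOrderAt_eq_top_iff, eventually_punctured_coord_iff (p := p)]
  rfl

lemma IsMeromorphic.orderAt_ne_top_iff {f : M → ℂ} (hf : IsMeromorphic f) {p : M} :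
    orderAt f p ≠ ⊤ ↔ ∀ᶠ q in 𝓝[≠] p, f q ≠ 0 := by
  rw [orderAt, meromorphicOrderAt_ne_top_iff_eventually_ne_zero (hf p),
    eventually_punctured_coord_iff (p := p)]
  rfl

/-- The identity theorem. -/
lemma IsMeromorphic.orderAt_eq_top [T2Space M] [PreconnectedSpace M] {f : M → ℂ}
    (hf : IsMeromorphic f) {p : M} (hp : orderAt f p = ⊤) (q : M) : orderAt f q = ⊤ := by
  -- Around each point `f` either vanishes on a punctured neighbourhood or has no zero on one, and
  -- either alternative is inherited by nearby points.
  have hclopen : IsClopen {p | orderAt f p = ⊤} := by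
    refine ⟨⟨?_⟩, ?_⟩
    · rw [isOpen_iff_eventually]
      intro x hx
      have h1 := hf.orderAt_ne_top_iff.mp hx
      rw [← eventually_eventually_nhdsWithin] at h1
      rw [eventually_nhdsWithin_iff] at h1
      filter_upwards [h1] with y hy
      by_cases hyx : y = x
      · rwa [hyx]
      · have h2 : ∀ᶠ w in 𝓝[≠] y, f w ≠ 0 := by
          have := hy hyx
          rw [(isOpen_compl_singleton.nhdsWithin_eq (show y ∈ ({x}ᶜ : Set M) from hyx))] at this
          exact this.filter_mono nhdsWithin_le_nhds
        exact hf.orderAt_ne_top_iff.mpr h2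
    · rw [isOpen_iff_eventually]
      intro x hx
      have h1 := orderAt_eq_top_iff.mp hx
      rw [← eventually_eventually_nhdsWithin] at h1
      rw [eventually_nhdsWithin_iff] at h1
      filter_upwards [h1] with y hy
      by_cases hyx : y = x
      · rwa [hyx]
      · have h2 : ∀ᶠ w in 𝓝[≠] y, f w = 0 := by
          have := hy hyx
          rw [(isOpen_compl_singleton.nhdsWithin_eq (show y ∈ ({x}ᶜ : Set M) from hyx))] at this
          exact this.filter_mono nhdsWithin_le_nhds
        exact orderAt_eq_top_iff.mpr h2
  have := hclopen.eq_univ ⟨p, hp⟩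
  exact (Set.ext_iff.mp this q).mpr trivial

variable [IsManifold 𝓘(ℂ) ω M]

lemma analyticAt_transition (he : e ∈ atlas ℂ M) (he' : e' ∈ atlas ℂ M) {x : M}
    (hx : x ∈ e.source) (hx' : x ∈ e'.source) :
    AnalyticAt ℂ (fun z => e' (e.symm z)) (e x) := by
  have h1 : ContMDiffAt 𝓘(ℂ) 𝓘(ℂ) ω e' x := contMDiffAt_of_mem_maximalAtlas
    (StructureGroupoid.subset_maximalAtlas _ he') hx'
  have h2 : ContMDiffAt 𝓘(ℂ) 𝓘(ℂ) ω e.symm (e x) := contMDiffAt_symm_of_mem_maximalAtlas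
    (StructureGroupoid.subset_maximalAtlas _ he) (e.map_source hx)
  have h3 : ContMDiffAt 𝓘(ℂ) 𝓘(ℂ) ω (e' ∘ e.symm) (e x) :=
    ContMDiffAt.comp (e x) (by rwa [e.left_inv hx]) h2
  exact (contMDiffAt_iff_contDiffAt.mp h3).analyticAt

lemma deriv_transition_mul (he : e ∈ atlas ℂ M) (he' : e' ∈ atlas ℂ M) {x : M}
    (hx : x ∈ e.source) (hx' : x ∈ e'.source) :
    deriv (fun w => e (e'.symm w)) (e' x) * deriv (fun z => e' (e.symm z)) (e x) = 1 := by
  have h1 := (analyticAt_transition he he' hx hx').differentiableAt.hasDerivAt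
  have h2 := (analyticAt_transition he' he hx' hx).differentiableAt.hasDerivAt
  have h3 : HasDerivAt (fun w => e (e'.symm w)) (deriv (fun w => e (e'.symm w)) (e' x))
      ((fun z => e' (e.symm z)) (e x)) := by simpa only [e.left_inv hx] using h2
  have h4 := (h3.comp (e x) h1).deriv
  rw [← h4]
  have h5 := comp_symm_eventuallyEq (e := e) (e' := e') (fun q => e q) hx hx'
  rw [← h5.deriv_eq]
  have h6 : (fun z => e (e.symm z)) =ᶠ[𝓝 (e x)] id := by
    filter_upwards [e.open_target.mem_nhds (e.map_source hx)] with z hz using e.right_inv hz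
  rw [h6.deriv_eq, deriv_id]

lemma deriv_transition_ne_zero (he : e ∈ atlas ℂ M) (he' : e' ∈ atlas ℂ M) {x : M}
    (hx : x ∈ e.source) (hx' : x ∈ e'.source) :
    deriv (fun z => e' (e.symm z)) (e x) ≠ 0 := fun h => by
  have := deriv_transition_mul he he' hx hx'
  rw [h, mul_zero] at this
  exact zero_ne_one this

lemma analyticAt_chart_change (he : e ∈ atlas ℂ M) (he' : e' ∈ atlas ℂ M) {x : M}
    (hx : x ∈ e.source) (hx' : x ∈ e'.source) {f : M → ℂ}
    (hf : AnalyticAt ℂ (fun w => f (e'.symm w)) (e' x)) :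
    AnalyticAt ℂ (fun z => f (e.symm z)) (e x) := by
  refine AnalyticAt.congr ?_ (comp_symm_eventuallyEq f hx hx').symm
  refine AnalyticAt.comp ?_ (analyticAt_transition he he' hx hx')
  rwa [e.left_inv hx]

lemma deriv_chart_change (he : e ∈ atlas ℂ M) (he' : e' ∈ atlas ℂ M) {x : M}
    (hx : x ∈ e.source) (hx' : x ∈ e'.source) (f : M → ℂ) :
    deriv (fun z => f (e.symm z)) (e x) =
      deriv (fun w => f (e'.symm w)) (e' x) * deriv (fun z => e' (e.symm z)) (e x) := by
  have hT := (analyticAt_transition he he' hx hx').differentiableAt.hasDerivAt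
  have hne := deriv_transition_ne_zero he he' hx hx'
  by_cases hd : DifferentiableAt ℂ (fun w => f (e'.symm w)) (e' x)
  · have h3 : HasDerivAt (fun w => f (e'.symm w)) (deriv (fun w => f (e'.symm w)) (e' x))
        ((fun z => e' (e.symm z)) (e x)) := by simpa only [e.left_inv hx] using hd.hasDerivAt
    rw [(comp_symm_eventuallyEq f hx hx').deriv_eq, (h3.comp (e x) hT).deriv]
  -- Differentiability in one chart is equivalent to differentiability in the other, so both sides
  -- take the default value `0`; no regularity of `f` is needed.
  · rw [deriv_zero_of_not_differentiableAt hd, zero_mul, deriv_zero_of_not_differentiableAt]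
    intro hd'
    apply hd
    have hT' := (analyticAt_transition he' he hx' hx).differentiableAt
    refine DifferentiableAt.congr_of_eventuallyEq ?_ (comp_symm_eventuallyEq f hx' hx)
    refine DifferentiableAt.comp _ ?_ hT'
    rwa [e'.left_inv hx']

/-- Partitions of unity exist only in the real smooth category; holomorphic transition maps are real
smooth. -/
lemma isManifold_real : IsManifold 𝓘(ℝ, ℂ) ∞ M := by
  refine isManifold_of_contDiffOn 𝓘(ℝ, ℂ) ∞ M fun e e' he he' => ?_
  intro z hz
  simp only [modelWithCornersSelf_coe, modelWithCornersSelf_coe_symm, id,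
    Set.range_id, Set.inter_univ, OpenPartialHomeomorph.trans_source,
    OpenPartialHomeomorph.symm_source, Set.mem_inter_iff, Set.mem_preimage] at hz
  have h := analyticAt_transition he he' (e.map_target hz.1) hz.2
  rw [e.right_inv hz.1] at h
  exact (h.contDiffAt.restrict_scalars ℝ).contDiffWithinAt

/-- `f` is holomorphic at `p`. -/
def RegAt (f : M → ℂ) (p : M) : Prop := AnalyticAt ℂ (inChart f p) (coord p)

lemma RegAt.analyticAt {f : M → ℂ} {p : M} (h : RegAt f p) (he : e ∈ atlas ℂ M)
    (hp : p ∈ e.source) : AnalyticAt ℂ (fun z => f (e.symm z)) (e p) :=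
  analyticAt_chart_change he (chart_mem_atlas ℂ p) hp (mem_chart_source ℂ p) h

lemma RegAt.of_analyticAt {f : M → ℂ} {p : M} (he : e ∈ atlas ℂ M)
    (hp : p ∈ e.source) (h : AnalyticAt ℂ (fun z => f (e.symm z)) (e p)) : RegAt f p :=
  analyticAt_chart_change (chart_mem_atlas ℂ p) he (mem_chart_source ℂ p) hp h

lemma regAt_iff_chart {f : M → ℂ} (he : e ∈ atlas ℂ M) {z : ℂ} (hz : z ∈ e.target) :
    RegAt f (e.symm z) ↔ AnalyticAt ℂ (fun z => f (e.symm z)) z := by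
  constructor
  · intro h
    have := h.analyticAt he (e.map_target hz)
    rwa [e.right_inv hz] at this
  · intro h
    exact RegAt.of_analyticAt he (e.map_target hz) (by rwa [e.right_inv hz])

lemma IsMeromorphic.eventually_regAt {f : M → ℂ} (hf : IsMeromorphic f) (p : M) :
    ∀ᶠ q in 𝓝[≠] p, RegAt f q := by
  rw [eventually_punctured_coord_iff]
  filter_upwards [(hf p).eventually_analyticAt, eventually_target_punctured p] with z hz hzt
  exact (regAt_iff_chart (chart_mem_atlas ℂ p) hzt).mpr hz

end Charts

end RiemannSurface

/-! ### The reflected function. -/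

namespace RiemannSurface

lemma analyticAt_conj_conj {F : ℂ → ℂ} {a : ℂ} (hF : AnalyticAt ℂ F a) :
    AnalyticAt ℂ (fun w => conj (F (conj w))) (conj a) := by
  rw [analyticAt_iff_eventually_differentiableAt] at hF ⊢
  have h : Tendsto (fun w : ℂ => conj w) (𝓝 (conj a)) (𝓝 a) := by
    have := (continuous_conj.tendsto (conj a))
    rwa [conj_conj] at this
  filter_upwards [h.eventually hF] with w hw
  have := DifferentiableAt.conj_conj hw
  rwa [conj_conj] at this

lemma meromorphicAt_conj_conj {F : ℂ → ℂ} {a : ℂ} (hF : MeromorphicAt F a) :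
    MeromorphicAt (fun w => conj (F (conj w))) (conj a) := by
  obtain ⟨n, hn⟩ := hF
  refine ⟨n, (analyticAt_conj_conj hn).congr (Eventually.of_forall fun w => ?_)⟩
  simp

section Reflection

variable {M : Type*} [TopologicalSpace M] [ChartedSpace ℂ M] {J : M → M}

/-- The conjugate of `J` in the coordinates at `p` and `J p`. -/
noncomputable def conjChart (J : M → M) (p : M) (z : ℂ) : ℂ :=
  conj (chartAt ℂ (J p) (J ((chartAt ℂ p).symm z)))

lemma conjChart_coord (p : M) : conjChart J p (coord p) = conj (coord (J p)) := by
  rw [conjChart, coord, (chartAt ℂ p).left_inv (mem_chart_source ℂ p)]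
  rfl

lemma eventually_source (hJ : Continuous J) (p : M) :
    ∀ᶠ z in 𝓝 (coord p), z ∈ (chartAt ℂ p).target ∧
      J ((chartAt ℂ p).symm z) ∈ (chartAt ℂ (J p)).source := by
  have h1 := (hJ.tendsto p).comp (tendsto_chart_symm (mem_chart_source ℂ p))
  exact Filter.Eventually.and ((chartAt ℂ p).open_target.mem_nhds (coord_mem_target p))
    (h1.eventually ((chartAt ℂ (J p)).open_source.mem_nhds (mem_chart_source ℂ (J p))))

variable [IsManifold 𝓘(ℂ) ω M]

/-- The hypothesis gives differentiability only at the centre of each chart. Transporting it from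
the charts at a nearby `q` and at `J q` gives differentiability on a neighbourhood, hence
analyticity. -/
lemma analyticAt_conjChart (hJ : IsAntiholomorphic J) (p : M) :
    AnalyticAt ℂ (conjChart J p) (coord p) := by
  rw [analyticAt_iff_eventually_differentiableAt]
  filter_upwards [eventually_source hJ.1 p] with z hz
  set q := (chartAt ℂ p).symm z with hq
  have hqs : q ∈ (chartAt ℂ p).source := (chartAt ℂ p).map_target hz.1
  have hzq : chartAt ℂ p q = z := (chartAt ℂ p).right_inv hz.1
  have hT1 := (analyticAt_transition (chart_mem_atlas ℂ p) (chart_mem_atlas ℂ q) hqs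
    (mem_chart_source ℂ q)).differentiableAt
  have hT2 := (analyticAt_transition (chart_mem_atlas ℂ (J q)) (chart_mem_atlas ℂ (J p))
    (mem_chart_source ℂ (J q)) hz.2).differentiableAt
  have h3 : DifferentiableAt ℂ (fun w => conj (chartAt ℂ (J p) ((chartAt ℂ (J q)).symm (conj w))))
      (conjChart J q (coord q)) := by
    rw [conjChart_coord]
    exact DifferentiableAt.conj_conj hT2
  have h4 : DifferentiableAt ℂ (conjChart J q) (coord q) := hJ.2 q
  have h5 := h3.comp (coord q) h4
  rw [hzq] at hT1
  have h6 : DifferentiableAt ℂ ((fun w => conj (chartAt ℂ (J p)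
      ((chartAt ℂ (J q)).symm (conj w)))) ∘ conjChart J q) (chartAt ℂ q ((chartAt ℂ p).symm z)) := h5
  have h7 := h6.comp z hT1
  refine h7.congr_of_eventuallyEq ?_
  have ht : Tendsto (chartAt ℂ p).symm (𝓝 z) (𝓝 q) := by
    have := tendsto_chart_symm hqs
    rwa [hzq] at this
  filter_upwards [ht.eventually ((chartAt ℂ q).open_source.mem_nhds (mem_chart_source ℂ q)),
    ((hJ.1.tendsto q).comp ht).eventually
      ((chartAt ℂ (J q)).open_source.mem_nhds (mem_chart_source ℂ (J q)))] with w hw hw'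
  simp only [Function.comp_apply, conjChart, conj_conj, (chartAt ℂ q).left_inv hw] at hw' ⊢
  rw [(chartAt ℂ (J q)).left_inv hw']

omit [IsManifold 𝓘(ℂ) ω M] in
lemma inChart_reflect (hJ : Continuous J) (f : M → ℂ) (p : M) :
    inChart (reflect J f) p =ᶠ[𝓝 (coord p)]
      fun z => conj (inChart f (J p) (conj (conjChart J p z))) := by
  filter_upwards [eventually_source hJ p] with z hz
  simp only [inChart, reflect, conjChart, conj_conj]
  rw [(chartAt ℂ (J p)).left_inv hz.2]

lemma IsMeromorphic.reflect (hJ : IsAntiholomorphic J) {f : M → ℂ} (hf : IsMeromorphic f) :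
    IsMeromorphic (reflect J f) := by
  intro p
  have h1 := meromorphicAt_conj_conj (hf (J p))
  rw [← conjChart_coord] at h1
  exact (h1.comp_analyticAt (analyticAt_conjChart hJ p)).congr
    ((inChart_reflect hJ.1 f p).symm.filter_mono nhdsWithin_le_nhds)

end Reflection

/-! ### The half `M₊` and its boundary. -/

section Topology

variable {M : Type*} [TopologicalSpace M] {J : M → M} {Mplus : Set M}

lemma isOpen_of_mem_components [T2Space M] [LocallyConnectedSpace M] (hJ : Continuous J)
    (h : Mplus ∈ components (fixedPoints J)ᶜ) : IsOpen Mplus := by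
  obtain ⟨x, -, rfl⟩ := h
  exact (isClosed_fixedPoints hJ).isOpen_compl.connectedComponentIn

/-- A boundary point not fixed by `J` would lie in an open component meeting `M₊`, hence equal to
`M₊`, and so be interior. -/
lemma frontier_subset_fixedPoints [T2Space M] [LocallyConnectedSpace M] (hJ : Continuous J)
    (h : Mplus ∈ components (fixedPoints J)ᶜ) : frontier Mplus ⊆ fixedPoints J := by
  intro p hp
  by_contra hpJ
  have hop := isOpen_of_mem_components hJ h
  have hC : IsOpen (connectedComponentIn (fixedPoints J)ᶜ p) :=
    (isClosed_fixedPoints hJ).isOpen_compl.connectedComponentIn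
  have hpC : p ∈ connectedComponentIn (fixedPoints J)ᶜ p := mem_connectedComponentIn hpJ
  obtain ⟨q, hqC, hq⟩ := mem_closure_iff.mp hp.1 _ hC hpC
  obtain ⟨x, hx, rfl⟩ := h
  have h1 := connectedComponentIn_eq hq
  have h2 := connectedComponentIn_eq hqC
  rw [h2, ← h1] at hpC
  exact hp.2 (by rwa [hop.interior_eq])

/-- With empty boundary `M₊` would be all of `M`, leaving a single component. A boundary point is
later needed to see that `1 + f f*` is not identically zero. -/
lemma frontier_nonempty [T2Space M] [PreconnectedSpace M]
    (h2 : (components (fixedPoints J)ᶜ).ncard = 2) (h : Mplus ∈ components (fixedPoints J)ᶜ) :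
    (frontier Mplus).Nonempty := by
  have hne : Mplus.Nonempty := by
    obtain ⟨x, hx, rfl⟩ := h
    exact ⟨x, mem_connectedComponentIn hx⟩
  refine nonempty_frontier_iff.mpr ⟨hne, fun hu => ?_⟩
  have : components (fixedPoints J)ᶜ = {Mplus} := by
    refine Set.eq_singleton_iff_unique_mem.mpr ⟨h, ?_⟩
    rintro _ ⟨y, hy, rfl⟩
    obtain ⟨x, hx, rfl⟩ := h
    have hyx : y ∈ connectedComponentIn (fixedPoints J)ᶜ x := by
      rw [hu]
      trivial
    exact (connectedComponentIn_eq hyx).symm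
  rw [this, Set.ncard_singleton] at h2
  omega

end Topology

end RiemannSurface

/-! ### Points at which nothing singular happens. -/

namespace RiemannSurface

/-- Differentiation lowers a finite nonzero order by one. If `F` has order `0`, subtracting its
limit makes the order positive without changing the derivative. -/
lemma meromorphicOrderAt_deriv_ne_top {F : ℂ → ℂ} {z₀ : ℂ} (hF : MeromorphicAt F z₀)
    (h : ∀ c : ℂ, meromorphicOrderAt (fun z => F z - c) z₀ ≠ ⊤) :
    meromorphicOrderAt (deriv F) z₀ ≠ ⊤ := by
  have key : ∀ c : ℂ, meromorphicOrderAt (fun z => F z - c) z₀ ≠ 0 →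
      meromorphicOrderAt (deriv F) z₀ ≠ ⊤ := by
    intro c hc
    obtain ⟨n, hn⟩ := WithTop.ne_top_iff_exists.mp (h c)
    have hn0 : (n : ℂ) ≠ 0 := by
      intro h0
      rw [Int.cast_eq_zero] at h0
      rw [← hn, h0] at hc
      exact hc rfl
    have h1 := meromorphicOrderAt_deriv_eq_sub_one hn0 hn.symm
    have h2 : deriv (fun z => F z - c) = deriv F := by
      ext z
      rw [deriv_sub_const]
    rw [← h2, h1]
    exact WithTop.coe_ne_top
  by_cases h0 : meromorphicOrderAt F z₀ = 0
  · obtain ⟨a, -, ha⟩ := (tendsto_ne_zero_iff_meromorphicOrderAt_eq_zero hF).mpr h0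
    refine key a (ne_of_gt ?_)
    rw [← tendsto_zero_iff_meromorphicOrderAt_pos (by fun_prop)]
    simpa using ha.sub_const a
  · refine key 0 ?_
    simpa using h0

section Good

variable {M : Type*} [TopologicalSpace M] [ChartedSpace ℂ M]

/-- Points at which nothing singular happens. -/
structure Good (f g : M → ℂ) (q : M) : Prop where
  reg : RegAt f q
  reg' : RegAt g q
  ne : f q ≠ 0
  ne' : 1 + f q * g q ≠ 0
  der : deriv (inChart f q) (coord q) ≠ 0

lemma IsMeromorphic.add {f g : M → ℂ} (hf : IsMeromorphic f) (hg : IsMeromorphic g) :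
    IsMeromorphic fun q => f q + g q := fun p => (hf p).add (hg p)

lemma IsMeromorphic.mul {f g : M → ℂ} (hf : IsMeromorphic f) (hg : IsMeromorphic g) :
    IsMeromorphic fun q => f q * g q := fun p => (hf p).mul (hg p)

lemma IsMeromorphic.const (c : ℂ) : IsMeromorphic fun _ : M => c := fun _ =>
  MeromorphicAt.const c _

/-- By the identity theorem, `f - c` vanishing near one point forces `f = c` off a discrete set, the
only sense of constancy that ignores irrelevant values. -/
lemma orderAt_sub_const_ne_top [T2Space M] [PreconnectedSpace M] {f : M → ℂ} (hf : IsMeromorphic f)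
    (hn : ∀ c : ℂ, ¬ f =ᶠ[codiscrete M] fun _ => c) (c : ℂ) (p : M) :
    orderAt (fun q => f q - c) p ≠ ⊤ := by
  intro h
  have hm : IsMeromorphic fun q => f q - c := by
    simpa [sub_eq_add_neg] using hf.add (IsMeromorphic.const (-c))
  refine hn c ?_
  change {x | f x = c} ∈ codiscreteWithin Set.univ
  rw [mem_codiscreteWithin_iff_forall_mem_nhdsNE]
  intro x _
  have hx := orderAt_eq_top_iff.mp (hm.orderAt_eq_top h x)
  filter_upwards [hx] with q hq
  exact Or.inl (sub_eq_zero.mp hq)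

variable [IsManifold 𝓘(ℂ) ω M]

lemma eventually_good {f g : M → ℂ} (hf : IsMeromorphic f) (hg : IsMeromorphic g)
    (hn : ∀ (c : ℂ) (p : M), orderAt (fun q => f q - c) p ≠ ⊤)
    (h1 : ∀ p : M, orderAt (fun q => 1 + f q * g q) p ≠ ⊤) (p : M) :
    ∀ᶠ q in 𝓝[≠] p, Good f g q := by
  have hm : IsMeromorphic fun q => 1 + f q * g q := (IsMeromorphic.const 1).add (hf.mul hg)
  have hn0 : orderAt f p ≠ ⊤ := by simpa using hn 0 p
  have hd : ∀ᶠ q in 𝓝[≠] p, deriv (inChart f q) (coord q) ≠ 0 := by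
    have hd0 := meromorphicOrderAt_deriv_ne_top (hf p) fun c => hn c p
    rw [meromorphicOrderAt_ne_top_iff_eventually_ne_zero (hf p).deriv] at hd0
    rw [eventually_punctured_coord_iff]
    filter_upwards [hd0, eventually_target_punctured p] with z hz hzt h0
    have hs := (chartAt ℂ p).map_target hzt
    have e := deriv_chart_change (chart_mem_atlas ℂ p) (chart_mem_atlas ℂ ((chartAt ℂ p).symm z))
      hs (mem_chart_source ℂ _) f
    rw [(chartAt ℂ p).right_inv hzt] at e
    have h0' : deriv (fun w => f ((chartAt ℂ ((chartAt ℂ p).symm z)).symm w))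
      (chartAt ℂ ((chartAt ℂ p).symm z) ((chartAt ℂ p).symm z)) = 0 := h0
    rw [h0', zero_mul] at e
    exact hz e
  filter_upwards [hf.eventually_regAt p, hg.eventually_regAt p, hf.orderAt_ne_top_iff.mp hn0,
    hm.orderAt_ne_top_iff.mp (h1 p), hd] with q a b c d e
  exact ⟨a, b, c, d, e⟩

/-- Near a good point in a chart. -/
lemma Good.chart {f g : M → ℂ} {e : OpenPartialHomeomorph M ℂ} (he : e ∈ atlas ℂ M) {z : ℂ}
    (hz : z ∈ e.target) (h : Good f g (e.symm z)) :
    AnalyticAt ℂ (fun w => f (e.symm w)) z ∧ AnalyticAt ℂ (fun w => g (e.symm w)) z ∧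
      deriv (fun w => f (e.symm w)) z ≠ 0 := by
  refine ⟨(regAt_iff_chart he hz).mp h.reg, (regAt_iff_chart he hz).mp h.reg', ?_⟩
  have hs := e.map_target hz
  have h1 := deriv_chart_change he (chart_mem_atlas ℂ (e.symm z)) hs (mem_chart_source ℂ _) f
  have h2 := deriv_transition_ne_zero he (chart_mem_atlas ℂ (e.symm z)) hs (mem_chart_source ℂ _)
  rw [e.right_inv hz] at h1 h2
  rw [h1]
  exact mul_ne_zero h.der h2

omit [IsManifold 𝓘(ℂ) ω M] in
lemma orderAt_eq_zero_of_regAt {f : M → ℂ} {q : M} (h : RegAt f q) (h0 : f q ≠ 0) :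
    orderAt f q = 0 := by
  have hz : inChart f q (coord q) ≠ 0 := by
    rw [inChart, coord, (chartAt ℂ q).left_inv (mem_chart_source ℂ q)]
    exact h0
  rw [orderAt, AnalyticAt.meromorphicOrderAt_eq h, (AnalyticAt.analyticOrderAt_eq_zero h).mpr hz]
  rfl

end Good

end RiemannSurface

/-! ### Local data at a boundary point. -/

namespace RiemannSurface

open Asymptotics

/-- A nonconstant holomorphic function, compared with its reflection. -/
lemma exists_reflection_bound {F j : ℂ → ℂ} {z₀ : ℂ} (hF : AnalyticAt ℂ F z₀)
    (hn : meromorphicOrderAt (fun z => F z - F z₀) z₀ ≠ ⊤) (hj : AnalyticAt ℂ j z₀)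
    (hj0 : j z₀ = conj z₀) :
    ∃ C : ℝ, ∀ᶠ z in 𝓝 z₀,
      ‖deriv (fun z => conj (F (conj (j z)))) z‖ ≤ C * ‖deriv F z‖ ∧
      ‖conj (F z) - conj (F (conj (j z)))‖ ≤ C * ‖deriv F z‖ := by
  have hsub : AnalyticAt ℂ (fun z => F z - F z₀) z₀ := by fun_prop
  have hno : analyticOrderAt (fun z => F z - F z₀) z₀ ≠ ⊤ := by
    intro h
    rw [hsub.meromorphicOrderAt_eq, h] at hn
    exact hn rfl
  obtain ⟨m, hm⟩ := ENat.ne_top_iff_exists.mp hno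
  have hm0 : m ≠ 0 := by
    rintro rfl
    have : analyticOrderAt (fun z => F z - F z₀) z₀ = 0 := by rw [← hm]; rfl
    rw [hsub.analyticOrderAt_eq_zero] at this
    simp at this
  obtain ⟨n, rfl⟩ := Nat.exists_eq_succ_of_ne_zero hm0
  obtain ⟨g, hg, hg0, he⟩ := hsub.analyticOrderAt_eq_natCast.mp hm.symm
  -- From `F = F z₀ + (z - z₀)^(n+1) g` one gets `F' = (z - z₀)^n w` with `w z₀ ≠ 0`. Thus `F'` is
  -- comparable to `(z - z₀)^n`, also at a critical point.
  set w : ℂ → ℂ := fun z => (n + 1) * g z + (z - z₀) * deriv g z with hw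
  have hwa : AnalyticAt ℂ w z₀ := by
    have := hg.deriv
    fun_prop
  have hw0 : w z₀ ≠ 0 := by
    simp only [hw, sub_self, zero_mul, add_zero]
    exact mul_ne_zero (by exact_mod_cast Nat.succ_ne_zero n) hg0
  have hder : deriv F =ᶠ[𝓝 z₀] fun z => (z - z₀) ^ n * w z := by
    filter_upwards [he.eventually_nhds, hg.eventually_analyticAt] with z hz hgz
    have h1 : F =ᶠ[𝓝 z] fun z => F z₀ + (z - z₀) ^ (n + 1) * g z := by
      filter_upwards [hz] with y hy
      simp only [smul_eq_mul, Nat.succ_eq_add_one] at hy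
      linear_combination hy
    have h2 : HasDerivAt (fun z => F z₀ + (z - z₀) ^ (n + 1) * g z)
        ((n + 1 : ℕ) * (z - z₀) ^ n * 1 * g z + (z - z₀) ^ (n + 1) * deriv g z) z :=
      ((((hasDerivAt_id z).sub_const z₀).pow (n + 1)).mul
        hgz.differentiableAt.hasDerivAt).const_add _
    rw [h1.deriv_eq, h2.deriv]
    simp only [hw]
    push_cast
    ring
  have O1 : deriv F =O[𝓝 z₀] fun z => (z - z₀) ^ n := by
    refine hder.trans_isBigO ?_
    simpa using (isBigO_refl (fun z : ℂ => (z - z₀) ^ n) (𝓝 z₀)).mul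
      (hwa.continuousAt.tendsto.isBigO_one ℂ)
  have O2 : (fun z => (z - z₀) ^ n) =O[𝓝 z₀] deriv F := by
    have h1 : (fun z => (z - z₀) ^ n) =ᶠ[𝓝 z₀] fun z => deriv F z * (w z)⁻¹ := by
      filter_upwards [hder, hwa.continuousAt.eventually_ne hw0] with z hz hz'
      rw [hz, mul_inv_cancel_right₀ hz']
    refine h1.trans_isBigO ?_
    simpa using (isBigO_refl (deriv F) (𝓝 z₀)).mul
      ((hwa.continuousAt.inv₀ hw0).tendsto.isBigO_one ℂ)
  have O3 : (fun z => F z - F z₀) =O[𝓝 z₀] fun z => (z - z₀) ^ n := by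
    have h1 : (fun z => F z - F z₀) =ᶠ[𝓝 z₀] fun z => (z - z₀) ^ n * ((z - z₀) * g z) := by
      filter_upwards [he] with z hz
      rw [hz, smul_eq_mul, Nat.succ_eq_add_one, pow_succ]
      ring
    have h2 : ContinuousAt (fun z => (z - z₀) * g z) z₀ := by
      have := hg.continuousAt
      fun_prop
    refine h1.trans_isBigO ?_
    simpa using (isBigO_refl (fun z : ℂ => (z - z₀) ^ n) (𝓝 z₀)).mul
      (h2.tendsto.isBigO_one ℂ)
  -- The reflection `k` fixes `z₀` and satisfies `k z - z₀ = O(z - z₀)`, so bounds by `(z - z₀)^n`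
  -- survive composition with it.
  set k : ℂ → ℂ := fun z => conj (j z) with hk
  have hkt : Tendsto k (𝓝 z₀) (𝓝 z₀) := by
    have := (continuous_conj.tendsto (j z₀)).comp hj.continuousAt.tendsto
    rwa [hj0, conj_conj] at this
  have Ok : (fun z => (k z - z₀) ^ n) =O[𝓝 z₀] fun z => (z - z₀) ^ n := by
    refine IsBigO.pow ?_ n
    have h1 := hj.differentiableAt.isBigO_sub
    refine IsBigO.trans (IsBigO.of_bound 1 (Eventually.of_forall fun z => ?_)) h1
    rw [one_mul, hj0, hk, ← norm_conj]
    simp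
  have Od : deriv (fun z => conj (F (conj (j z)))) =O[𝓝 z₀] deriv F := by
    have h1 : deriv (fun z => conj (F (conj (j z)))) =ᶠ[𝓝 z₀]
        fun z => conj (deriv F (k z)) * deriv j z := by
      filter_upwards [hkt.eventually hF.eventually_analyticAt, hj.eventually_analyticAt] with z hz hz'
      have h2 := hz.differentiableAt.hasDerivAt.conj_conj
      simp only [hk, conj_conj] at h2
      exact (h2.comp z hz'.differentiableAt.hasDerivAt).deriv
    refine h1.trans_isBigO ?_
    have h3 : (fun z => conj (deriv F (k z))) =O[𝓝 z₀] fun z => (z - z₀) ^ n := by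
      refine IsBigO.trans ?_ ((O1.comp_tendsto hkt).trans Ok)
      exact IsBigO.of_bound 1 (Eventually.of_forall fun z => by simp)
    have h4 := (h3.trans O2).mul (hj.deriv.continuousAt.tendsto.isBigO_one ℂ)
    simpa using h4
  have Os : (fun z => conj (F z) - conj (F (conj (j z)))) =O[𝓝 z₀] deriv F := by
    have h1 : (fun z => conj (F z - F z₀)) =O[𝓝 z₀] deriv F :=
      IsBigO.trans (IsBigO.of_bound 1 (Eventually.of_forall fun z => by rw [norm_conj, one_mul])) (O3.trans O2)
    have h2 : (fun z => conj (F (k z) - F z₀)) =O[𝓝 z₀] deriv F :=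
      IsBigO.trans (IsBigO.of_bound 1 (Eventually.of_forall fun z => by rw [norm_conj, one_mul]; rfl))
        (((O3.comp_tendsto hkt).trans Ok).trans O2)
    refine (h1.sub h2).congr_left fun z => ?_
    simp [hk]
  obtain ⟨C1, h1⟩ := Od.bound
  obtain ⟨C2, h2⟩ := Os.bound
  refine ⟨max C1 C2, ?_⟩
  filter_upwards [h1, h2] with z a b
  exact ⟨a.trans (by gcongr; exact le_max_left _ _), b.trans (by gcongr; exact le_max_right _ _)⟩

section Boundary

variable {M : Type*} [TopologicalSpace M] [ChartedSpace ℂ M] [IsManifold 𝓘(ℂ) ω M]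
  {J : M → M} {Mplus : Set M} {f : M → ℂ}

/-- Near a boundary point of `M₊` the hypotheses of Green's formula hold in a chart. -/
lemma exists_boundaryData (hJi : Involutive J) (hJ : IsAntiholomorphic J) (hop : IsOpen Mplus)
    (hfix : frontier Mplus ⊆ fixedPoints J) (hf : IsMeromorphic f)
    (hn : ∀ (c : ℂ) (p : M), orderAt (fun q => f q - c) p ≠ ⊤) {p : M} (hp : p ∈ frontier Mplus)
    (h0 : orderAt f p = 0) :
    ∃ (r : ℝ) (F G : ℂ → ℂ) (C : ℝ), 0 < r ∧
      Metric.ball (coord p) r ⊆ (chartAt ℂ p).target ∧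
      (∀ z ∈ Metric.ball (coord p) r \ {coord p}, inChart f p z = F z ∧
        inChart (reflect J f) p z = G z) ∧
      BoundaryData F G (Metric.ball (coord p) r)
        (Metric.ball (coord p) r ∩ (chartAt ℂ p).symm ⁻¹' Mplus) (coord p) C := by
  have hJp : J p = p := hfix hp
  set z₀ := coord p with hz₀
  -- The value of `f` at `p` is arbitrary; `F` is the analytic function agreeing with `f` off `p`.
  obtain ⟨F, hF, he⟩ := (hf p).meromorphicOrderAt_nonneg_iff.mp
    (le_of_eq (show (0 : WithTop ℤ) = meromorphicOrderAt (inChart f p) (coord p) from h0.symm))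
  have hj := analyticAt_conjChart hJ p
  have hj0 : conjChart J p z₀ = conj z₀ := by rw [hz₀, conjChart_coord, hJp]
  set G : ℂ → ℂ := fun z => conj (F (conj (conjChart J p z))) with hG
  have hFn : ∀ c, meromorphicOrderAt (fun z => F z - c) z₀ ≠ ⊤ := fun c => by
    have := hn c p
    rw [orderAt] at this
    rw [← meromorphicOrderAt_congr (f₁ := inChart (fun q => f q - c) p)]
    · exact this
    · filter_upwards [he] with z hz
      simp only [inChart] at hz ⊢
      rw [hz]
  obtain ⟨C, hC⟩ := exists_reflection_bound hF (hFn _) hj hj0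
  have hGa : AnalyticAt ℂ G z₀ := by
    have h1 : AnalyticAt ℂ (fun w => conj (F (conj w))) (conjChart J p z₀) := by
      rw [hj0]
      exact analyticAt_conj_conj hF
    exact h1.comp hj
  have hderiv : ∀ᶠ z in 𝓝[≠] z₀, deriv F z ≠ 0 :=
    (meromorphicOrderAt_ne_top_iff_eventually_ne_zero hF.meromorphicAt.deriv).mp
      (meromorphicOrderAt_deriv_ne_top hF.meromorphicAt hFn)
  have hGe : ∀ᶠ z in 𝓝[≠] z₀, inChart (reflect J f) p z = G z := by
    -- Injectivity of `J` keeps the reflected point off `p`, so `f` and `F` agree there too.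
    have hne : Tendsto (fun z => conj (conjChart J p z)) (𝓝[≠] z₀) (𝓝[≠] z₀) := by
      refine tendsto_nhdsWithin_iff.mpr ⟨?_, ?_⟩
      · have := (continuous_conj.tendsto _).comp hj.continuousAt.tendsto
        rw [hj0, conj_conj] at this
        exact this.mono_left nhdsWithin_le_nhds
      · filter_upwards [self_mem_nhdsWithin,
          (eventually_source hJ.1 p).filter_mono nhdsWithin_le_nhds] with z hz hzs heq
        apply hz
        rw [Set.mem_singleton_iff, conjChart, conj_conj] at heq
        have hz₀' : z₀ = chartAt ℂ (J p) (J p) := by rw [hJp]; rfl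
        rw [hz₀'] at heq
        have h1 := (chartAt ℂ (J p)).injOn hzs.2 (mem_chart_source ℂ (J p)) heq
        have h2 := hJi.injective h1
        rw [Set.mem_singleton_iff, ← (chartAt ℂ p).right_inv hzs.1, h2]
        rfl
    filter_upwards [hne.eventually he,
      (inChart_reflect hJ.1 f p).filter_mono nhdsWithin_le_nhds] with z hz hz'
    rw [hz', hG, hJp]
    simp only
    rw [hz]
  have hFb : ∀ᶠ z in 𝓝 z₀, ‖F z‖ < ‖F z₀‖ + 1 :=
    hF.continuousAt.norm.eventually_lt_const (by linarith)
  -- At `z₀` the value is `1 + |F z₀|² ≥ 1`.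
  have hhalf : ∀ᶠ z in 𝓝 z₀, 1 / 2 < ‖1 + F z * G z‖ := by
    have h1 : ContinuousAt (fun z => ‖1 + F z * G z‖) z₀ :=
      (continuousAt_const.add (hF.continuousAt.mul hGa.continuousAt)).norm
    refine h1.eventually_const_lt ?_
    have h2 : G z₀ = conj (F z₀) := by
      simp only [hG]
      rw [hj0, conj_conj]
    change 1 / 2 < ‖1 + F z₀ * G z₀‖
    rw [h2, one_add_mul_conj, norm_real, Real.norm_eq_abs, abs_of_nonneg (by positivity)]
    nlinarith [sq_nonneg ‖F z₀‖]
  have hall := (((((hC.and hF.eventually_analyticAt).and hGa.eventually_analyticAt).and hFb).and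
    hhalf).and (eventually_source hJ.1 p)).and
    (eventually_nhdsWithin_iff.mp ((he.and hGe).and hderiv))
  obtain ⟨r, hr, hb⟩ := Metric.eventually_nhds_iff_ball.mp hall
  have hcW : ContinuousOn (chartAt ℂ p).symm (Metric.ball z₀ r) :=
    (chartAt ℂ p).continuousOn_symm.mono fun z hz => (hb z hz).1.2.1
  refine ⟨r, F, G, max C (‖F z₀‖ + 1), hr, fun z hz => (hb z hz).1.2.1,
    fun z hz => ((hb z hz.1).2 hz.2).1, ?_⟩
  refine
    { isOpen_W := Metric.isOpen_ball
      isOpen_V := hcW.isOpen_inter_preimage Metric.isOpen_ball hop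
      diffF := fun z hz => (hb z hz).1.1.1.1.1.2.differentiableAt.differentiableWithinAt
      diffG := fun z hz => (hb z hz).1.1.1.1.2.differentiableAt.differentiableWithinAt
      eq_conj := fun z hz => ?_
      deriv_ne := fun z hz => ((hb z hz.1).2 hz.2).2
      deriv_le := fun z hz => ?_
      sub_le := fun z hz => ?_
      bound := fun z hz => (hb z hz).1.1.1.2.le.trans (le_max_right _ _)
      half_le := fun z hz => (hb z hz).1.1.2.le }
  · have hfr : (chartAt ℂ p).symm z ∈ frontier Mplus := by
      rw [frontier, hop.interior_eq]
      refine ⟨?_, fun hmem => ?_⟩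
      · have h1 : ContinuousAt (chartAt ℂ p).symm z :=
          hcW.continuousAt (Metric.isOpen_ball.mem_nhds hz.1)
        exact h1.continuousWithinAt.mem_closure hz.2.1 fun w hw => hw.2
      · have h2 : IsOpen (Metric.ball z₀ r ∩ (chartAt ℂ p).symm ⁻¹' Mplus) :=
          hcW.isOpen_inter_preimage Metric.isOpen_ball hop
        have h3 := hz.2.2
        rw [h2.interior_eq] at h3
        exact h3 ⟨hz.1, hmem⟩
    have hfx : J ((chartAt ℂ p).symm z) = (chartAt ℂ p).symm z := hfix hfr
    simp only [hG, conjChart]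
    rw [hfx, hJp, (chartAt ℂ p).right_inv (hb z hz.1).1.2.1, conj_conj, sub_self]
  · exact (hb z hz).1.1.1.1.1.1.1.trans (by gcongr; exact le_max_left _ _)
  · exact (hb z hz).1.1.1.1.1.1.2.trans (by gcongr; exact le_max_left _ _)

end Boundary

end RiemannSurface

/-! ### The spherical measure read in a chart. -/

namespace RiemannSurface

lemma det_smul_one (c : ℂ) : (c • (1 : ℂ →L[ℝ] ℂ)).det = ‖c‖ ^ 2 := by
  change LinearMap.det ((c • (1 : ℂ →ₗ[ℂ] ℂ)).restrictScalars ℝ) = ‖c‖ ^ 2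
  rw [LinearMap.det_restrictScalars]
  simp [Algebra.norm_complex_eq, Complex.normSq_eq_norm_sq]

section Measure

variable {M : Type*} [TopologicalSpace M] {e e' : OpenPartialHomeomorph M ℂ}

section

variable [MeasurableSpace M]

/-- The pull-back of the spherical area measure on the domain of a chart. -/
noncomputable def chartMeasure (f : M → ℂ) (e : OpenPartialHomeomorph M ℂ) : Measure M :=
  Measure.map e.symm
    ((volume.restrict e.target).withDensity (sphericalDensity fun z => f (e.symm z)))

variable [BorelSpace M]

lemma measurableEmbedding_symm (e : OpenPartialHomeomorph M ℂ) :
    MeasurableEmbedding (fun z : e.target => e.symm z) :=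
  (e.symm.isOpenEmbedding_restrict).measurableEmbedding

lemma measurableSet_target_inter (e : OpenPartialHomeomorph M ℂ) {s : Set M}
    (hs : MeasurableSet s) : MeasurableSet (e.target ∩ e.symm ⁻¹' s) := by
  have h := e.open_target.measurableSet.subtype_image ((measurableEmbedding_symm e).measurable hs)
  convert! h using 1
  ext z
  simp [and_comm]

lemma aemeasurable_symm (f : M → ℂ) (e : OpenPartialHomeomorph M ℂ) : AEMeasurable e.symm
    ((volume.restrict e.target).withDensity (sphericalDensity fun z => f (e.symm z))) :=
  (e.continuousOn_symm.aemeasurable e.open_target.measurableSet).mono_ac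
    (withDensity_absolutelyContinuous _ _)

lemma chartMeasure_apply (f : M → ℂ) {s : Set M} (hs : MeasurableSet s) :
    chartMeasure f e s =
      ∫⁻ z in e.target ∩ e.symm ⁻¹' s, sphericalDensity (fun z => f (e.symm z)) z := by
  rw [chartMeasure, Measure.map_apply_of_aemeasurable (aemeasurable_symm f e) hs,
    withDensity_apply', Measure.restrict_restrict' e.open_target.measurableSet, Set.inter_comm]

lemma chartMeasure_inter_source (f : M → ℂ) {s : Set M} (hs : MeasurableSet s) :
    chartMeasure f e (s ∩ e.source) = chartMeasure f e s := by
  rw [chartMeasure_apply f hs, chartMeasure_apply f (hs.inter e.open_source.measurableSet)]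
  congr 2
  ext z
  simp only [Set.mem_inter_iff, Set.mem_preimage]
  exact ⟨fun h => ⟨h.1, h.2.1⟩, fun h => ⟨h.1, h.2, e.map_target h.1⟩⟩

omit [MeasurableSpace M] [BorelSpace M] in
lemma withDensity_restrict_preimage (f : M → ℂ) (U : Set M) :
    ((volume.restrict e.target).withDensity (sphericalDensity fun z => f (e.symm z))).restrict
        (e.symm ⁻¹' U) = (volume.restrict (e.target ∩ e.symm ⁻¹' U)).withDensity
          (sphericalDensity fun z => f (e.symm z)) := by
  rw [restrict_withDensity', Measure.restrict_restrict' e.open_target.measurableSet, Set.inter_comm]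

/-- Nothing is known about `e.symm` off `e.target`. Passing to the subtype turns it into a
measurable embedding, along which integrals transfer without measurability of the integrand. -/
lemma chartMeasure_eq_map (f : M → ℂ) (e : OpenPartialHomeomorph M ℂ) :
    ∃ ν : Measure e.target, Measure.map Subtype.val ν =
        (volume.restrict e.target).withDensity (sphericalDensity fun z => f (e.symm z)) ∧
      Measure.map (fun z : e.target => e.symm z) ν = chartMeasure f e := by
  set μ := (volume.restrict e.target).withDensity (sphericalDensity fun z => f (e.symm z)) with hμ
  have hv := MeasurableEmbedding.subtype_coe e.open_target.measurableSet
  have h1 : Measure.map Subtype.val (Measure.comap (Subtype.val : e.target → ℂ) μ) = μ := by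
    rw [hv.map_comap, Subtype.range_coe, hμ, restrict_withDensity',
      Measure.restrict_restrict e.open_target.measurableSet, Set.inter_self]
  refine ⟨_, h1, ?_⟩
  rw [chartMeasure, ← hμ, ← h1, AEMeasurable.map_map_of_aemeasurable _ hv.measurable.aemeasurable]
  · rw [h1]
    rfl
  · rw [h1]
    exact aemeasurable_symm f e

variable [ChartedSpace ℂ M] [IsManifold 𝓘(ℂ) ω M]

omit [MeasurableSpace M] [BorelSpace M] in
lemma sphericalDensity_chart_change (he : e ∈ atlas ℂ M) (he' : e' ∈ atlas ℂ M) (f : M → ℂ) {z : ℂ}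
    (hz : z ∈ e.target) (hz' : e.symm z ∈ e'.source) :
    sphericalDensity (fun z => f (e.symm z)) z =
      ENNReal.ofReal (‖deriv (fun z => e' (e.symm z)) z‖ ^ 2) *
        sphericalDensity (fun z => f (e'.symm z)) (e' (e.symm z)) := by
  have h := deriv_chart_change he he' (e.map_target hz) hz' f
  rw [e.right_inv hz] at h
  rw [sphericalDensity, sphericalDensity, ← ENNReal.ofReal_mul (by positivity), h,
    e'.left_inv hz', norm_mul]
  ring_nf

/-- The real Jacobian `|T'|²` of the transition map is exactly the factor by which the density
changes. -/
lemma chartMeasure_eq_of_subset (he : e ∈ atlas ℂ M) (he' : e' ∈ atlas ℂ M) (f : M → ℂ) {s : Set M}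
    (hs : MeasurableSet s) (h : s ⊆ e.source) (h' : s ⊆ e'.source) :
    chartMeasure f e s = chartMeasure f e' s := by
  set T : ℂ → ℂ := fun z => e' (e.symm z) with hT
  have himg : T '' (e.target ∩ e.symm ⁻¹' s) = e'.target ∩ e'.symm ⁻¹' s := by
    ext w
    constructor
    · rintro ⟨z, ⟨hz, hzs⟩, rfl⟩
      refine ⟨e'.map_source (h' hzs), ?_⟩
      rw [Set.mem_preimage, hT, e'.left_inv (h' hzs)]
      exact hzs
    · rintro ⟨hw, hws⟩
      refine ⟨e (e'.symm w), ⟨e.map_source (h hws), ?_⟩, ?_⟩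
      · rw [Set.mem_preimage, e.left_inv (h hws)]
        exact hws
      · simp only [hT]
        rw [e.left_inv (h hws), e'.right_inv hw]
  have hd : ∀ z ∈ e.target ∩ e.symm ⁻¹' s, HasFDerivWithinAt T (deriv T z • (1 : ℂ →L[ℝ] ℂ))
      (e.target ∩ e.symm ⁻¹' s) z := by
    intro z hz
    have ha := analyticAt_transition he he' (h hz.2) (h' hz.2)
    rw [e.right_inv hz.1] at ha
    exact ha.differentiableAt.hasDerivAt.complexToReal_fderiv.hasFDerivWithinAt
  have hinj : Set.InjOn T (e.target ∩ e.symm ⁻¹' s) := by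
    intro z hz w hw hzw
    have h1 := e'.injOn (h' hz.2) (h' hw.2) hzw
    exact e.symm.injOn hz.1 hw.1 h1
  rw [chartMeasure_apply f hs, chartMeasure_apply f hs, ← himg,
    lintegral_image_eq_lintegral_abs_det_fderiv_mul volume (measurableSet_target_inter e hs) hd hinj]
  refine setLIntegral_congr_fun (measurableSet_target_inter e hs) fun z hz => ?_
  rw [det_smul_one, abs_of_nonneg (by positivity)]
  exact sphericalDensity_chart_change he he' f hz.1 (h' hz.2)

lemma sphericalMeasure_restrict_source (he : e ∈ atlas ℂ M) (f : M → ℂ) :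
    (sphericalMeasure f).restrict e.source = chartMeasure f e := by
  have hle : ∀ e' ∈ atlas ℂ M, chartMeasure f e' ≤ sphericalMeasure f := fun e' he' =>
    le_iSup₂ (f := fun e' (_ : e' ∈ atlas ℂ M) => chartMeasure f e') e' he'
  have hs := e.open_source.measurableSet
  -- A supremum of measures is not computed setwise. It is bounded by exhibiting one upper bound of
  -- all chart measures: on `e.source` they are at most `chartMeasure f e`, elsewhere at most the
  -- supremum itself.
  have hub : sphericalMeasure f ≤ chartMeasure f e + (sphericalMeasure f).restrict e.sourceᶜ := by
    refine iSup₂_le fun e' he' => ?_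
    change chartMeasure f e' ≤ _
    refine Measure.le_iff.mpr fun t ht => ?_
    rw [← measure_inter_add_sdiff t hs, Measure.add_apply, Measure.restrict_apply ht]
    refine add_le_add ?_ (hle e' he' _)
    rw [← chartMeasure_inter_source f (ht.inter hs), chartMeasure_eq_of_subset he' he f
      ((ht.inter hs).inter e'.open_source.measurableSet) (fun x hx => hx.2) (fun x hx => hx.1.2)]
    exact measure_mono fun x hx => hx.1.1
  refine le_antisymm ?_ ?_
  · refine Measure.le_iff.mpr fun t ht => ?_
    rw [Measure.restrict_apply ht]
    refine (hub _).trans ?_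
    rw [Measure.add_apply, Measure.restrict_apply (ht.inter hs)]
    have : t ∩ e.source ∩ e.sourceᶜ = ∅ := by
      ext x
      simp
    rw [this, measure_empty, add_zero]
    exact measure_mono Set.inter_subset_left
  · refine Measure.le_iff.mpr fun t ht => ?_
    rw [Measure.restrict_apply ht, ← chartMeasure_inter_source f ht]
    exact hle e he _

lemma sphericalMeasure_restrict_of_subset (he : e ∈ atlas ℂ M) (f : M → ℂ) {U : Set M}
    (hUs : U ⊆ e.source) :
    (sphericalMeasure f).restrict U = (chartMeasure f e).restrict U := by
  rw [← sphericalMeasure_restrict_source he, Measure.restrict_restrict' e.open_source.measurableSet,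
    Set.inter_eq_left.mpr hUs]

omit [MeasurableSpace M] [BorelSpace M] in
lemma aemeasurable_sphericalDensity [CompactSpace M] (he : e ∈ atlas ℂ M) {f : M → ℂ}
    (hf : IsMeromorphic f) :
    AEMeasurable (sphericalDensity fun z => f (e.symm z)) (volume.restrict e.target) := by
  set F : ℂ → ℂ := fun z => f (e.symm z) with hF
  set O := e.target ∩ {z | AnalyticAt ℂ F z} with hO
  have hOo : IsOpen O := e.open_target.inter (isOpen_analyticAt ℂ F)
  have hfin : (e.target \ O).Finite := by
    refine Set.Finite.subset ((finite_of_eventually_punctured hf.eventually_regAt).image e) ?_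
    rintro z ⟨hz, hzO⟩
    refine ⟨e.symm z, fun hr => hzO ⟨hz, (regAt_iff_chart he hz).mp hr⟩, e.right_inv hz⟩
  have hae : O =ᵐ[volume] e.target :=
    (Set.inter_subset_left.eventuallyLE).antisymm
      (ae_le_set.mpr (hfin.measure_zero _))
  rw [← Measure.restrict_congr_set hae]
  have hFm : AEMeasurable F (volume.restrict O) :=
    ContinuousOn.aemeasurable (fun z hz => hz.2.continuousAt.continuousWithinAt) hOo.measurableSet
  have hdm : AEMeasurable (deriv F) (volume.restrict O) := (measurable_deriv F).aemeasurable
  unfold sphericalDensity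
  fun_prop

lemma toReal_sphericalDensity (F : ℂ → ℂ) (z : ℂ) :
    (sphericalDensity F z).toReal = sphDens F z / Real.pi := by
  rw [sphericalDensity, ENNReal.toReal_ofReal (by positivity), sphDens, div_div, mul_comm Real.pi]

variable [CompactSpace M] {E : Type*} [NormedAddCommGroup E] [NormedSpace ℝ E]

lemma integrableOn_sphericalMeasure_iff (he : e ∈ atlas ℂ M) {f : M → ℂ} (hf : IsMeromorphic f)
    {U : Set M} (hUs : U ⊆ e.source) (g : M → E) :
    IntegrableOn g U (sphericalMeasure f) ↔
      IntegrableOn (fun z => (sphDens (fun z => f (e.symm z)) z / Real.pi) • g (e.symm z))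
        (e.target ∩ e.symm ⁻¹' U) := by
  obtain ⟨ν, h1, h2⟩ := chartMeasure_eq_map f e
  have hv := MeasurableEmbedding.subtype_coe e.open_target.measurableSet
  have key : IntegrableOn (fun z => g (e.symm z)) (e.symm ⁻¹' U) (Measure.map Subtype.val ν) ↔
      IntegrableOn g U (chartMeasure f e) := by
    rw [← h2, hv.integrableOn_map_iff, (measurableEmbedding_symm e).integrableOn_map_iff]
    rfl
  have hmeas : AEMeasurable (sphericalDensity fun z => f (e.symm z))
      (volume.restrict (e.target ∩ e.symm ⁻¹' U)) :=
    (aemeasurable_sphericalDensity he hf).mono_measure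
      (Measure.restrict_mono_set _ Set.inter_subset_left)
  rw [IntegrableOn, sphericalMeasure_restrict_of_subset he f hUs]
  change IntegrableOn g U (chartMeasure f e) ↔ _
  rw [← key, h1, IntegrableOn, withDensity_restrict_preimage,
    integrable_withDensity_iff_integrable_smul₀' hmeas
      (Eventually.of_forall fun _ => ENNReal.ofReal_lt_top)]
  simp only [toReal_sphericalDensity, IntegrableOn]

lemma setIntegral_sphericalMeasure (he : e ∈ atlas ℂ M) {f : M → ℂ} (hf : IsMeromorphic f)
    {U : Set M} (hUs : U ⊆ e.source) (g : M → E) :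
    ∫ q in U, g q ∂(sphericalMeasure f) = ∫ z in e.target ∩ e.symm ⁻¹' U,
      (sphDens (fun z => f (e.symm z)) z / Real.pi) • g (e.symm z) := by
  obtain ⟨ν, h1, h2⟩ := chartMeasure_eq_map f e
  have hv := MeasurableEmbedding.subtype_coe e.open_target.measurableSet
  have key : ∫ q in U, g q ∂(chartMeasure f e) =
      ∫ z in e.symm ⁻¹' U, g (e.symm z) ∂(Measure.map Subtype.val ν) := by
    rw [← h2, hv.setIntegral_map, (measurableEmbedding_symm e).setIntegral_map]
    rfl
  have hmeas : AEMeasurable (sphericalDensity fun z => f (e.symm z))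
      (volume.restrict (e.target ∩ e.symm ⁻¹' U)) :=
    (aemeasurable_sphericalDensity he hf).mono_measure
      (Measure.restrict_mono_set _ Set.inter_subset_left)
  rw [sphericalMeasure_restrict_of_subset he f hUs, key, h1, withDensity_restrict_preimage,
    integral_withDensity_eq_integral_toReal_smul₀ hmeas
      (Eventually.of_forall fun _ => ENNReal.ofReal_lt_top)]
  simp only [toReal_sphericalDensity]

end

end Measure

end RiemannSurface

/-! ### Transfer of Green's formula from a chart to the surface. -/

namespace RiemannSurface

section Transfer

variable {M : Type*} [TopologicalSpace M] {e e' : OpenPartialHomeomorph M ℂ}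
  [ChartedSpace ℂ M] [IsManifold 𝓘(ℂ) ω M] {f g h : M → ℂ} {Mplus : Set M} {ρ : M → ℝ}

/-- A function on the surface in a chart, extended by zero. -/
noncomputable def chartExt (e : OpenPartialHomeomorph M ℂ) (ρ : M → ℝ) : ℂ → ℂ :=
  e.target.indicator fun z => (ρ (e.symm z) : ℂ)

omit [ChartedSpace ℂ M] [IsManifold 𝓘(ℂ) ω M] in
lemma chartExt_eventuallyEq {z : ℂ} (hz : z ∈ e.target) :
    chartExt e ρ =ᶠ[𝓝 z] fun z => (ρ (e.symm z) : ℂ) := by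
  filter_upwards [e.open_target.mem_nhds hz] with w hw
  exact Set.indicator_of_mem hw _

lemma contDiffAt_comp_symm (hρ : ContMDiff 𝓘(ℝ, ℂ) 𝓘(ℝ) ∞ ρ) (he : e ∈ atlas ℂ M) {z : ℂ}
    (hz : z ∈ e.target) : ContDiffAt ℝ 1 (fun z => (ρ (e.symm z) : ℂ)) z := by
  have := isManifold_real (M := M)
  have h1 := (contMDiffOn_symm_of_mem_maximalAtlas (I := 𝓘(ℝ, ℂ)) (n := ∞)
    (IsManifold.subset_maximalAtlas he)).contMDiffAt (e.open_target.mem_nhds hz)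
  have h2 := (hρ (e.symm z)).comp z h1
  have h3 : ContDiffAt ℝ ∞ (ρ ∘ e.symm) z := contMDiffAt_iff_contDiffAt.mp h2
  have h4 : ContDiffAt ℝ 1 (ρ ∘ e.symm) z := h3.of_le (by exact_mod_cast le_top)
  exact (ofRealCLM.contDiff.contDiffAt (x := ρ (e.symm z))).comp z h4

omit [ChartedSpace ℂ M] [IsManifold 𝓘(ℂ) ω M] in
lemma chartExt_of_notMem {z : ℂ} (hz : z ∉ e '' tsupport ρ) : chartExt e ρ z = 0 := by
  by_contra h
  have hzt : z ∈ e.target := by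
    by_contra hz'
    exact h (Set.indicator_of_notMem hz' _)
  rw [chartExt, Set.indicator_of_mem hzt] at h
  have h' : ρ (e.symm z) ≠ 0 := by simpa using h
  exact hz ⟨e.symm z, subset_tsupport _ h', e.right_inv hzt⟩

omit [ChartedSpace ℂ M] [IsManifold 𝓘(ℂ) ω M] in
lemma isCompact_image_tsupport [CompactSpace M] (hs : tsupport ρ ⊆ e.source) :
    IsCompact (e '' tsupport ρ) :=
  (isClosed_tsupport ρ).isCompact.image_of_continuousOn (e.continuousOn.mono hs)

omit [ChartedSpace ℂ M] [IsManifold 𝓘(ℂ) ω M] in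
lemma tsupport_chartExt_subset [CompactSpace M] (hs : tsupport ρ ⊆ e.source) :
    tsupport (chartExt e ρ) ⊆ e '' tsupport ρ :=
  closure_minimal (fun z hz => by
    by_contra h
    exact hz (chartExt_of_notMem h)) (isCompact_image_tsupport hs).isClosed

omit [ChartedSpace ℂ M] [IsManifold 𝓘(ℂ) ω M] in
lemma tsupport_chartExt_subset_preimage [CompactSpace M] {U : Set M} (hs : tsupport ρ ⊆ U)
    (hU : U ⊆ e.source) : tsupport (chartExt e ρ) ⊆ e.target ∩ e.symm ⁻¹' U := by
  refine (tsupport_chartExt_subset (hs.trans hU)).trans ?_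
  rintro _ ⟨q, hq, rfl⟩
  refine ⟨e.map_source (hU (hs hq)), ?_⟩
  rw [Set.mem_preimage, e.left_inv (hU (hs hq))]
  exact hs hq

omit [ChartedSpace ℂ M] [IsManifold 𝓘(ℂ) ω M] in
lemma hasCompactSupport_chartExt [CompactSpace M] (hs : tsupport ρ ⊆ e.source) :
    HasCompactSupport (chartExt e ρ) :=
  (isCompact_image_tsupport hs).of_isClosed_subset (isClosed_tsupport _)
    (tsupport_chartExt_subset hs)

lemma contDiff_chartExt [CompactSpace M] (hρ : ContMDiff 𝓘(ℝ, ℂ) 𝓘(ℝ) ∞ ρ) (he : e ∈ atlas ℂ M)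
    (hs : tsupport ρ ⊆ e.source) : ContDiff ℝ 1 (chartExt e ρ) := by
  rw [contDiff_iff_contDiffAt]
  intro z
  by_cases hz : z ∈ e.target
  · exact (contDiffAt_comp_symm hρ he hz).congr_of_eventuallyEq (chartExt_eventuallyEq hz)
  · have : z ∉ tsupport (chartExt e ρ) := fun h =>
      hz ((tsupport_chartExt_subset_preimage subset_rfl hs h).1)
    exact contDiffAt_const.congr_of_eventuallyEq (notMem_tsupport_iff_eventuallyEq.mp this)

/-- The quotient of `∂̄ρ ∧ h (f̄ / (1 + |f|²) - g / (1 + f g)) df` by the spherical area form. -/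
noncomputable def boundaryTerm (f g h : M → ℂ) (ρ : M → ℝ) (q : M) : ℂ :=
  dbar (fun z => (ρ ((chartAt ℂ q).symm z) : ℂ)) (coord q) / conj (deriv (inChart f q) (coord q)) *
    (h q * (conj (f q) - g q) * (1 + f q * conj (f q)) / (1 + f q * g q))

/-- Under a change of chart `∂ρ/∂z̄` and `conj f'` are multiplied by the same conjugate derivative,
so their quotient is a function on the surface. -/
lemma boundaryTerm_symm (hρ : ContMDiff 𝓘(ℝ, ℂ) 𝓘(ℝ) ∞ ρ) (he : e ∈ atlas ℂ M) {z : ℂ}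
    (hz : z ∈ e.target) :
    boundaryTerm f g h ρ (e.symm z) =
      dbar (chartExt e ρ) z / conj (deriv (fun w => f (e.symm w)) z) *
        (h (e.symm z) * (conj (f (e.symm z)) - g (e.symm z)) *
          (1 + f (e.symm z) * conj (f (e.symm z))) / (1 + f (e.symm z) * g (e.symm z))) := by
  set q := e.symm z with hq
  set e' := chartAt ℂ q with he'_def
  have he' : e' ∈ atlas ℂ M := chart_mem_atlas ℂ q
  have hs : q ∈ e.source := e.map_target hz
  have hs' : q ∈ e'.source := mem_chart_source ℂ q
  have hez : e q = z := e.right_inv hz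
  have hT := analyticAt_transition he he' hs hs'
  have hT0 := deriv_transition_ne_zero he he' hs hs'
  have hd := deriv_chart_change he he' hs hs' f
  rw [hez] at hT hT0 hd
  have hρ' := (contDiffAt_comp_symm hρ he' (e'.map_source hs')).differentiableAt one_ne_zero
  have h1 : dbar (chartExt e ρ) z = dbar (fun w => (ρ (e'.symm w) : ℂ)) (e' q) *
      conj (deriv (fun z => e' (e.symm z)) z) := by
    rw [hq] at hρ'
    rw [← dbar_comp hρ' hT.differentiableAt]
    refine dbar_congr ((chartExt_eventuallyEq hz).trans ?_)
    have := comp_symm_eventuallyEq (fun q => (ρ q : ℂ)) hs hs'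
    rw [hez] at this
    exact this
  rw [h1, hd, boundaryTerm, map_mul]
  have hc : conj (deriv (fun z => e' (e.symm z)) z) ≠ 0 := by simpa using hT0
  rw [mul_div_mul_right _ _ hc]
  rfl

/-- The factor `|f'|² = f' conj f'` of the density cancels the denominator `conj f'`; this is why
critical points are excluded from the good points. -/
lemma sphDens_smul_boundaryTerm (hρ : ContMDiff 𝓘(ℝ, ℂ) 𝓘(ℝ) ∞ ρ) (he : e ∈ atlas ℂ M) {z : ℂ}
    (hz : z ∈ e.target) (hg : Good f g (e.symm z)) :
    (sphDens (fun w => f (e.symm w)) z / Real.pi) • boundaryTerm f g h ρ (e.symm z) =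
      (Real.pi : ℂ)⁻¹ * (dbar (chartExt e ρ) z * (h (e.symm z) *
        (sphPrim (fun w => f (e.symm w)) z -
          merPrim (fun w => f (e.symm w)) (fun w => g (e.symm w)) z))) := by
  rw [boundaryTerm_symm hρ he hz]
  have hd := (hg.chart he hz).2.2
  have hne := hg.ne'
  rw [sphDens, sphPrim, merPrim, real_smul]
  push_cast
  have h1 := one_add_mul_conj (f (e.symm z))
  have h2 := one_add_mul_conj_ne_zero (f (e.symm z))
  push_cast at h1
  rw [← h1, ← Complex.mul_conj']
  have hc : conj (deriv (fun w => f (e.symm w)) z) ≠ 0 := by simpa using hd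
  have hpi : (Real.pi : ℂ) ≠ 0 := by exact_mod_cast Real.pi_ne_zero
  generalize conj (deriv (fun w => f (e.symm w)) z) = d' at *
  generalize deriv (fun w => f (e.symm w)) z = d at *
  generalize conj (f (e.symm z)) = b at *
  generalize f (e.symm z) = a at *
  generalize g (e.symm z) = c at *
  field_simp
  ring

omit [IsManifold 𝓘(ℂ) ω M] in
lemma boundaryTerm_of_notMem {q : M} (hq : q ∉ tsupport ρ) : boundaryTerm f g h ρ q = 0 := by
  have h0 : ρ =ᶠ[𝓝 q] 0 := notMem_tsupport_iff_eventuallyEq.mp hq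
  have h1 : Tendsto (chartAt ℂ q).symm (𝓝 (coord q)) (𝓝 q) := tendsto_chart_symm (mem_chart_source ℂ q)
  have h2 : (fun z => (ρ ((chartAt ℂ q).symm z) : ℂ)) =ᶠ[𝓝 (coord q)] fun _ => 0 := by
    filter_upwards [h1.eventually h0] with z hz
    rw [hz]
    simp
  rw [boundaryTerm, dbar_congr h2, dbar_const]
  simp

/-- The term depends on `ρ` linearly through `∂ρ/∂z̄`, and `∂1/∂z̄ = 0`. This glues the local
formulas. -/
lemma sum_boundaryTerm {ι : Type*} {t : Finset ι} {ρ : ι → M → ℝ}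
    (hρ : ∀ i, ContMDiff 𝓘(ℝ, ℂ) 𝓘(ℝ) ∞ (ρ i)) (h1 : ∀ q, ∑ i ∈ t, ρ i q = 1) (q : M) :
    ∑ i ∈ t, boundaryTerm f g h (ρ i) q = 0 := by
  simp only [boundaryTerm, ← Finset.sum_mul, ← Finset.sum_div]
  rw [← dbar_sum t fun i _ => (contDiffAt_comp_symm (hρ i) (chart_mem_atlas ℂ q)
    (coord_mem_target q)).differentiableAt one_ne_zero]
  have h2 : (fun w => ∑ i ∈ t, (ρ i ((chartAt ℂ q).symm w) : ℂ)) = fun _ => 1 := by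
    ext w
    exact_mod_cast h1 _
  rw [h2, dbar_const]
  simp

lemma differentiableOn_comp_symm (hop : IsOpen Mplus) (hh : MDifferentiableOn 𝓘(ℂ) 𝓘(ℂ) h Mplus)
    (he : e ∈ atlas ℂ M) :
    DifferentiableOn ℂ (fun z => h (e.symm z)) (e.target ∩ e.symm ⁻¹' Mplus) := by
  have : IsManifold 𝓘(ℂ) 1 M := IsManifold.of_le (n := ω) le_top
  intro z hz
  have h1 := mdifferentiableAt_atlas_symm (I := 𝓘(ℂ)) he hz.1
  have h2 := hh.mdifferentiableAt (hop.mem_nhds hz.2)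
  have h3 := h2.comp z h1
  exact (mdifferentiableAt_iff_differentiableAt.mp h3).differentiableWithinAt

variable [CompactSpace M] [MeasurableSpace M] [BorelSpace M]

/-- A formula for functions supported in the domain of a chart, read in the chart. -/
lemma integral_mul_of_chart (hf : IsMeromorphic f) (hfin : {q | ¬ Good f g q}.Finite)
    (hop : IsOpen Mplus) (hρ : ContMDiff 𝓘(ℝ, ℂ) 𝓘(ℝ) ∞ ρ) (he : e ∈ atlas ℂ M)
    (hs : tsupport ρ ⊆ e.source) {R : ℂ}
    (hi : IntegrableOn (fun z => dbar (chartExt e ρ) z * (h (e.symm z) *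
      (sphPrim (fun w => f (e.symm w)) z -
        merPrim (fun w => f (e.symm w)) (fun w => g (e.symm w)) z)))
      (e.target ∩ e.symm ⁻¹' Mplus))
    (hI : ∫ z in e.target ∩ e.symm ⁻¹' Mplus,
        chartExt e ρ z * (h (e.symm z) * sphDens (fun w => f (e.symm w)) z) =
      -(∫ z in e.target ∩ e.symm ⁻¹' Mplus, dbar (chartExt e ρ) z * (h (e.symm z) *
        (sphPrim (fun w => f (e.symm w)) z -
          merPrim (fun w => f (e.symm w)) (fun w => g (e.symm w)) z))) + Real.pi * R) :
    IntegrableOn (boundaryTerm f g h ρ) Mplus (sphericalMeasure f) ∧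
      ∫ q in Mplus, ρ q * h q ∂(sphericalMeasure f) =
        -(∫ q in Mplus, boundaryTerm f g h ρ q ∂(sphericalMeasure f)) + R := by
  have hpi : (Real.pi : ℂ) ≠ 0 := by exact_mod_cast Real.pi_ne_zero
  have hWm : MeasurableSet (e.target ∩ e.symm ⁻¹' Mplus) :=
    measurableSet_target_inter e hop.measurableSet
  have hpre : e.target ∩ e.symm ⁻¹' (e.source ∩ Mplus) = e.target ∩ e.symm ⁻¹' Mplus := by
    ext z
    simp only [Set.mem_inter_iff, Set.mem_preimage]
    exact ⟨fun h => ⟨h.1, h.2.2⟩, fun h => ⟨h.1, e.map_target h.1, h.2⟩⟩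
  have hae : ∀ᵐ z ∂volume.restrict (e.target ∩ e.symm ⁻¹' Mplus),
      (sphDens (fun w => f (e.symm w)) z / Real.pi) • boundaryTerm f g h ρ (e.symm z) =
        (Real.pi : ℂ)⁻¹ * (dbar (chartExt e ρ) z * (h (e.symm z) *
          (sphPrim (fun w => f (e.symm w)) z -
            merPrim (fun w => f (e.symm w)) (fun w => g (e.symm w)) z))) := by
    have hc : ∀ᵐ z ∂volume.restrict (e.target ∩ e.symm ⁻¹' Mplus), z ∉ e '' {q | ¬ Good f g q} :=
      ae_restrict_of_ae (measure_eq_zero_iff_ae_notMem.mp ((hfin.image e).measure_zero volume))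
    filter_upwards [hc, ae_restrict_mem hWm] with z hz hzW
    refine sphDens_smul_boundaryTerm hρ he hzW.1 ?_
    by_contra hb
    exact hz ⟨e.symm z, hb, e.right_inv hzW.1⟩
  have hsupp : support (boundaryTerm f g h ρ) ⊆ e.source := fun q hq => by
    by_contra h'
    exact hq (boundaryTerm_of_notMem fun h'' => h' (hs h''))
  have hrr : ((sphericalMeasure f).restrict Mplus).restrict e.source =
      (sphericalMeasure f).restrict (e.source ∩ Mplus) :=
    Measure.restrict_restrict e.open_source.measurableSet
  have hin : IntegrableOn (boundaryTerm f g h ρ) Mplus (sphericalMeasure f) := by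
    rw [IntegrableOn, ← integrableOn_iff_integrable_of_support_subset hsupp, IntegrableOn, hrr]
    change IntegrableOn _ _ _
    rw [integrableOn_sphericalMeasure_iff he hf Set.inter_subset_left, hpre, integrableOn_congr_fun_ae hae]
    exact hi.const_mul _
  refine ⟨hin, ?_⟩
  have e1 : ∫ q in Mplus, boundaryTerm f g h ρ q ∂(sphericalMeasure f) =
      (Real.pi : ℂ)⁻¹ * ∫ z in e.target ∩ e.symm ⁻¹' Mplus, dbar (chartExt e ρ) z *
        (h (e.symm z) * (sphPrim (fun w => f (e.symm w)) z -
          merPrim (fun w => f (e.symm w)) (fun w => g (e.symm w)) z)) := by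
    rw [← setIntegral_eq_integral_of_forall_compl_eq_zero (s := e.source)
      fun q hq => boundaryTerm_of_notMem fun h' => hq (hs h'), hrr,
      setIntegral_sphericalMeasure he hf Set.inter_subset_left, hpre, integral_congr_ae hae,
      integral_const_mul]
  have e2 : ∫ q in Mplus, ρ q * h q ∂(sphericalMeasure f) =
      (Real.pi : ℂ)⁻¹ * ∫ z in e.target ∩ e.symm ⁻¹' Mplus,
        chartExt e ρ z * (h (e.symm z) * sphDens (fun w => f (e.symm w)) z) := by
    rw [← setIntegral_eq_integral_of_forall_compl_eq_zero (s := e.source) fun q hq => by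
      rw [image_eq_zero_of_notMem_tsupport fun h' => hq (hs h')]
      simp, hrr, setIntegral_sphericalMeasure he hf Set.inter_subset_left, hpre, ← integral_const_mul]
    refine setIntegral_congr_fun hWm fun z hz => ?_
    simp only [chartExt, Set.indicator_of_mem hz.1, real_smul]
    push_cast
    ring
  rw [e1, e2, hI]
  field_simp

end Transfer

end RiemannSurface

/-! ### Local Green formulas on the surface. -/

namespace RiemannSurface

lemma IsMeromorphic.meromorphicAt_coord {M : Type*} [TopologicalSpace M] [ChartedSpace ℂ M]
    {f : M → ℂ} (hf : IsMeromorphic f) (p : M) :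
    MeromorphicAt (fun z => f ((chartAt ℂ p).symm z)) (coord p) := hf p

section Local

variable {M : Type*} [TopologicalSpace M] [ChartedSpace ℂ M] [IsManifold 𝓘(ℂ) ω M]
  [CompactSpace M] [MeasurableSpace M] [BorelSpace M]
  {J : M → M} {f g h : M → ℂ} {Mplus : Set M} {ρ : M → ℝ} {p : M}

/-- The contribution of a singular point. -/
noncomputable def residueTerm (f g h : M → ℂ) (p : M) : ℂ :=
  formResidue (fun q => h q * g q / (1 + f q * g q)) f p + (poleMult f p : ℂ) * h p

/-- Green's formula for `ρ h` times the spherical area form, with a correction `R`. -/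
def GreenFormula (f g h : M → ℂ) (Mplus : Set M) (ρ : M → ℝ) (R : ℂ) : Prop :=
  IntegrableOn (boundaryTerm f g h ρ) Mplus (sphericalMeasure f) ∧
    ∫ q in Mplus, ρ q * h q ∂(sphericalMeasure f) =
      -(∫ q in Mplus, boundaryTerm f g h ρ q ∂(sphericalMeasure f)) + R

lemma greenFormula_of_integral [T2Space M] {U : Set M} {R : ℂ} (hf : IsMeromorphic f)
    (hfin : {q | ¬ Good f g q}.Finite) (hop : IsOpen Mplus)
    (hρ : ContMDiff 𝓘(ℝ, ℂ) 𝓘(ℝ) ∞ ρ) (hs : tsupport ρ ⊆ U) (hU : U ⊆ (chartAt ℂ p).source)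
    (hUM : U ⊆ Mplus)
    (hI : Integrable (fun z => dbar (chartExt (chartAt ℂ p) ρ) z * (h ((chartAt ℂ p).symm z) *
        (sphPrim (fun w => f ((chartAt ℂ p).symm w)) z -
        merPrim (fun w => f ((chartAt ℂ p).symm w)) (fun w => g ((chartAt ℂ p).symm w)) z))) ∧
      ∫ z, chartExt (chartAt ℂ p) ρ z *
          (h ((chartAt ℂ p).symm z) * sphDens (fun w => f ((chartAt ℂ p).symm w)) z) =
        -(∫ z, dbar (chartExt (chartAt ℂ p) ρ) z * (h ((chartAt ℂ p).symm z) *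
          (sphPrim (fun w => f ((chartAt ℂ p).symm w)) z -
          merPrim (fun w => f ((chartAt ℂ p).symm w))
            (fun w => g ((chartAt ℂ p).symm w)) z))) + Real.pi * R) :
    GreenFormula f g h Mplus ρ R := by
  have hsub := tsupport_chartExt_subset_preimage hs hU
  have hout : ∀ z ∉ (chartAt ℂ p).target ∩ (chartAt ℂ p).symm ⁻¹' Mplus,
      z ∉ tsupport (chartExt (chartAt ℂ p) ρ) := fun z hz h' =>
    hz ⟨(hsub h').1, hUM (hsub h').2⟩
  refine integral_mul_of_chart hf hfin hop hρ (chart_mem_atlas ℂ p) (hs.trans hU)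
    hI.1.integrableOn ?_
  rw [setIntegral_eq_integral_of_forall_compl_eq_zero fun z hz => by
      rw [image_eq_zero_of_notMem_tsupport (hout z hz), zero_mul],
    setIntegral_eq_integral_of_forall_compl_eq_zero fun z hz => by
      rw [dbar_eq_zero_of_notMem_tsupport (hout z hz), zero_mul]]
  exact hI.2

/-- At a singular `p` the test function must be `1` nearby, so that the residue has weight one and
`∂ρ/∂z̄` avoids the singularity; at a good `p` it is unrestricted. -/
lemma greenFormula_interior [T2Space M] (hf : IsMeromorphic f)
    (hg : IsMeromorphic g) (hfin : {q | ¬ Good f g q}.Finite) (hop : IsOpen Mplus)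
    (hh : MDifferentiableOn 𝓘(ℂ) 𝓘(ℂ) h Mplus) {U : Set M} (hUo : IsOpen U) (hp : p ∈ U)
    (hU : U ⊆ (chartAt ℂ p).source) (hUM : U ⊆ Mplus)
    (hUg : ∀ q ∈ U, q ≠ p → Good f g q)
    (hρ : ContMDiff 𝓘(ℝ, ℂ) 𝓘(ℝ) ∞ ρ) (hs : tsupport ρ ⊆ U) :
    (Good f g p → GreenFormula f g h Mplus ρ 0) ∧
      (ρ =ᶠ[𝓝 p] 1 → GreenFormula f g h Mplus ρ (residueTerm f g h p)) := by
  set e := chartAt ℂ p with he_def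
  have he : e ∈ atlas ℂ M := chart_mem_atlas ℂ p
  have hps : p ∈ e.source := mem_chart_source ℂ p
  have hWo : IsOpen (e.target ∩ e.symm ⁻¹' U) := e.isOpen_inter_preimage_symm hUo
  have hrs := tsupport_chartExt_subset_preimage hs hU
  have hr := contDiff_chartExt hρ he (hs.trans hU)
  have hc := hasCompactSupport_chartExt (hs.trans hU)
  have hhd := (differentiableOn_comp_symm hop hh he).mono
    (Set.inter_subset_inter_right e.target (Set.preimage_mono hUM))
  constructor
  · intro hpg
    have hgood : ∀ z ∈ e.target ∩ e.symm ⁻¹' U, Good f g (e.symm z) := fun z hz => by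
      by_cases h' : e.symm z = p
      · rwa [h']
      · exact hUg _ hz.2 h'
    refine greenFormula_of_integral hf hfin hop hρ hs hU hUM ?_
    have := integral_mul_sphDens hWo hr hc hrs hhd
      (fun z hz => ((hgood z hz).chart he hz.1).1.differentiableAt.differentiableWithinAt)
      (fun z hz => ((hgood z hz).chart he hz.1).2.1.differentiableAt.differentiableWithinAt)
      (fun z hz => (hgood z hz).ne')
    rw [mul_zero, add_zero]
    exact this
  · intro h1
    have hgood : ∀ z ∈ (e.target ∩ e.symm ⁻¹' U) \ {coord p}, Good f g (e.symm z) :=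
      fun z hz => hUg _ hz.1.2 fun h' => hz.2 (by
        rw [Set.mem_singleton_iff, coord, ← he_def, ← h', e.right_inv hz.1.1])
    have hz₀ : coord p ∈ e.target ∩ e.symm ⁻¹' U := by
      refine ⟨coord_mem_target p, ?_⟩
      rw [Set.mem_preimage, coord, ← he_def, e.left_inv hps]
      exact hp
    have hr1 : chartExt e ρ =ᶠ[𝓝 (coord p)] fun _ => 1 := by
      refine (chartExt_eventuallyEq hz₀.1).trans ?_
      have ht : Tendsto e.symm (𝓝 (coord p)) (𝓝 p) := tendsto_chart_symm hps
      filter_upwards [ht.eventually h1] with z hz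
      rw [hz]
      simp
    refine greenFormula_of_integral hf hfin hop hρ hs hU hUM ?_
    have := integral_mul_sphDens_of_punctured hWo hz₀ hr hc hrs hr1 hhd
      (fun z hz => ((hgood z hz).chart he hz.1.1).1.differentiableAt.differentiableWithinAt)
      (fun z hz => ((hgood z hz).chart he hz.1.1).2.1.differentiableAt.differentiableWithinAt)
      (fun z hz => (hgood z hz).ne) (fun z hz => (hgood z hz).ne')
      (hf.meromorphicAt_coord p) (hg.meromorphicAt_coord p)
    convert! this using 5
    rw [residueTerm]
    congr 1
    · rw [formResidue]
      congr 1
      ext z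
      simp only [formCoeff, inChart, merPrim]
      rw [← mul_assoc, ← mul_div_assoc]
      rfl
    · rw [coord, ← he_def, e.left_inv hps]
      rfl

lemma greenFormula_boundary (hJi : Involutive J) (hJ : IsAntiholomorphic J) (hop : IsOpen Mplus)
    (hfix : frontier Mplus ⊆ fixedPoints J) (hf : IsMeromorphic f)
    (hn : ∀ (c : ℂ) (p : M), orderAt (fun q => f q - c) p ≠ ⊤)
    (hfin : {q | ¬ Good f (reflect J f) q}.Finite)
    (hh : MDifferentiableOn 𝓘(ℂ) 𝓘(ℂ) h Mplus) (hi : IntegrableOn h Mplus (sphericalMeasure f))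
    (hp : p ∈ frontier Mplus) (h0 : orderAt f p = 0) :
    ∃ U : Set M, IsOpen U ∧ p ∈ U ∧ ∀ ρ : M → ℝ, ContMDiff 𝓘(ℝ, ℂ) 𝓘(ℝ) ∞ ρ → tsupport ρ ⊆ U →
      GreenFormula f (reflect J f) h Mplus ρ 0 := by
  obtain ⟨r, F, G, C, hr0, hball, heq, D⟩ := exists_boundaryData hJi hJ hop hfix hf hn hp h0
  set e := chartAt ℂ p with he_def
  have he : e ∈ atlas ℂ M := chart_mem_atlas ℂ p
  have hps : p ∈ e.source := mem_chart_source ℂ p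
  set z₀ := coord p with hz₀
  set B := Metric.ball z₀ r with hB
  set V := B ∩ e.symm ⁻¹' Mplus with hV
  set W := e.target ∩ e.symm ⁻¹' Mplus with hW
  have hWm : MeasurableSet W := measurableSet_target_inter e hop.measurableSet
  have hVW : V ⊆ W := fun z hz => ⟨hball hz.1, hz.2⟩
  have hpM : p ∉ Mplus := fun h' => (hop.frontier_eq ▸ hp).2 h'
  -- As `p` lies outside the open set `M₊`, `V` misses the one point where `f` and `F` may differ.
  have hVz : ∀ z ∈ V, z ∈ B \ {z₀} := fun z hz => ⟨hz.1, fun h' => hpM (by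
    have h2 := hz.2
    rw [Set.mem_singleton_iff.mp h', Set.mem_preimage, hz₀, coord, ← he_def, e.left_inv hps] at h2
    exact h2)⟩
  have hBo : IsOpen (B \ {z₀}) := Metric.isOpen_ball.sdiff isClosed_singleton
  have hFe : ∀ z ∈ V, (fun w => f (e.symm w)) =ᶠ[𝓝 z] F := fun z hz => by
    filter_upwards [hBo.mem_nhds (hVz z hz)] with w hw
    exact (heq w hw).1
  have hGe : ∀ z ∈ V, reflect J f (e.symm z) = G z := fun z hz => (heq z (hVz z hz)).2
  have hdens : ∀ z ∈ V, sphDens (fun w => f (e.symm w)) z = sphDens F z := fun z hz => by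
    rw [sphDens, sphDens, (hFe z hz).deriv_eq, (hFe z hz).eq_of_nhds]
  have hprim : ∀ z ∈ V, sphPrim (fun w => f (e.symm w)) z -
      merPrim (fun w => f (e.symm w)) (fun w => reflect J f (e.symm w)) z =
        sphPrim F z - merPrim F G z := fun z hz => by
    rw [sphPrim, sphPrim, merPrim, merPrim, (hFe z hz).deriv_eq, (hFe z hz).eq_of_nhds, hGe z hz]
  have hhd := (differentiableOn_comp_symm hop hh he).mono hVW
  have hVm := D.isOpen_V.measurableSet
  have hint : IntegrableOn (fun z => h (e.symm z) * sphDens F z) V := by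
    have h1 := hi.mono_set (Set.inter_subset_right : e.source ∩ Mplus ⊆ Mplus)
    rw [integrableOn_sphericalMeasure_iff he hf Set.inter_subset_left] at h1
    have hVs : V ⊆ e.target ∩ e.symm ⁻¹' (e.source ∩ Mplus) := fun z hz =>
      ⟨hball hz.1, e.map_target (hball hz.1), hz.2⟩
    have h2 := (h1.mono_set hVs).const_mul (Real.pi : ℂ)
    refine IntegrableOn.congr_fun h2 (fun z hz => ?_) hVm
    have hpi : (Real.pi : ℂ) ≠ 0 := by exact_mod_cast Real.pi_ne_zero
    simp only [hdens z hz, real_smul]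
    push_cast
    field_simp
  refine ⟨e.source ∩ e ⁻¹' B, e.isOpen_inter_preimage Metric.isOpen_ball,
    ⟨hps, Metric.mem_ball_self hr0⟩, fun ρ hρ hs => ?_⟩
  have hs' : tsupport ρ ⊆ e.source := hs.trans Set.inter_subset_left
  have hrs : tsupport (chartExt e ρ) ⊆ B := fun z hz => by
    obtain ⟨q, hq, rfl⟩ := tsupport_chartExt_subset hs' hz
    exact (hs hq).2
  have hout : ∀ z ∈ W \ V, z ∉ tsupport (chartExt e ρ) := fun z hz h' =>
    hz.2 ⟨hrs h', hz.1.2⟩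
  obtain ⟨i1, i2⟩ := D.integral_mul_sphDens (contDiff_chartExt hρ he hs')
    (hasCompactSupport_chartExt hs') hrs Set.inter_subset_left hhd hint
  refine integral_mul_of_chart hf hfin hop hρ he hs' ?_ ?_
  · refine IntegrableOn.of_forall_sdiff_eq_zero (s := V) ?_ hWm fun z hz => by
      rw [dbar_eq_zero_of_notMem_tsupport (hout z hz), zero_mul]
    refine IntegrableOn.congr_fun i1 (fun z hz => ?_) hVm
    rw [hprim z hz]
  · rw [setIntegral_eq_of_subset_of_forall_sdiff_eq_zero hWm hVW fun z hz => by
        rw [image_eq_zero_of_notMem_tsupport (hout z hz), zero_mul],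
      setIntegral_eq_of_subset_of_forall_sdiff_eq_zero hWm hVW fun z hz => by
        rw [dbar_eq_zero_of_notMem_tsupport (hout z hz), zero_mul], mul_zero, add_zero]
    calc _ = ∫ z in V, chartExt e ρ z * (h (e.symm z) * sphDens F z) :=
          setIntegral_congr_fun hVm fun z hz => by simp only [hdens z hz]
      _ = _ := i2
      _ = _ := by
          rw [setIntegral_congr_fun hVm fun z hz => ?_]
          rw [hprim z hz]

omit [IsManifold 𝓘(ℂ) ω M] [CompactSpace M] in
lemma greenFormula_of_disjoint (hop : IsOpen Mplus) (hs : Disjoint (tsupport ρ) Mplus) :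
    GreenFormula f g h Mplus ρ 0 := by
  have h1 : ∀ q ∈ Mplus, boundaryTerm f g h ρ q = 0 := fun q hq =>
    boundaryTerm_of_notMem fun h' => Set.disjoint_left.mp hs h' hq
  refine ⟨?_, ?_⟩
  · exact (integrableOn_congr_fun h1 hop.measurableSet).mpr integrableOn_zero
  · rw [setIntegral_congr_fun hop.measurableSet h1, setIntegral_congr_fun (g := fun _ => 0)
      hop.measurableSet fun q hq => by
        simp [image_eq_zero_of_notMem_tsupport fun h' => Set.disjoint_left.mp hs h' hq]]
    simp

end Local

end RiemannSurface

/-! ### Gluing by a partition of unity. -/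

namespace RiemannSurface

section Sum

variable {M : Type*} [TopologicalSpace M] [ChartedSpace ℂ M] [IsManifold 𝓘(ℂ) ω M]
  [T2Space M] [CompactSpace M] [MeasurableSpace M] [BorelSpace M]
  {J : M → M} {f h : M → ℂ} {Mplus : Set M}

open Classical in
-- Allowing `U` no singular point of `M₊` other than `p` forces a partition of unity subordinate to
-- these sets to satisfy the normalisation required at singular points.
lemma exists_greenFormula (hJi : Involutive J) (hJ : IsAntiholomorphic J) (hop : IsOpen Mplus)
    (hfix : frontier Mplus ⊆ fixedPoints J) (hf : IsMeromorphic f)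
    (hn : ∀ (c : ℂ) (p : M), orderAt (fun q => f q - c) p ≠ ⊤)
    (hfin : {q | ¬ Good f (reflect J f) q}.Finite)
    (h0 : ∀ p ∈ frontier Mplus, orderAt f p = 0)
    (hh : MDifferentiableOn 𝓘(ℂ) 𝓘(ℂ) h Mplus) (hi : IntegrableOn h Mplus (sphericalMeasure f))
    (p : M) :
    ∃ U : Set M, IsOpen U ∧ p ∈ U ∧
      (∀ q ∈ U, q ∈ Mplus → ¬ Good f (reflect J f) q → q = p) ∧
      ∀ ρ : M → ℝ, ContMDiff 𝓘(ℝ, ℂ) 𝓘(ℝ) ∞ ρ → tsupport ρ ⊆ U →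
        (p ∈ Mplus → ¬ Good f (reflect J f) p → ρ =ᶠ[𝓝 p] 1) →
        GreenFormula f (reflect J f) h Mplus ρ
          (if p ∈ Mplus ∧ ¬ Good f (reflect J f) p then residueTerm f (reflect J f) h p else 0) := by
  set g := reflect J f
  by_cases hp : p ∈ Mplus
  · set U := (chartAt ℂ p).source ∩ Mplus ∩ ({q | ¬ Good f g q} \ {p})ᶜ with hU
    have hUo : IsOpen U := ((chartAt ℂ p).open_source.inter hop).inter
      (hfin.subset Set.sdiff_subset).isClosed.isOpen_compl
    have hpU : p ∈ U := ⟨⟨mem_chart_source ℂ p, hp⟩, fun h' => h'.2 rfl⟩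
    have hUg : ∀ q ∈ U, q ≠ p → Good f g q := fun q hq hqp => by
      by_contra hg
      exact hq.2 ⟨hg, hqp⟩
    refine ⟨U, hUo, hpU, fun q hq _ hg => ?_, fun ρ hρ hs h1 => ?_⟩
    · by_contra hqp
      exact hg (hUg q hq hqp)
    · have key := greenFormula_interior hf (hf.reflect hJ) hfin hop hh hUo hpU
        (fun q hq => hq.1.1) (fun q hq => hq.1.2) hUg hρ hs
      by_cases hg : Good f g p
      · rw [if_neg fun h' => h'.2 hg]
        exact key.1 hg
      · rw [if_pos ⟨hp, hg⟩]
        exact key.2 (h1 hp hg)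
  · rw [if_neg fun h' => hp h'.1]
    by_cases hfr : p ∈ frontier Mplus
    · obtain ⟨U, hU, hpU, hG⟩ := greenFormula_boundary hJi hJ hop hfix hf hn hfin hh hi hfr (h0 p hfr)
      have hSc := (hfin.subset (Set.inter_subset_right (s := Mplus))).isClosed
      exact ⟨U ∩ (Mplus ∩ {q | ¬ Good f g q})ᶜ, hU.inter hSc.isOpen_compl, ⟨hpU, fun h' => hp h'.1⟩,
        fun q hq hqM hg => absurd ⟨hqM, hg⟩ hq.2,
        fun ρ hρ hs _ => hG ρ hρ (hs.trans Set.inter_subset_left)⟩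
    · have hcl : p ∉ closure Mplus := fun h' => hfr (by
        rw [hop.frontier_eq]
        exact ⟨h', hp⟩)
      exact ⟨(closure Mplus)ᶜ, isClosed_closure.isOpen_compl, hcl,
        fun q hq hqM _ => absurd (subset_closure hqM) hq,
        fun ρ hρ hs _ => greenFormula_of_disjoint hop
          (Set.disjoint_left.mpr fun q hq hqM => hs hq (subset_closure hqM))⟩

/-- The integral of a holomorphic function against the spherical area form is a sum of local
contributions. -/
theorem integral_eq_sum_residueTerm (hJi : Involutive J) (hJ : IsAntiholomorphic J)
    (hop : IsOpen Mplus) (hfix : frontier Mplus ⊆ fixedPoints J) (hf : IsMeromorphic f)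
    (hn : ∀ (c : ℂ) (p : M), orderAt (fun q => f q - c) p ≠ ⊤)
    (hfin : {q | ¬ Good f (reflect J f) q}.Finite)
    (h0 : ∀ p ∈ frontier Mplus, orderAt f p = 0)
    (hh : MDifferentiableOn 𝓘(ℂ) 𝓘(ℂ) h Mplus) (hi : IntegrableOn h Mplus (sphericalMeasure f)) :
    ∫ q in Mplus, h q ∂(sphericalMeasure f) =
      ∑ᶠ p ∈ {q ∈ Mplus | ¬ Good f (reflect J f) q}, residueTerm f (reflect J f) h p := by
  classical
  have := isManifold_real (M := M)
  set g := reflect J f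
  choose U hUo hpU hUS hG using exists_greenFormula hJi hJ hop hfix hf hn hfin h0 hh hi
  obtain ⟨P, hP⟩ := SmoothPartitionOfUnity.exists_isSubordinate 𝓘(ℝ, ℂ) (s := (Set.univ : Set M))
    isClosed_univ U hUo fun q _ => Set.mem_iUnion.mpr ⟨q, hpU q⟩
  have hfinP : {i | (support (P i)).Nonempty}.Finite := P.locallyFinite.finite_nonempty_of_compact
  set t := hfinP.toFinset with ht
  have hsum : ∀ q, ∑ i ∈ t, P i q = 1 := fun q => by
    refine P.sum_finsupport' q (Set.mem_univ q) fun i hi => ?_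
    rw [ht, Set.Finite.mem_toFinset]
    exact ⟨q, (P.mem_finsupport q).mp hi⟩
  have hsm : ∀ i, ContMDiff 𝓘(ℝ, ℂ) 𝓘(ℝ) ∞ (P i) := fun i => (P i).contMDiff
  -- Every other member of the partition vanishes near a singular `p`, since its set does not
  -- contain `p`.
  have hone : ∀ p ∈ Mplus, ¬ Good f g p → P p =ᶠ[𝓝 p] 1 := by
    intro p hp hg
    have hev : ∀ i ∈ t.erase p, ∀ᶠ q in 𝓝 p, P i q = 0 := fun i hi => by
      have : p ∉ tsupport (P i) := fun h' =>
        (Finset.mem_erase.mp hi).1 (hUS i p (hP i h') hp hg).symm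
      exact notMem_tsupport_iff_eventuallyEq.mp this
    filter_upwards [(Finset.eventually_all _).mpr hev] with q hq
    have h1 := hsum q
    by_cases hpt : p ∈ t
    · rw [← Finset.add_sum_erase t _ hpt, Finset.sum_eq_zero hq, add_zero] at h1
      exact h1
    · rw [Finset.erase_eq_of_notMem hpt] at hq
      rw [Finset.sum_eq_zero hq] at h1
      exact absurd h1 zero_ne_one
  have hGi : ∀ i, GreenFormula f g h Mplus (P i) _ := fun i => hG i (P i) (hsm i) (hP i) (hone i)
  have hint : ∀ i ∈ t, Integrable (fun q => (P i q : ℂ) * h q) ((sphericalMeasure f).restrict Mplus) := by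
    intro i _
    refine Integrable.bdd_mul (c := 1) hi
      (continuous_ofReal.comp (P i).contMDiff.continuous).aestronglyMeasurable
      (Eventually.of_forall fun q => ?_)
    rw [norm_real, Real.norm_eq_abs, abs_of_nonneg (P.nonneg i q)]
    exact P.le_one i q
  have e1 : ∫ q in Mplus, h q ∂(sphericalMeasure f) =
      ∑ i ∈ t, ∫ q in Mplus, P i q * h q ∂(sphericalMeasure f) := by
    rw [← integral_finsetSum t hint]
    refine integral_congr_ae (Eventually.of_forall fun q => ?_)
    have h1 : (∑ i ∈ t, (P i q : ℂ)) = 1 := by exact_mod_cast hsum q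
    simp only
    rw [← Finset.sum_mul, h1, one_mul]
  have e2 : ∑ i ∈ t, ∫ q in Mplus, boundaryTerm f g h (P i) q ∂(sphericalMeasure f) = 0 := by
    rw [← integral_finsetSum t fun i _ => (hGi i).1]
    simp [sum_boundaryTerm hsm hsum]
  rw [e1, Finset.sum_congr rfl fun i _ => (hGi i).2, Finset.sum_add_distrib,
    Finset.sum_neg_distrib, e2, neg_zero, zero_add, ← Finset.sum_filter,
    ← finsum_mem_coe_finset]
  refine finsum_mem_congr ?_ fun _ _ => rfl
  ext p
  simp only [Finset.coe_filter, Set.mem_ofPred_eq, ht, Set.Finite.mem_toFinset]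
  refine ⟨fun h' => h'.2, fun h' => ⟨⟨p, ?_⟩, h'⟩⟩
  rw [mem_support, (hone p h'.1 h'.2).eq_of_nhds]
  exact one_ne_zero

end Sum

end RiemannSurface

/-! ### Orders and residues of the two differentials. -/

namespace RiemannSurface

section Plane

variable {F G H : ℂ → ℂ} {z₀ : ℂ}

lemma meromorphicOrderAt_deriv_nonneg (hF : MeromorphicAt F z₀)
    (h : 0 ≤ meromorphicOrderAt F z₀) : 0 ≤ meromorphicOrderAt (deriv F) z₀ := by
  obtain ⟨g, hg, he⟩ := hF.meromorphicOrderAt_nonneg_iff.mp h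
  rw [meromorphicOrderAt_congr he.nhdsNE_deriv]
  exact hg.deriv.meromorphicOrderAt_nonneg

lemma meromorphicOrderAt_one : meromorphicOrderAt (fun _ : ℂ => (1 : ℂ)) z₀ = 0 := by
  classical
  rw [meromorphicOrderAt_const, if_neg one_ne_zero]

lemma meromorphicOrderAt_one_add_of_neg (h : meromorphicOrderAt F z₀ < 0) :
    meromorphicOrderAt (fun z => 1 + F z) z₀ = meromorphicOrderAt F z₀ :=
  meromorphicOrderAt_add_eq_right_of_lt (MeromorphicAt.const 1 z₀) (by rwa [meromorphicOrderAt_one])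

lemma meromorphicOrderAt_one_add_of_pos (hF : MeromorphicAt F z₀)
    (h : 0 < meromorphicOrderAt F z₀) : meromorphicOrderAt (fun z => 1 + F z) z₀ = 0 :=
  (meromorphicOrderAt_add_eq_left_of_lt (f₁ := fun _ => (1 : ℂ)) hF
    (by rwa [meromorphicOrderAt_one])).trans meromorphicOrderAt_one

lemma meromorphicOrderAt_one_add_nonneg (hF : MeromorphicAt F z₀)
    (h : 0 ≤ meromorphicOrderAt F z₀) : 0 ≤ meromorphicOrderAt (fun z => 1 + F z) z₀ :=
  (le_min meromorphicOrderAt_one.ge h).trans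
    (meromorphicOrderAt_add (f₁ := fun _ => (1 : ℂ)) (MeromorphicAt.const 1 z₀) hF)

/-- The sum of the two differentials is `H dF / F`, because `1/(F (1 + F G)) + G/(1 + F G) = 1/F`.
-/
lemma residue_add_residue {n : ℤ} (hF : MeromorphicAt F z₀) (hG : MeromorphicAt G z₀)
    (hH : AnalyticAt ℂ H z₀) (hn : meromorphicOrderAt F z₀ = n)
    (hk : meromorphicOrderAt (fun z => 1 + F z * G z) z₀ ≠ ⊤) :
    residue (fun z => H z / (F z * (1 + F z * G z)) * deriv F z) z₀ +
      residue (fun z => H z * G z / (1 + F z * G z) * deriv F z) z₀ = n * H z₀ := by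
  have hF' := hF.deriv
  have hHm := hH.meromorphicAt
  rw [← residue_add (by fun_prop) (by fun_prop), ← residue_mul_logDeriv hH hF hn]
  refine residue_congr ?_
  have h1 := (meromorphicOrderAt_ne_top_iff_eventually_ne_zero hF).mp (by rw [hn]; exact WithTop.coe_ne_top)
  have h2 := (meromorphicOrderAt_ne_top_iff_eventually_ne_zero (by fun_prop)).mp hk
  filter_upwards [h1, h2] with z hz hz'
  field_simp

lemma meromorphicOrderAt_merPrim_nonneg (hF : MeromorphicAt F z₀) (hG : MeromorphicAt G z₀)
    (hH : AnalyticAt ℂ H z₀) (hn : 0 ≤ meromorphicOrderAt F z₀)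
    (h : 0 ≤ meromorphicOrderAt G z₀ - meromorphicOrderAt (fun z => 1 + F z * G z) z₀) :
    0 ≤ meromorphicOrderAt (fun z => H z * G z / (1 + F z * G z) * deriv F z) z₀ := by
  have hF' := hF.deriv
  have hHm := hH.meromorphicAt
  have e : (fun z => H z * G z / (1 + F z * G z) * deriv F z) =
      H * (G / fun z => 1 + F z * G z) * deriv F := by
    ext z
    simp only [Pi.mul_apply, Pi.div_apply]
    ring
  have hK : MeromorphicAt (fun z => 1 + F z * G z) z₀ := by fun_prop
  rw [e, meromorphicOrderAt_mul (hHm.mul (hG.div hK)) hF', meromorphicOrderAt_mul hHm (hG.div hK),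
    meromorphicOrderAt_div hG hK]
  exact add_nonneg (add_nonneg hH.meromorphicOrderAt_nonneg h)
    (meromorphicOrderAt_deriv_nonneg hF hn)

/-- The residues where `1 + F G` does not vanish. -/
lemma residue_of_order_nonpos {n : ℤ} (hF : MeromorphicAt F z₀) (hG : MeromorphicAt G z₀)
    (hH : AnalyticAt ℂ H z₀) (hn : meromorphicOrderAt F z₀ = n)
    (hk : meromorphicOrderAt (fun z => 1 + F z * G z) z₀ ≠ ⊤)
    (hk0 : ¬ 0 < meromorphicOrderAt (fun z => 1 + F z * G z) z₀)
    (h1 : ¬ (n < 0 ∧ 0 < meromorphicOrderAt G z₀)) (h2 : ¬ (meromorphicOrderAt G z₀ < 0 ∧ 0 < n)) :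
    residue (fun z => H z / (F z * (1 + F z * G z)) * deriv F z) z₀ = n.toNat * H z₀ ∧
      residue (fun z => H z * G z / (1 + F z * G z) * deriv F z) z₀ = -((-n).toNat * H z₀) := by
  have hsum := residue_add_residue hF hG hH hn hk
  have hF' := hF.deriv
  have hHm := hH.meromorphicAt
  have hFG : meromorphicOrderAt (fun z => F z * G z) z₀ = n + meromorphicOrderAt G z₀ := by
    rw [← hn]
    exact meromorphicOrderAt_mul hF hG
  have hFGm : MeromorphicAt (fun z => F z * G z) z₀ := hF.mul hG
  have hK : MeromorphicAt (fun z => 1 + F z * G z) z₀ := by fun_prop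
  have hcast : ((n.toNat : ℂ)) - ((-n).toNat : ℂ) = n := by exact_mod_cast n.toNat_sub_toNat_neg
  rcases lt_or_ge n 0 with hn0 | hn0
  -- At a pole of `F`, `G` has no zero, so `1 + F G` has order `n + m < 0`. Dividing by it removes
  -- the simple pole of `F'/F`, and the first residue vanishes.
  · have hm : meromorphicOrderAt G z₀ ≤ 0 := not_lt.mp fun h => h1 ⟨hn0, h⟩
    obtain ⟨m, hm'⟩ := WithTop.ne_top_iff_exists.mp (ne_top_of_le_ne_top (WithTop.coe_ne_top (a := 0)) hm)
    rw [← hm'] at hFG hm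
    norm_cast at hFG hm
    have hk' := meromorphicOrderAt_one_add_of_neg (F := fun z => F z * G z) (z₀ := z₀) (by
      rw [hFG]
      exact_mod_cast (by lia : n + m < 0))
    rw [hFG] at hk'
    have hA : residue (fun z => H z / (F z * (1 + F z * G z)) * deriv F z) z₀ = 0 := by
      refine residue_eq_zero_of_order_nonneg (by fun_prop) ?_
      have e : (fun z => H z / (F z * (1 + F z * G z)) * deriv F z) =
          H * ((deriv F / F) / fun z => 1 + F z * G z) := by
        ext z
        simp only [Pi.mul_apply, Pi.div_apply]
        rw [div_mul_eq_mul_div, mul_div_assoc, div_div]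
      rw [e, meromorphicOrderAt_mul hHm ((hF'.div hF).div hK),
        meromorphicOrderAt_div (hF'.div hF) hK, meromorphicOrderAt_div hF' hF,
        meromorphicOrderAt_deriv_eq_sub_one (by exact_mod_cast hn0.ne) hn, hn, hk']
      refine add_nonneg hH.meromorphicOrderAt_nonneg ?_
      have : (0 : ℤ) ≤ n - 1 - n - (n + m) := by lia
      exact_mod_cast this
    rw [hA, zero_add] at hsum
    have h0 : n.toNat = 0 := Int.toNat_of_nonpos hn0.le
    rw [h0, Nat.cast_zero, zero_sub] at hcast
    rw [hA, hsum, h0, ← hcast]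
    simp
  · have h0 : (-n).toNat = 0 := Int.toNat_of_nonpos (by lia)
    have hn0' : 0 ≤ meromorphicOrderAt F z₀ := by
      rw [hn]
      exact_mod_cast hn0
    -- If `G` has a pole, then `n = 0` and `1 + F G` has the order of `G`; otherwise `1 + F G` has
    -- order `0`. So `G/(1 + F G)` is regular and the second residue vanishes.
    have hord : 0 ≤ meromorphicOrderAt G z₀ - meromorphicOrderAt (fun z => 1 + F z * G z) z₀ := by
      rcases lt_or_ge (meromorphicOrderAt G z₀) 0 with hm | hm
      · have : n = 0 := le_antisymm (not_lt.mp fun h => h2 ⟨hm, h⟩) hn0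
        rw [this] at hFG
        have h3 : meromorphicOrderAt (fun z => F z * G z) z₀ = meromorphicOrderAt G z₀ := by
          rw [hFG]
          exact zero_add _
        rw [meromorphicOrderAt_one_add_of_neg (F := fun z => F z * G z) (by rwa [h3]), h3]
        obtain ⟨m, hm'⟩ := WithTop.ne_top_iff_exists.mp hm.ne_top
        rw [← hm']
        exact_mod_cast (by lia : (0 : ℤ) ≤ m - m)
      · have h3 := meromorphicOrderAt_one_add_nonneg hFGm (by
          rw [hFG]
          exact add_nonneg (by exact_mod_cast hn0) hm)
        rw [le_antisymm (not_lt.mp hk0) h3, sub_zero]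
        exact hm
    have hB := residue_eq_zero_of_order_nonneg (by fun_prop)
      (meromorphicOrderAt_merPrim_nonneg hF hG hH hn0' hord)
    rw [hB, add_zero] at hsum
    rw [h0, Nat.cast_zero, sub_zero] at hcast
    rw [hB, hsum, h0, hcast]
    simp

/-- Where `1 + F G` vanishes, `F` has neither a zero nor a pole. -/
lemma eq_zero_of_order_pos {n : ℤ} (hF : MeromorphicAt F z₀) (hG : MeromorphicAt G z₀)
    (hn : meromorphicOrderAt F z₀ = n)
    (hk : 0 < meromorphicOrderAt (fun z => 1 + F z * G z) z₀)
    (h1 : ¬ (n < 0 ∧ 0 < meromorphicOrderAt G z₀)) (h2 : ¬ (meromorphicOrderAt G z₀ < 0 ∧ 0 < n)) :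
    n = 0 := by
  have hFG : meromorphicOrderAt (fun z => F z * G z) z₀ = n + meromorphicOrderAt G z₀ := by
    rw [← hn]
    exact meromorphicOrderAt_mul hF hG
  -- A pole of `F` would be a pole of `F G`, and a zero of `F` a zero of `F G`; in neither case can
  -- `1 + F G` vanish.
  rcases lt_trichotomy n 0 with h | h | h
  · have h3 : meromorphicOrderAt (fun z => F z * G z) z₀ < 0 := by
      have hm : meromorphicOrderAt G z₀ ≤ 0 := not_lt.mp fun h' => h1 ⟨h, h'⟩
      rw [hFG]
      exact add_neg_of_neg_of_nonpos (by exact_mod_cast h) hm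
    rw [meromorphicOrderAt_one_add_of_neg h3] at hk
    exact absurd hk h3.not_gt
  · exact h
  · have h3 : 0 < meromorphicOrderAt (fun z => F z * G z) z₀ := by
      have hm : 0 ≤ meromorphicOrderAt G z₀ := not_lt.mp fun h' => h2 ⟨h', h⟩
      rw [hFG]
      exact add_pos_of_pos_of_nonneg (by exact_mod_cast h) hm
    rw [meromorphicOrderAt_one_add_of_pos (F := fun z => F z * G z) (hF.mul hG) h3] at hk
    exact absurd hk (lt_irrefl _)

end Plane

end RiemannSurface

/-! ### Order facts on the surface for the final assembly. -/

namespace RiemannSurface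

section Global

variable {M : Type*} [TopologicalSpace M] [ChartedSpace ℂ M] {J : M → M} {f g h : M → ℂ}
  {Mplus : Set M} {p : M}

lemma inChart_coord (f : M → ℂ) (p : M) : inChart f p (coord p) = f p := by
  rw [inChart, coord, (chartAt ℂ p).left_inv (mem_chart_source ℂ p)]

lemma regAt_of_mdifferentiableOn [IsManifold 𝓘(ℂ) ω M] (hop : IsOpen Mplus)
    (hh : MDifferentiableOn 𝓘(ℂ) 𝓘(ℂ) h Mplus) (hp : p ∈ Mplus) : RegAt h p := by
  refine (differentiableOn_comp_symm hop hh (chart_mem_atlas ℂ p)).analyticAt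
    (((chartAt ℂ p).isOpen_inter_preimage_symm hop).mem_nhds ⟨coord_mem_target p, ?_⟩)
  rwa [Set.mem_preimage, coord, (chartAt ℂ p).left_inv (mem_chart_source ℂ p)]

/-- `1 + f f^*` does not vanish identically near a fixed point of `J` where `f` is finite. -/
lemma orderAt_one_add_reflect_ne_top (hJi : Involutive J) (hJ : IsAntiholomorphic J)
    (hf : IsMeromorphic f) (hp : J p = p) (h0 : orderAt f p = 0) :
    orderAt (fun q => 1 + f q * reflect J f q) p ≠ ⊤ := by
  -- If `f` tends to `a` at `p`, then `f*` tends to `conj a`, so `1 + f f*` tends to `1 + |a|² ≠ 0`.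
  obtain ⟨a, -, ha⟩ := (tendsto_ne_zero_iff_meromorphicOrderAt_eq_zero (hf p)).mpr h0
  have hfa : Tendsto f (𝓝[≠] p) (𝓝 a) := by
    refine (ha.comp (tendsto_chart_punctured (mem_chart_source ℂ p))).congr' ?_
    filter_upwards [mem_nhdsWithin_of_mem_nhds (chart_source_mem_nhds ℂ p)] with q hq
    simp [inChart, (chartAt ℂ p).left_inv hq]
  have hJt : Tendsto J (𝓝[≠] p) (𝓝[≠] p) := by
    have h1 : Tendsto J (𝓝[≠] p) (𝓝[≠] (J p)) :=
      hJ.1.continuousAt.tendsto.mono_left nhdsWithin_le_nhds |> fun ht =>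
        tendsto_nhdsWithin_iff.mpr ⟨ht, by
          filter_upwards [self_mem_nhdsWithin] with q hq hq'
          exact hq (hJi.injective hq')⟩
    rwa [hp] at h1
  have hga : Tendsto (reflect J f) (𝓝[≠] p) (𝓝 (conj a)) :=
    (continuous_conj.tendsto a).comp (hfa.comp hJt)
  intro htop
  have h1 : Tendsto (fun q => 1 + f q * reflect J f q) (𝓝[≠] p) (𝓝 0) :=
    tendsto_const_nhds.congr' ((orderAt_eq_top_iff.mp htop).mono fun q hq => hq.symm)
  exact one_add_mul_conj_ne_zero a
    (tendsto_nhds_unique ((tendsto_const_nhds (x := (1 : ℂ))).add (hfa.mul hga)) h1)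

lemma Good.orderAt_eq_zero (hp : Good f g p) : orderAt f p = 0 :=
  orderAt_eq_zero_of_regAt hp.reg hp.ne

lemma Good.orderAt_one_add_eq_zero (hp : Good f g p) : orderAt (fun q => 1 + f q * g q) p = 0 :=
  orderAt_eq_zero_of_regAt (analyticAt_const.add (AnalyticAt.mul hp.reg hp.reg')) hp.ne'

lemma Good.formCoeff_nonneg (hp : Good f g p) (hh : RegAt h p) :
    0 ≤ meromorphicOrderAt (formCoeff (fun q => h q / (f q * (1 + f q * g q))) f p) (coord p) ∧
      0 ≤ meromorphicOrderAt (formCoeff (fun q => h q * g q / (1 + f q * g q)) f p) (coord p) := by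
  have h1 : AnalyticAt ℂ (fun z => 1 + inChart f p z * inChart g p z) (coord p) :=
    analyticAt_const.add (AnalyticAt.mul hp.reg hp.reg')
  have h2 : 1 + inChart f p (coord p) * inChart g p (coord p) ≠ 0 := by
    simpa only [inChart_coord] using hp.ne'
  have h3 : inChart f p (coord p) ≠ 0 := by simpa only [inChart_coord] using hp.ne
  have hd : AnalyticAt ℂ (deriv (inChart f p)) (coord p) := AnalyticAt.deriv hp.reg
  exact ⟨((AnalyticAt.div hh (AnalyticAt.mul hp.reg h1) (mul_ne_zero h3 h2)).mul
      hd).meromorphicOrderAt_nonneg,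
    ((AnalyticAt.div (AnalyticAt.mul hh hp.reg') h1 h2).mul hd).meromorphicOrderAt_nonneg⟩

lemma coe_untop₀_orderAt (hn : orderAt f p ≠ ⊤) :
    meromorphicOrderAt (inChart f p) (coord p) = ((orderAt f p).untop₀ : ℤ) :=
  (WithTop.coe_untop₀_of_ne_top hn).symm

lemma meromorphicAt_formCoeff {a : M → ℂ} (ha : MeromorphicAt (inChart a p) (coord p))
    (hf : IsMeromorphic f) : MeromorphicAt (formCoeff a f p) (coord p) :=
  ha.mul (hf p).deriv

/-- The two residue contributions at a point agree. -/
lemma residueTerm_eq (hf : IsMeromorphic f) (hg : IsMeromorphic g) (hh : RegAt h p)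
    (hn : orderAt f p ≠ ⊤) (hk : orderAt (fun q => 1 + f q * g q) p ≠ ⊤) :
    residueTerm f g h p =
      -formResidue (fun q => h q / (f q * (1 + f q * g q))) f p + (zeroMult f p : ℂ) * h p := by
  have h1 := residue_add_residue (hf p) (hg p) hh (coe_untop₀_orderAt hn) hk
  have h2 : ((zeroMult f p : ℕ) : ℂ) - (poleMult f p : ℂ) = (orderAt f p).untop₀ := by
    exact_mod_cast (orderAt f p).untop₀.toNat_sub_toNat_neg
  rw [inChart_coord, ← h2] at h1
  change formResidue (fun q => h q / (f q * (1 + f q * g q))) f p +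
    formResidue (fun q => h q * g q / (1 + f q * g q)) f p = _ at h1
  rw [residueTerm]
  linear_combination h1

end Global

end RiemannSurface

/-! ### Assembly of the residue formulas. -/

theorem mainTheorem1
    -- a compact connected Riemann surface
    {M : Type*} [TopologicalSpace M] [T2Space M] [CompactSpace M] [ConnectedSpace M]
    [ChartedSpace ℂ M] [IsManifold 𝓘(ℂ) ω M] [MeasurableSpace M] [BorelSpace M]
    -- with an anti-conformal involution, of dividing type, and a chosen half
    (J : M → M) (hJ_inv : Function.Involutive J) (hJ : IsAntiholomorphic J)
    (h_dividing : (components (fixedPoints J)ᶜ).ncard = 2)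
    (Mplus : Set M) (hMplus : Mplus ∈ components (fixedPoints J)ᶜ)
    -- a non-constant meromorphic function without zeros and poles on the boundary of the half
    (f : M → ℂ) (hf : IsMeromorphic f)
    (hf_nonconst : ∀ c : ℂ, ¬ f =ᶠ[codiscrete M] fun _ => c)
    (hf_boundary : ∀ p ∈ frontier Mplus, orderAt f p = 0)
    -- a test function
    (h : M → ℂ) (hh : MDifferentiableOn 𝓘(ℂ) 𝓘(ℂ) h Mplus)
    (hh_int : IntegrableOn h Mplus (sphericalMeasure f)) :
    let fs : M → ℂ := reflect J f
    -- the coefficients of `df` in the two differentials, and the points where `1 + f f^* = 0`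
    let A : M → ℂ := fun p => h p / (f p * (1 + f p * fs p))
    let B : M → ℂ := fun p => h p * fs p / (1 + f p * fs p)
    let N : Set M := {p ∈ Mplus | 0 < orderAt (fun q => 1 + f q * fs q) p}
    -- all sums below are finite
    ({p ∈ Mplus | orderAt f p ≠ 0}.Finite ∧ N.Finite ∧
      (formSingularPoints A f Mplus).Finite ∧ (formSingularPoints B f Mplus).Finite) ∧
    (∫ p in Mplus, h p ∂(sphericalMeasure f) =
      -(∑ᶠ p ∈ formSingularPoints A f Mplus, formResidue A f p)
        + ∑ᶠ p ∈ Mplus, (zeroMult f p : ℂ) * h p) ∧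
    (∫ p in Mplus, h p ∂(sphericalMeasure f) =
      (∑ᶠ p ∈ formSingularPoints B f Mplus, formResidue B f p)
        + ∑ᶠ p ∈ Mplus, (poleMult f p : ℂ) * h p) ∧
    -- if neither of `f`, `f^*` vanishes at a pole of the other
    ((∀ p ∈ Mplus, ¬ (orderAt f p < 0 ∧ 0 < orderAt fs p) ∧
        ¬ (orderAt fs p < 0 ∧ 0 < orderAt f p)) →
      -- the explicit terms cancel against the residues at the points where `1 + f f^* ≠ 0`
      (∀ p ∈ Mplus \ N, formResidue A f p = (zeroMult f p : ℂ) * h p ∧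
        formResidue B f p = -((poleMult f p : ℂ) * h p)) ∧
      -- and only the residues at the points where `1 + f f^* = 0` remain
      (∫ p in Mplus, h p ∂(sphericalMeasure f) = -∑ᶠ p ∈ N, formResidue A f p) ∧
      (∫ p in Mplus, h p ∂(sphericalMeasure f) = ∑ᶠ p ∈ N, formResidue B f p)) := by
  intro fs A B N
  have := ChartedSpace.locallyConnectedSpace ℂ M
  have hop := isOpen_of_mem_components hJ.1 hMplus
  have hfix := frontier_subset_fixedPoints hJ.1 hMplus
  have hn := orderAt_sub_const_ne_top hf hf_nonconst
  have hn0 : ∀ p, orderAt f p ≠ ⊤ := fun p => by simpa using hn 0 p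
  have hg : IsMeromorphic fs := hf.reflect hJ
  have hK : IsMeromorphic fun q => 1 + f q * fs q := (IsMeromorphic.const 1).add (hf.mul hg)
  -- Nonvanishing near a boundary point spreads over `M` by the identity theorem.
  have hk : ∀ p, orderAt (fun q => 1 + f q * fs q) p ≠ ⊤ := fun p h' => by
    obtain ⟨q, hq⟩ := frontier_nonempty h_dividing hMplus
    exact orderAt_one_add_reflect_ne_top hJ_inv hJ hf (hfix hq) (hf_boundary q hq)
      (hK.orderAt_eq_top h' q)
  have hfin : {q | ¬ Good f fs q}.Finite :=
    finite_of_eventually_punctured (eventually_good hf hg hn hk)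
  have hreg : ∀ p ∈ Mplus, RegAt h p := fun p hp => regAt_of_mdifferentiableOn hop hh hp
  have hint := integral_eq_sum_residueTerm hJ_inv hJ hop hfix hf hn hfin hf_boundary hh hh_int
  set S := {q ∈ Mplus | ¬ Good f fs q} with hS_def
  have hS : S.Finite := hfin.subset fun q hq => hq.2
  have hZS : {p ∈ Mplus | orderAt f p ≠ 0} ⊆ S := fun p hp =>
    ⟨hp.1, fun hg' => hp.2 hg'.orderAt_eq_zero⟩
  have hNS : N ⊆ S := fun p hp => ⟨hp.1, fun hg' => hp.2.ne' hg'.orderAt_one_add_eq_zero⟩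
  have hAS : formSingularPoints A f Mplus ⊆ S := fun p hp =>
    ⟨hp.1, fun hg' => hp.2.not_ge (hg'.formCoeff_nonneg (hreg p hp.1)).1⟩
  have hBS : formSingularPoints B f Mplus ⊆ S := fun p hp =>
    ⟨hp.1, fun hg' => hp.2.not_ge (hg'.formCoeff_nonneg (hreg p hp.1)).2⟩
  have hAm : ∀ p ∈ Mplus, MeromorphicAt (formCoeff A f p) (coord p) := fun p hp =>
    meromorphicAt_formCoeff ((hreg p hp).meromorphicAt.div ((hf p).mul (hK p))) hf
  have hBm : ∀ p ∈ Mplus, MeromorphicAt (formCoeff B f p) (coord p) := fun p hp =>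
    meromorphicAt_formCoeff (((hreg p hp).meromorphicAt.mul (hg p)).div (hK p)) hf
  have hzero : ∀ p ∈ Mplus, Good f fs p → zeroMult f p = 0 ∧ poleMult f p = 0 := fun p _ hg' => by
    simp [zeroMult, poleMult, hg'.orderAt_eq_zero]
  -- The finite set `S` serves as common index set: points of `S` that are not poles of the
  -- differential have residue zero.
  have hsing : ∀ a : M → ℂ, (∀ p ∈ Mplus, MeromorphicAt (formCoeff a f p) (coord p)) →
      formSingularPoints a f Mplus ⊆ S →
      ∑ᶠ p ∈ S, formResidue a f p = ∑ᶠ p ∈ formSingularPoints a f Mplus, formResidue a f p := by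
    intro a ha hsub
    refine finsum_mem_inter_support_eq' _ _ _ fun p hp => ⟨fun hpS => ⟨hpS.1, ?_⟩, fun h' => hsub h'⟩
    by_contra hge
    exact hp (residue_eq_zero_of_order_nonneg (ha p hpS.1) (not_lt.mp hge))
  have hmult : ∀ m : M → ℕ, (∀ p ∈ Mplus, Good f fs p → m p = 0) →
      ∑ᶠ p ∈ S, (m p : ℂ) * h p = ∑ᶠ p ∈ Mplus, (m p : ℂ) * h p := by
    intro m hm
    refine finsum_mem_inter_support_eq' _ _ _ fun p hp => ⟨fun hpS => hpS.1, fun hpM => ⟨hpM, ?_⟩⟩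
    intro hg'
    refine hp ?_
    simp only [hm p hpM hg', Nat.cast_zero, zero_mul]
  have hterm : ∀ p ∈ S, residueTerm f fs h p = -formResidue A f p + (zeroMult f p : ℂ) * h p :=
    fun p hp => residueTerm_eq hf hg (hreg p hp.1) (hn0 p) (hk p)
  refine ⟨⟨hS.subset hZS, hS.subset hNS, hS.subset hAS, hS.subset hBS⟩, ?_, ?_, fun hcancel => ?_⟩
  · rw [hint, finsum_mem_congr rfl hterm, finsum_mem_add_distrib hS, finsum_mem_neg_distrib _ hS,
      hsing A hAm hAS, hmult _ fun p hp hg' => (hzero p hp hg').1]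
  · rw [hint]
    simp only [residueTerm]
    rw [finsum_mem_add_distrib hS, hsing B hBm hBS, hmult _ fun p hp hg' => (hzero p hp hg').2]
  have horder : ∀ p, orderAt f p = ((orderAt f p).untop₀ : ℤ) := fun p => coe_untop₀_orderAt (hn0 p)
  have hc1 : ∀ p ∈ Mplus, ¬ ((orderAt f p).untop₀ < 0 ∧ 0 < orderAt fs p) := fun p hp h' =>
    (hcancel p hp).1 ⟨by rw [horder p]; exact_mod_cast h'.1, h'.2⟩
  have hc2 : ∀ p ∈ Mplus, ¬ (orderAt fs p < 0 ∧ 0 < (orderAt f p).untop₀) := fun p hp h' =>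
    (hcancel p hp).2 ⟨h'.1, by rw [horder p]; exact_mod_cast h'.2⟩
  have hres : ∀ p ∈ Mplus \ N, formResidue A f p = (zeroMult f p : ℂ) * h p ∧
      formResidue B f p = -((poleMult f p : ℂ) * h p) := by
    intro p hp
    have := residue_of_order_nonpos (hf p) (hg p) (hreg p hp.1) (coe_untop₀_orderAt (hn0 p)) (hk p)
      (fun h' => hp.2 ⟨hp.1, h'⟩) (hc1 p hp.1) (hc2 p hp.1)
    rwa [inChart_coord] at this
  have hNzero : ∀ p ∈ N, zeroMult f p = 0 ∧ poleMult f p = 0 := fun p hp => by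
    have := eq_zero_of_order_pos (hf p) (hg p) (coe_untop₀_orderAt (hn0 p)) hp.2 (hc1 p hp.1)
      (hc2 p hp.1)
    simp [zeroMult, poleMult, this]
  -- Off `N` the residue of the second differential cancels the pole term exactly.
  have hsumN : ∑ᶠ p ∈ S, residueTerm f fs h p = ∑ᶠ p ∈ N, residueTerm f fs h p := by
    refine finsum_mem_inter_support_eq' _ _ _ fun p hp => ⟨fun hpS => ?_, fun hpN => hNS hpN⟩
    by_contra hpN
    refine hp ?_
    change formResidue B f p + (poleMult f p : ℂ) * h p = 0
    rw [(hres p ⟨hpS.1, hpN⟩).2, neg_add_cancel]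
  refine ⟨hres, ?_, ?_⟩
  · rw [hint, hsumN, ← finsum_mem_neg_distrib _ (hS.subset hNS)]
    refine finsum_mem_congr rfl fun p hp => ?_
    rw [hterm p (hNS hp), (hNzero p hp).1, Nat.cast_zero, zero_mul, add_zero]
  · rw [hint, hsumN]
    refine finsum_mem_congr rfl fun p hp => ?_
    change formResidue B f p + (poleMult f p : ℂ) * h p = _
    rw [(hNzero p hp).2, Nat.cast_zero, zero_mul, add_zero]
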